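/- Let $k\ge 0$ be an integer and $n=4k+3$. **The graphs.** $\Gamma_k$ is the graph with vertices $a_0,\dots,a_n,b_1,b_2,b_3,c_1,c_2,c_3$ consisting of the path $a_0-a_1-\cdots-a_n$ and the two paths $a_n-b_1-b_2-b_3$ and $a_n-c_1-c_2-c_3$. $\Gamma'_k$ is the graph with vertices $a'_0,\dots,a'_n,f,g,\bar b_2,\bar c_2$ consisting of the path $a'_0-\cdots-a'_n$ and the edges $a'_n-f$, $a'_n-g$, $g-\bar b_2$, $g-\bar c_2$. **The algebra.** Let $G$ be the $0/1$ adjacency matrix between the even vertices $a_0,a_2,\dots,a_{n-1},b_1,c_1,b_3,c_3$ and the odd vertices $a_1,a_3,\dots,a_n,b_2,c_2$ of $\Gamma_k$, and let $\mathbb D=GG^t$, acting on $\ell^2$ of the even vertices. Define polynomials by $q_0=t^2-5t+3$, $q_1=(t-1)(t^3-8t^2+17t-5)$, $q_m=(t^2-4t+2)q_{m-1}-q_{m-2}$ for $m\ge2$. Put $t_1=0$, $t_2=2$, and let $t_3,\dots,t_{2k+4}$ be the roots of $q_k$, in any order. Let $\mu_j=\langle E_ja_0,a_0\rangle$, with $E_j$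 the orthogonal projection onto the eigenspace of $\mathbb D$ for $t_j$. Let $(e_{ij})$ be the matrix units of $M_{2k+4}(\mathbb R)$, let $$\mathcal B=\operatorname{span}_{\mathbb R}\{e_{11},e_{12},e_{21},e_{22},e_{33},\dots,e_{2k+4,2k+4}\}\cong M_2(\mathbb R)\oplus\mathbb R^{2k+2},$$ and put $\mu(b)=\sum_j\mu_jb_{jj}$ for $b\in\mathcal B$, and $A=\operatorname{diag}(0,\sqrt2,\sqrt{t_3},\dots,\sqrt{t_{2k+4}})\in\mathcal B$. **The elements.** Let $R_0=1$, $R_1=t$, $R_m=tR_{m-1}-R_{m-2}$, write $R_j$ for $R_j(A)$ below, and let $f_{ij}$ be the matrix units of $M_2(\mathbb R)$. In $M_2(\mathcal B)=\mathcal B\otimes M_2(\mathbb R)$ put, for $0\le j\le 2k+1$, $$\alpha_{2j}=R_{2j}\otimes f_{11},\quad \alpha_{2j+1}=R_{2j+1}\otimes f_{12},\quad \bar\alpha_{2j+1}=R_{2j+1}\otimes f_{21},\quad \alpha'_{2j}=R_{2j}\otimes f_{22},$$ and, with the upper sign for $\beta$ and the lower sign for $\gamma$, $$\beta_1,\gamma_1=\tfrac12\bigl(R_{n+1}\pm\sqrt{2k+3}\,(e_{12}+e_{21})\bigr)\otimes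 f_{11},$$ $$\beta_3,\gamma_3=\tfrac12\bigl(R_{n+3}-R_{n+1}-R_{n-1}\pm\sqrt{2k+3}\,(e_{12}-e_{21})\bigr)\otimes f_{11},$$ $$\beta_2,\gamma_2=\tfrac12\bigl(R_{n+2}-R_n\pm\sqrt{2(2k+3)}\,e_{12}\bigr)\otimes f_{12},\qquad \bar\beta_2,\bar\gamma_2=\tfrac12\bigl(R_{n+2}-R_n\pm\sqrt{2(2k+3)}\,e_{21}\bigr)\otimes f_{21},$$ $$f=\tfrac12(R_{n-1}+2R_{n+1}-R_{n+3})\otimes f_{22},\qquad g=\tfrac12(R_{n+3}-R_{n-1})\otimes f_{22}.$$ Let $V_{11}=\{\alpha_0,\alpha_2,\dots,\alpha_{n-1},\beta_1,\gamma_1,\beta_3,\gamma_3\}$, $V_{12}=\{\alpha_1,\alpha_3,\dots,\alpha_n,\beta_2,\gamma_2\}$, $V_{21}=\{\bar\alpha_1,\bar\alpha_3,\dots,\bar\alpha_n,\bar\beta_2,\bar\gamma_2\}$, $V_{22}=\{\alpha'_0,\alpha'_2,\dots,\alpha'_{n-1},f,g\}$ and $V=V_{11}\sqcup V_{12}\sqcup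 V_{21}\sqcup V_{22}$. Conjugation on $V$ exchanges $\alpha_{2j+1}\leftrightarrow\bar\alpha_{2j+1}$, $\beta_2\leftrightarrow\bar\beta_2$, $\gamma_2\leftrightarrow\bar\gamma_2$, $\beta_3\leftrightarrow\gamma_3$ and fixes all other elements. Put $\langle b\otimes f_{ij},c\otimes f_{ij}\rangle_\mu=\mu(bc^t)$. **Theorem.** The polynomial $q_k$ has $2k+2$ distinct real roots, all positive and different from $2$; $\mu$ is a faithful trace state on $\mathcal B$; and conjugation on $V$ is the transpose in $M_2(\mathcal B)$. Moreover $\mathbb ZV\subset M_2(\mathcal B)$ is a fusion ring with units $\alpha_0\in V_{11}$ and $\alpha'_0\in V_{22}$ and with coefficients $$N_{X,Y}^Z=\langle XY,Z\rangle_\mu\in\{0,1,2,\dots\}\qquad(X\in V_{ij},\ Y\in V_{jl},\ Z\in V_{il}).$$ That is: - the listed elements of $V$ are distinct and linearly independent over $\mathbb Z$; - $XY=\sum_{Z\in V_{il}}N_{X,Y}^ZZ$ for $X\in V_{ij}$, $Y\in V_{jl}$, and $XY=0$ for $X\in V_{ij}$, $Y\in V_{ml}$ with $j\ne m$; - conjugation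 is an involution mapping $V_{ij}$ onto $V_{ji}$, and $N_{X,Y}^Z=N_{Z,\bar Y}^X=N_{\bar X,Z}^Y=N_{\bar Y,\bar X}^{\bar Z}=N_{\bar Z,X}^{\bar Y}=N_{Y,\bar Z}^{\bar X}$; - $\alpha_0$ and $\alpha'_0$ act as identities on all elements of $V$ with matching index, on the left and on the right. Finally, the graph on $V_{11}\sqcup V_{12}$ with $N_{X,\alpha_1}^Y$ edges between $X\in V_{11}$ and $Y\in V_{12}$ (and no others) is $\Gamma_k$, and the graph on $V_{22}\sqcup V_{21}$ with $N_{X,\bar\alpha_1}^Y$ edges between $X\in V_{22}$ and $Y\in V_{21}$ (and no others) is $\Gamma'_k$. Here $\alpha_j,\beta_j,\gamma_j$ correspond to $a_j,b_j,c_j$; $\alpha'_{2j},\bar\alpha_{2j+1}$ to $a'_{2j},a'_{2j+1}$; $f,g$ to $f,g$; and $\bar\beta_2,\bar\gamma_2$ to $\bar b_2,\bar c_2$. -/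

import Mathlib

namespace GraphFusion

/-! ### Fusion rings -/

/-- `(x, y, z)` is a compatible triple: the product `x y` is defined (the right label of `x` is the
left label of `y`), and `z` has the left label of `x` and the right label of `y`. -/
def Compatible {ι : Type*} (left right : ι → Fin 2) (x y z : ι) : Prop :=
  right x = left y ∧ left z = left x ∧ right z = right y

instance {ι : Type*} (left right : ι → Fin 2) (x y z : ι) :
    Decidable (Compatible left right x y z) :=
  inferInstanceAs (Decidable (_ ∧ _ ∧ _))

/-- A family `V : ι → R` of elements of an ambient (associative) ring `R`, each with a left and a
right label in a two-element set, spans a bigraded fusion ring `ℤV ⊆ R`: the family is a finite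
`ℤ`-basis of `ℤV`, it carries an involution `conj` exchanging the two labels, products with
matching labels decompose with nonnegative integer coefficients `N x y z` (the others vanish), the
coefficients satisfy Frobenius reciprocity, and there is an identity element for each label.

In particular `V` is injective; the set `V_ij` is the set of all `V x` with `left x = i`
and `right x = j`. -/
structure IsFusionRing {R : Type*} [Ring R] {ι : Type*} [Fintype ι] (V : ι → R)
    (left right : ι → Fin 2) (conj : ι → ι) (one : Fin 2 → ι) (N : ι → ι → ι → ℕ) : Prop where
  linearIndependent : LinearIndependent ℤ V
  conj_conj : ∀ x, conj (conj x) = x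
  left_conj : ∀ x, left (conj x) = right x
  right_conj : ∀ x, right (conj x) = left x
  mul_eq_sum : ∀ x y, right x = left y →
    V x * V y = ∑ z with left z = left x ∧ right z = right y, N x y z • V z
  mul_eq_zero : ∀ x y, right x ≠ left y → V x * V y = 0
  frobenius : ∀ x y z, Compatible left right x y z →
    N x y z = N z (conj y) x ∧
    N x y z = N (conj x) z y ∧
    N x y z = N (conj y) (conj x) (conj z) ∧
    N x y z = N (conj z) x (conj y) ∧
    N x y z = N y (conj z) (conj x)
  left_one : ∀ i, left (one i) = i
  right_one : ∀ i, right (one i) = i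
  one_mul : ∀ x, V (one (left x)) * V x = V x
  mul_one : ∀ x, V x * V (one (right x)) = V x

/-- The number of edges between `x` and `y` in the graph obtained by right multiplication by `g`:
it is `N x g y` when `x g` is defined and `y` has the labels of `x g`, symmetrically in `x` and `y`,
and there are no other edges. -/
def edgeCount {ι : Type*} (left right : ι → Fin 2) (N : ι → ι → ι → ℕ) (g x y : ι) : ℕ :=
  if Compatible left right x g y then N x g y
  else if Compatible left right y g x then N y g x
  else 0

/-! ### The graphs; throughout, `n = 4 * k + 3` -/

/-- Vertices of the graph `Γ_k`: `a 0, …, a n`, and `b₁, b₂, b₃, c₁, c₂, c₃`. -/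
inductive GammaVertex (k : ℕ) : Type
  | a (j : Fin (4 * k + 4))
  | b1 | b2 | b3 | c1 | c2 | c3
  deriving DecidableEq, Fintype

/-- Each edge of `Γ_k`, in one direction: a path `a 0 - a 1 - ⋯ - a n`, continued at `a n` by the
two legs `b1 - b2 - b3` and `c1 - c2 - c3`. -/
def GammaEdge (k : ℕ) : GammaVertex k → GammaVertex k → Prop
  | .a i, .a j => i.val + 1 = j.val
  | .a i, .b1 => i.val = 4 * k + 3
  | .a i, .c1 => i.val = 4 * k + 3
  | .b1, .b2 => True
  | .b2, .b3 => True
  | .c1, .c2 => True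
  | .c2, .c3 => True
  | _, _ => False

/-- The graph `Γ_k`. -/
def Gamma (k : ℕ) : SimpleGraph (GammaVertex k) := SimpleGraph.fromRel (GammaEdge k)

/-- Odd vertices of `Γ_k`. -/
def GammaVertex.IsOdd {k : ℕ} : GammaVertex k → Prop
  | .a j => Odd j.val
  | .b2 => True
  | .c2 => True
  | _ => False

instance {k : ℕ} : DecidablePred (GammaVertex.IsOdd (k := k)) := fun v => by
  cases v <;> unfold GammaVertex.IsOdd <;> infer_instance

/-- Vertices of the graph `Γ'_k`: `a 0, …, a n`, and `f, g` and two more vertices. -/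
inductive GammaVertex' (k : ℕ) : Type
  | a (j : Fin (4 * k + 4))
  | f | g | b2bar | c2bar
  deriving DecidableEq, Fintype

/-- Each edge of `Γ'_k`, in one direction: a path `a 0 - a 1 - ⋯ - a n`, with `f` and `g` attached
to `a n`, and `b2bar` and `c2bar` attached to `g`. -/
def GammaEdge' (k : ℕ) : GammaVertex' k → GammaVertex' k → Prop
  | .a i, .a j => i.val + 1 = j.val
  | .a i, .f => i.val = 4 * k + 3
  | .a i, .g => i.val = 4 * k + 3
  | .g, .b2bar => True
  | .g, .c2bar => True
  | _, _ => False

/-- The graph `Γ'_k`. -/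
def Gamma' (k : ℕ) : SimpleGraph (GammaVertex' k) := SimpleGraph.fromRel (GammaEdge' k)

/-- Odd vertices of `Γ'_k`. -/
def GammaVertex'.IsOdd {k : ℕ} : GammaVertex' k → Prop
  | .a j => Odd j.val
  | .b2bar => True
  | .c2bar => True
  | _ => False

instance {k : ℕ} : DecidablePred (GammaVertex'.IsOdd (k := k)) := fun v => by
  cases v <;> unfold GammaVertex'.IsOdd <;> infer_instance

/-! ### The matrix `𝔻 = G Gᵗ`, the weights and the polynomials -/

open Classical in
/-- The adjacency matrix `G` between the even and the odd vertices of `Γ_k`. -/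
noncomputable def G (k : ℕ) :
    Matrix {v : GammaVertex k // ¬ v.IsOdd} {v : GammaVertex k // v.IsOdd} ℝ :=
  fun x y => if (Gamma k).Adj x.1 y.1 then 1 else 0

/-- The operator `𝔻 = G Gᵗ` on the Euclidean space `l²` of the even vertices of `Γ_k`. -/
noncomputable def DD (k : ℕ) :
    Module.End ℝ (EuclideanSpace ℝ {v : GammaVertex k // ¬ v.IsOdd}) :=
  Matrix.toEuclideanLin (G k * (G k).transpose)

/-- The unit vector at the vertex `a 0`. -/
noncomputable def a0 (k : ℕ) : EuclideanSpace ℝ {v : GammaVertex k // ¬ v.IsOdd} :=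
  EuclideanSpace.single ⟨.a 0, by simp [GammaVertex.IsOdd]⟩ 1

/-- `⟨E a₀, a₀⟩`, with `E` the orthogonal projection on the eigenspace of `𝔻` for `s`. -/
noncomputable def weight (k : ℕ) (s : ℝ) : ℝ :=
  inner ℝ (((DD k).eigenspace s).starProjection (a0 k)) (a0 k)

open Polynomial in
/-- The polynomials `q_k`. -/
noncomputable def q : ℕ → ℝ[X]
  | 0 => X ^ 2 - 5 * X + 3
  | 1 => (X - 1) * (X ^ 3 - 8 * X ^ 2 + 17 * X - 5)
  | k + 2 => (X ^ 2 - 4 * X + 2) * q (k + 1) - q k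

/-- `t` lists `2k + 2` distinct real roots of `q_k` (hence all its roots, as `q_k` has degree
`2k + 2`). -/
def IsRootList (k : ℕ) (t : Fin (2 * k + 2) → ℝ) : Prop :=
  Function.Injective t ∧ ∀ j, (q k).eval (t j) = 0

/-! ### The algebra `𝓑`, its trace, and the elements of `M₂(𝓑)` -/

/-- The real `*`-algebra `𝓑 = M₂(ℝ) ⊕ ℝ^{2k+2}`: block-diagonal real matrices of size `2k + 4` with
one block of size `2` and `2k + 2` blocks of size `1`; the involution is transposition. -/
abbrev B (k : ℕ) : Type := Matrix (Fin 2) (Fin 2) ℝ × (Fin (2 * k + 2) → ℝ)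

/-- The trace `μ(b) = ∑ μ_j b_jj`, the `μ_j` being the weights of `0`, `2` and the roots of `q_k`. -/
noncomputable def mu (k : ℕ) (t : Fin (2 * k + 2) → ℝ) (b : B k) : ℝ :=
  weight k 0 * b.1 0 0 + weight k 2 * b.1 1 1 + ∑ j, weight k (t j) * b.2 j

/-- The diagonal matrix `A` with entries `0`, `√2` and the square roots of the roots of `q_k`. -/
noncomputable def A (k : ℕ) (t : Fin (2 * k + 2) → ℝ) : B k :=
  (Matrix.diagonal ![0, √2], fun j => √(t j))

/-- `R_j(A)`, where `R_0 = 1`, `R_1 = X`, `R_{m+2} = X R_{m+1} - R_m` are the rescaled Chebyshev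
polynomials of the second kind. -/
noncomputable def RA (k : ℕ) (t : Fin (2 * k + 2) → ℝ) (j : ℕ) : B k :=
  Polynomial.aeval (A k t) (Polynomial.Chebyshev.S ℝ (j : ℤ))

/-- The matrix unit `e₁₂`. -/
def e12 (k : ℕ) : B k := (Matrix.single 0 1 1, 0)

/-- The matrix unit `e₂₁`. -/
def e21 (k : ℕ) : B k := (Matrix.single 1 0 1, 0)

/-- Labels for the elements of `V`: `V₁₁` and `V₁₂` are the even and the odd vertices of `Γ_k`,
`V₂₂` and `V₂₁` are the even and the odd vertices of `Γ'_k`. -/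
abbrev Label (k : ℕ) : Type := GammaVertex k ⊕ GammaVertex' k

/-- The row index `i` of `x ∈ V_ij`. -/
def left {k : ℕ} : Label k → Fin 2
  | .inl _ => 0
  | .inr _ => 1

/-- The column index `j` of `x ∈ V_ij`. -/
def right {k : ℕ} : Label k → Fin 2
  | .inl v => if v.IsOdd then 1 else 0
  | .inr v => if v.IsOdd then 0 else 1

/-- The conjugation: it exchanges `α_j` (`j` odd), `β₂`, `γ₂` with the corresponding elements of
`V₂₁`, exchanges `β₃` with `γ₃`, and fixes all other elements. -/
def conj {k : ℕ} : Label k → Label k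
  | .inl (.a j) => if Odd j.val then .inr (.a j) else .inl (.a j)
  | .inl .b1 => .inl .b1
  | .inl .c1 => .inl .c1
  | .inl .b2 => .inr .b2bar
  | .inl .c2 => .inr .c2bar
  | .inl .b3 => .inl .c3
  | .inl .c3 => .inl .b3
  | .inr (.a j) => if Odd j.val then .inl (.a j) else .inr (.a j)
  | .inr .f => .inr .f
  | .inr .g => .inr .g
  | .inr .b2bar => .inl .b2
  | .inr .c2bar => .inl .c2

/-- The units `α₀` and `α'₀`. -/
def unit (k : ℕ) : Fin 2 → Label k
  | 0 => .inl (.a 0)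
  | 1 => .inr (.a 0)

/-- The generator `α = α₁ ∈ V₁₂`. -/
def alpha (k : ℕ) : Label k := .inl (.a 1)

/-- The generator `ᾱ = ᾱ₁ ∈ V₂₁`. -/
def alphaBar (k : ℕ) : Label k := .inr (.a 1)

/-- The component `b ∈ 𝓑` of each element `b ⊗ f_ij` of `V`. In indices, `n = 4 * k + 3`. -/
noncomputable def entry (k : ℕ) (t : Fin (2 * k + 2) → ℝ) : Label k → B k
  | .inl (.a j) => RA k t j
  | .inl .b1 => (1 / 2 : ℝ) •
      (RA k t (4 * k + 4) + √(2 * k + 3) • (e12 k + e21 k))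
  | .inl .c1 => (1 / 2 : ℝ) •
      (RA k t (4 * k + 4) - √(2 * k + 3) • (e12 k + e21 k))
  | .inl .b3 => (1 / 2 : ℝ) •
      (RA k t (4 * k + 6) - RA k t (4 * k + 4) - RA k t (4 * k + 2)
        + √(2 * k + 3) • (e12 k - e21 k))
  | .inl .c3 => (1 / 2 : ℝ) •
      (RA k t (4 * k + 6) - RA k t (4 * k + 4) - RA k t (4 * k + 2)
        - √(2 * k + 3) • (e12 k - e21 k))
  | .inl .b2 => (1 / 2 : ℝ) •
      (RA k t (4 * k + 5) - RA k t (4 * k + 3) + √(2 * (2 * k + 3)) • e12 k)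
  | .inl .c2 => (1 / 2 : ℝ) •
      (RA k t (4 * k + 5) - RA k t (4 * k + 3) - √(2 * (2 * k + 3)) • e12 k)
  | .inr (.a j) => RA k t j
  | .inr .b2bar => (1 / 2 : ℝ) •
      (RA k t (4 * k + 5) - RA k t (4 * k + 3) + √(2 * (2 * k + 3)) • e21 k)
  | .inr .c2bar => (1 / 2 : ℝ) •
      (RA k t (4 * k + 5) - RA k t (4 * k + 3) - √(2 * (2 * k + 3)) • e21 k)
  | .inr .f => (1 / 2 : ℝ) •
      (RA k t (4 * k + 2) + (2 : ℝ) • RA k t (4 * k + 4) - RA k t (4 * k + 6))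
  | .inr .g => (1 / 2 : ℝ) •
      (RA k t (4 * k + 6) - RA k t (4 * k + 2))

/-- The elements of `V`, inside the ring `M₂(𝓑)`. -/
noncomputable def V (k : ℕ) (t : Fin (2 * k + 2) → ℝ) (x : Label k) :
    Matrix (Fin 2) (Fin 2) (B k) :=
  Matrix.single (left x) (right x) (entry k t x)

/-- The inner product on `M₂(𝓑)` making the four summands `𝓑 ⊗ f_ij` orthogonal, given by
`⟨b ⊗ f_ij, c ⊗ f_ij⟩ = μ(b cᵗ)` on each of them. -/
noncomputable def innerMu (k : ℕ) (t : Fin (2 * k + 2) → ℝ)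
    (X Y : Matrix (Fin 2) (Fin 2) (B k)) : ℝ :=
  ∑ i, ∑ j, mu k t (X i j * star (Y i j))

end GraphFusion

open GraphFusion

namespace GraphFusion

/-! The diagonal part of `𝓑` is the algebra of functions on the points `0`, `2` and the roots of
`q_k`. Write `S_{2j}(x) = T_j(x²)`. The vectors `T_j(𝔻) a₀` walk along the path of `Γ_k` and then
symmetrically into both legs, until one of them is a combination of its predecessors. Hence `X (X -
2) q_k` is the minimal polynomial of `a₀` under the positive semidefinite operator `𝔻 = G Gᵗ`. So
its roots are real, simple and nonnegative, the weights are positive, and `p ↦ p(𝔻) a₀` is an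
isometry for `μ`. Under this isometry the diagonal elements `α'_{2i}`, `f`, `g` become explicit
orthonormal vectors (`IsRootList.isForkTrace`).

From there on a Chebyshev sequence with a trace suffices (`IsForkTrace`). The Clebsch–Gordan rule
and the action of `R_1`, `R_2` on the ends `f`, `g` of `Γ'_k` turn the traces of triple products
into linear recurrences, which are solved by the Tribonacci sequence started at `1, 0, 0`.

Elements on the legs also have off-diagonal entries. The points `0` and `2` both have weight `1 /
(2k + 3)` (`IsRootList.weight_zero`, `IsRootList.weight_two`). Therefore `μ` is a trace, and the
factor `√(2k + 3)` of the off-diagonal entries cancels the weight. What remains are values at `0`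
and `√2`, which are signs up to simple factors. Each `μ(x y z)` is thus a Tribonacci combination
plus a sign correction, divided by 1, 2, 4 or 8. Modulo 8 the Tribonacci sequence has period 16, so
that integrality and nonnegativity become a finite check (`IsRootList.isNat_mu`).

Finally, each `V_ij` is orthonormal and has as many elements as the dimension of a subspace
`blockSpace k i j`, and these subspaces multiply into each other. So products expand in `V` with
coefficients `μ(x y zᵗ)`. Frobenius reciprocity is the invariance of `μ` under rotation and
transposition, and multiplication by `A` gives the two graphs. -/

/-! ### The Tribonacci sequence -/

/-- The Tribonacci sequence `1, 0, 0, 1, 1, 2, 4, 7, …`. -/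
def trib : ℕ → ℤ
  | 0 => 1
  | 1 => 0
  | 2 => 0
  | n + 3 => trib (n + 2) + trib (n + 1) + trib n

theorem trib_add_three (n : ℕ) : trib (n + 3) = trib (n + 2) + trib (n + 1) + trib n := by
  rw [trib]

theorem trib_zero : trib 0 = 1 := by rw [trib]

theorem trib_one : trib 1 = 0 := by rw [trib]

theorem trib_two : trib 2 = 0 := by rw [trib]

theorem trib_nonneg (n : ℕ) : 0 ≤ trib n := by
  induction n using trib.induct with
  | case1 => rw [trib_zero]; decide
  | case2 => rw [trib_one]
  | case3 => rw [trib_two]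
  | case4 n h₁ h₂ h₃ => rw [trib_add_three]; omega

/-- Tribonacci numbers with given initial values, computed in accumulators. -/
def tribFrom : ℤ → ℤ → ℤ → ℕ → ℤ
  | x, _, _, 0 => x
  | x, y, z, r + 1 => tribFrom y z (z + y + x) r

theorem trib_add (i r : ℕ) :
    trib (i + r) = tribFrom (trib i) (trib (i + 1)) (trib (i + 2)) r := by
  induction r generalizing i with
  | zero => rfl
  | succ r ih =>
    rw [tribFrom, ← trib_add_three, show i + (r + 1) = i + 1 + r by ring, ih]

theorem tribFrom_linear (x y z : ℤ) (r : ℕ) : tribFrom x y z r =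
    tribFrom 1 0 0 r * x + tribFrom 0 1 0 r * y + tribFrom 0 0 1 r * z := by
  have key : ∀ (r : ℕ) (c x y z x' y' z' : ℤ), tribFrom (c * x + x') (c * y + y') (c * z + z') r =
      c * tribFrom x y z r + tribFrom x' y' z' r := by
    intro r
    induction r with
    | zero => intros; rfl
    | succ r ih =>
      intro c x y z x' y' z'
      simp only [tribFrom]
      rw [← ih]
      congr 1
      ring
  have h0 : tribFrom 0 0 0 r = 0 := by
    have := key r 1 0 0 0 0 0 0
    simp at this
    exact this
  have h1 := key r x 1 0 0 (y * 0) (y * 1) (y * 0 + z)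
  have h2 := key r y 0 1 0 0 0 z
  have h3 := key r z 0 0 1 0 0 0
  simp only [mul_zero, mul_one, zero_add, add_zero, h0] at h1 h2 h3
  rw [h1, h2, h3]
  ring

/-- For a numeral `r` the coefficients evaluate to numerals, so a shift by `r` becomes linear
arithmetic in three unknowns. -/
theorem trib_add_eq (i r : ℕ) : trib (i + r) =
    tribFrom 1 0 0 r * trib i + tribFrom 0 1 0 r * trib (i + 1)
      + tribFrom 0 0 1 r * trib (i + 2) := by
  rw [trib_add, tribFrom_linear]

/-- The state `(1, 0, 0)` recurs modulo 8 after 16 steps. The quotients are kept together with their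
signs because nonnegativity is needed as well as divisibility. -/
theorem trib_mod (j : ℕ) :
    (∃ a : ℤ, trib (16 * j) = 8 * a + 1 ∧ 0 ≤ a) ∧ (∃ a : ℤ, trib (16 * j + 1) = 8 * a ∧ 0 ≤ a) ∧
      ∃ a : ℤ, trib (16 * j + 2) = 8 * a ∧ 0 ≤ a := by
  induction j with
  | zero => exact ⟨⟨0, by simp [trib_zero]⟩, ⟨0, by simp [trib_one]⟩, ⟨0, by simp [trib_two]⟩⟩
  | succ j ih =>
    obtain ⟨⟨a, ha, ha0⟩, ⟨b, hb, hb0⟩, ⟨c, hc, hc0⟩⟩ := ih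
    have e0 := trib_add_eq (16 * j) 16
    have e1 := trib_add_eq (16 * j) 17
    have e2 := trib_add_eq (16 * j) 18
    simp only [tribFrom, Int.reduceAdd, ha, hb, hc] at e0 e1 e2
    have h : 16 * (j + 1) = 16 * j + 16 := by ring
    rw [h, show 16 * j + 16 + 1 = 16 * j + 17 by ring, show 16 * j + 16 + 2 = 16 * j + 18 by ring]
    refine ⟨⟨(trib (16 * j + 16) - 1) / 8, ?_⟩, ⟨trib (16 * j + 17) / 8, ?_⟩,
      ⟨trib (16 * j + 18) / 8, ?_⟩⟩ <;> omega

/-- Any claim on Tribonacci numbers near `i` becomes, for each of the 16 values of `r`, a linear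
claim in `a`, `b`, `c` that `omega` decides. -/
theorem trib_block (i : ℕ) : ∃ a b c : ℤ, 0 ≤ a ∧ 0 ≤ b ∧ 0 ≤ c ∧ ∃ j r : ℕ, i = 16 * j + r ∧
    r < 16 ∧ ∀ s, trib (16 * j + s) =
      tribFrom 1 0 0 s * (8 * a + 1) + tribFrom 0 1 0 s * (8 * b) + tribFrom 0 0 1 s * (8 * c) := by
  obtain ⟨⟨a, ha, ha0⟩, ⟨b, hb, hb0⟩, ⟨c, hc, hc0⟩⟩ := trib_mod (i / 16)
  refine ⟨a, b, c, ha0, hb0, hc0, i / 16, i % 16, by omega, by omega, fun s => ?_⟩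
  rw [trib_add_eq, ha, hb, hc]

/-- `x` is a natural number. -/
def IsNat (x : ℝ) : Prop := ∃ n : ℕ, x = n

theorem IsNat.add {x y : ℝ} (hx : IsNat x) (hy : IsNat y) : IsNat (x + y) := by
  obtain ⟨a, rfl⟩ := hx
  obtain ⟨b, rfl⟩ := hy
  exact ⟨a + b, by push_cast; rfl⟩

theorem IsNat.sum {ι : Type*} (s : Finset ι) {f : ι → ℝ} (h : ∀ i ∈ s, IsNat (f i)) :
    IsNat (∑ i ∈ s, f i) := by
  classical
  induction s using Finset.induction_on with
  | empty => exact ⟨0, by simp⟩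
  | insert a s ha ih =>
    rw [Finset.sum_insert ha]
    exact (h a (by simp)).add (ih fun i hi => h i (by simp [hi]))

theorem isNat_zero : IsNat 0 := ⟨0, by simp⟩

theorem isNat_one : IsNat 1 := ⟨1, by simp⟩

/-- The common exit of the integrality proofs: `d` clears the halves in the definitions of the
elements and is 1, 2, 4 or 8. -/
theorem isNat_of_mul_eq {x : ℝ} (d : ℕ) (hd : 0 < d) {a : ℤ} (h : (d : ℝ) * x = a)
    (ha : 0 ≤ a ∧ (d : ℤ) ∣ a) : IsNat x := by
  obtain ⟨ha, b, rfl⟩ := ha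
  have hb : 0 ≤ b := by
    by_contra hb
    push Not at hb
    have : (d : ℤ) * b < 0 := mul_neg_of_pos_of_neg (by exact_mod_cast hd) hb
    omega
  lift b to ℕ using hb
  refine ⟨b, ?_⟩
  have : (d : ℝ) ≠ 0 := by positivity
  push_cast at h
  exact mul_left_cancel₀ this h

theorem isNat_trib (i : ℕ) : IsNat (trib i) :=
  isNat_of_mul_eq 1 one_pos (a := trib i) (by simp) ⟨trib_nonneg i, by simp⟩

/-! ### Divisibility and nonnegativity of the Tribonacci combinations occurring as structure
constants -/

/-- The value of `S_{2i}` at `0`. -/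
def valZero (i : ℕ) : ℤ := if i % 2 = 0 then 1 else -1

/-- The value of `S_{2i}` at `√2`. -/
def valTwo (i : ℕ) : ℤ := if i % 4 < 2 then 1 else -1

theorem valZero_add (j r : ℕ) : valZero (16 * j + r) = valZero r := by
  unfold valZero
  rw [show (16 * j + r) % 2 = r % 2 by omega]

theorem valTwo_add (j r : ℕ) : valTwo (16 * j + r) = valTwo r := by
  unfold valTwo
  rw [show (16 * j + r) % 4 = r % 4 by omega]

/-- Here `a` is four times the trace of `R (2 * i)` times two leg ends of types `φ`, `φ'`, and `e`
is the product of their signs. The last summand comes from the off-diagonal entries. -/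
theorem trib_leg_leg (i : ℕ) {φ φ' e : ℤ} (hφ : φ = 1 ∨ φ = -1) (hφ' : φ' = 1 ∨ φ' = -1)
    (he : e = 1 ∨ e = -1) {a : ℤ}
    (h : a = trib (i + 2) + trib (i + 3) + (φ + φ') * (trib (i + 1) + trib (i + 2))
        + φ * φ' * (trib i + trib (i + 1)) + e * (φ' * valZero i + φ * valTwo i)) :
    0 ≤ a ∧ 4 ∣ a := by
  obtain ⟨a, b, c, ha, hb, hc, j, r, rfl, hr, ht⟩ := trib_block i
  rw [valZero_add, valTwo_add] at h
  simp only [Nat.add_assoc, ht] at h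
  clear ht
  interval_cases r <;> simp [tribFrom, valZero, valTwo] at h <;>
    rcases hφ with rfl | rfl <;> rcases hφ' with rfl | rfl <;> rcases he with rfl | rfl <;> omega

/-- Serves for an even path vertex times two middle leg vertices in the order `V₁₂`, `V₂₁`, where
the off-diagonal entries meet at the point `0`. In the order `V₂₁`, `V₁₂` they meet at `√2`, whence
the variant with `valTwo`. -/
theorem trib_odd_odd_zero (i : ℕ) {e : ℤ} (he : e = 1 ∨ e = -1) {a : ℤ}
    (h : a = trib (i + 2) + 2 * trib (i + 1) + trib i + e * valZero (i + 1)) : 0 ≤ a ∧ 2 ∣ a := by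
  obtain ⟨a, b, c, ha, hb, hc, j, r, rfl, hr, ht⟩ := trib_block i
  simp only [Nat.add_assoc, valZero_add, ht] at h
  clear ht
  interval_cases r <;> simp [tribFrom, valZero] at h <;> rcases he with rfl | rfl <;> omega

theorem trib_odd_odd_two (i : ℕ) {e : ℤ} (he : e = 1 ∨ e = -1) {a : ℤ}
    (h : a = trib (i + 2) + 2 * trib (i + 1) + trib i + e * valTwo (i + 1)) : 0 ≤ a ∧ 2 ∣ a := by
  obtain ⟨a, b, c, ha, hb, hc, j, r, rfl, hr, ht⟩ := trib_block i
  simp only [Nat.add_assoc, valTwo_add, ht] at h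
  clear ht
  interval_cases r <;> simp [tribFrom, valTwo] at h <;> rcases he with rfl | rfl <;> omega

/-- Serves for an odd path vertex, a middle leg vertex and a leg end. The sum of two `valTwo` is
`√2` times the value at `√2` of `R` at an odd index. -/
theorem trib_odd_leg (i : ℕ) {φ e : ℤ} (hφ : φ = 1 ∨ φ = -1) (he : e = 1 ∨ e = -1) {a : ℤ}
    (h : a = trib (i + 2) + trib (i + 3) + trib i + trib (i + 1)
      + φ * (trib (i + 2) + trib (i + 3) - trib i - trib (i + 1))
      + e * (valTwo i + valTwo (i + 1))) : 0 ≤ a ∧ 4 ∣ a := by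
  obtain ⟨a, b, c, ha, hb, hc, j, r, rfl, hr, ht⟩ := trib_block i
  simp only [Nat.add_assoc, valTwo_add, ht] at h
  clear ht
  interval_cases r <;> simp [tribFrom, valTwo] at h <;> rcases hφ with rfl | rfl <;>
    rcases he with rfl | rfl <;> omega

theorem trib_add_two_mul (k : ℕ) : ∃ a b c : ℤ, 0 ≤ a ∧ 0 ≤ b ∧ 0 ≤ c ∧ ∃ r : ℕ, r < 8 ∧
    valTwo (2 * k + 2) = valTwo (2 * r + 2) ∧ ∀ s, trib (2 * k + s) =
      tribFrom 1 0 0 (2 * r + s) * (8 * a + 1) + tribFrom 0 1 0 (2 * r + s) * (8 * b)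
        + tribFrom 0 0 1 (2 * r + s) * (8 * c) := by
  obtain ⟨a, b, c, ha, hb, hc, j, r, h, hr, ht⟩ := trib_block (2 * k)
  refine ⟨a, b, c, ha, hb, hc, r / 2, by omega, ?_, fun s => ?_⟩
  · rw [h, show r = 2 * (r / 2) by omega, Nat.add_assoc, valTwo_add]
    simp
  · rw [h, show r = 2 * (r / 2) by omega, Nat.add_assoc, ht]
    simp

/-- The alternatives are `k` even and `k` odd. These residues are all that products of three leg
vertices need. -/
theorem trib_residues (k : ℕ) :
    (valTwo (2 * k + 2) = -1 ∧ trib (2 * k + 2) % 4 = 0 ∧ trib (2 * k + 3) % 2 = 1 ∧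
      trib (2 * k + 4) % 4 = 1) ∨
    (valTwo (2 * k + 2) = 1 ∧ trib (2 * k + 2) % 4 = 1 ∧ trib (2 * k + 3) % 2 = 0 ∧
      trib (2 * k + 4) % 4 = 0) := by
  obtain ⟨a, b, c, ha, hb, hc, r, hr, hv, ht⟩ := trib_add_two_mul k
  simp only [ht, hv]
  clear ht
  interval_cases r <;> simp [tribFrom, valTwo] <;> omega

theorem trib_even_f (k : ℕ) {a : ℤ} (h : a = trib (2 * k + 1) + trib (2 * k + 2)) :
    0 ≤ a ∧ 2 ∣ a := by
  obtain ⟨a, b, c, ha, hb, hc, r, hr, hv, ht⟩ := trib_add_two_mul k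
  simp only [ht] at h
  clear ht
  interval_cases r <;> simp [tribFrom] at h <;> omega

theorem trib_even_g (k : ℕ) {e : ℤ} (he : e = 1 ∨ e = -1) {a : ℤ}
    (h : a = trib (2 * k + 2) + trib (2 * k + 3) + e * valTwo (2 * k + 2)) :
    0 ≤ a ∧ 2 ∣ a := by
  obtain ⟨a, b, c, ha, hb, hc, r, hr, hv, ht⟩ := trib_add_two_mul k
  rw [hv] at h
  simp only [ht] at h
  clear ht
  interval_cases r <;> simp [tribFrom, valTwo] at h <;> rcases he with rfl | rfl <;> omega

theorem trib_leg_odd_odd (k : ℕ) {φ e₀ e e' : ℤ} (hφ : φ = 1 ∨ φ = -1) (he₀ : e₀ = 1 ∨ e₀ = -1)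
    (he : e = 1 ∨ e = -1) (he' : e' = 1 ∨ e' = -1) {a : ℤ}
    (h : a = trib (2 * k + 2) + trib (2 * k + 3) + φ * (trib (2 * k + 1) + trib (2 * k + 2))
      + φ * (e * e') + valTwo (2 * k + 2) * (φ * (e₀ * e) + e₀ * e')) :
    0 ≤ a ∧ 4 ∣ a := by
  have hA := trib_nonneg (2 * k + 2)
  have hB := trib_nonneg (2 * k + 3)
  have hC := trib_nonneg (2 * k + 1)
  have hZ := trib_nonneg (2 * k)
  have e1 := trib_add_three (2 * k + 1)
  have e2 := trib_add_three (2 * k)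
  simp only [Nat.add_assoc, Nat.reduceAdd] at e1 e2
  rcases trib_residues k with ⟨hv, h0, h1, h2⟩ | ⟨hv, h0, h1, h2⟩ <;> rw [hv] at h <;>
    rcases hφ with rfl | rfl <;> rcases he₀ with rfl | rfl <;> rcases he with rfl | rfl <;>
    rcases he' with rfl | rfl <;> omega

/-- Write `t_i` for `trib (2 * k + i)`. By the recurrence the part without `e` is `4 t₄ + 4 t₃ + 2
t₂`, `2 t₄`, `2 t₂` or `2 t₀` when 0, 1, 2 or 3 of the `φ` are `-1`. Hence residues modulo 4 decide
divisibility by 8. -/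
theorem trib_three_legs (k : ℕ) {φ₁ φ₂ φ₃ e₁ e₂ e₃ : ℤ} (h₁ : φ₁ = 1 ∨ φ₁ = -1)
    (h₂ : φ₂ = 1 ∨ φ₂ = -1) (h₃ : φ₃ = 1 ∨ φ₃ = -1) (he₁ : e₁ = 1 ∨ e₁ = -1)
    (he₂ : e₂ = 1 ∨ e₂ = -1) (he₃ : e₃ = 1 ∨ e₃ = -1) {a : ℤ}
    (h : a = trib (2 * k + 5) + (φ₁ + φ₂ + φ₃) * trib (2 * k + 4)
      + (φ₁ * φ₂ + φ₂ * φ₃ + φ₃ * φ₁) * trib (2 * k + 3) + φ₁ * φ₂ * φ₃ * trib (2 * k + 2)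
      + e₁ * e₂ * (φ₂ * φ₃ + φ₁ * valTwo (2 * k + 2))
      + e₂ * e₃ * (φ₃ * φ₁ + φ₂ * valTwo (2 * k + 2))
      + e₃ * e₁ * (φ₁ * φ₂ + φ₃ * valTwo (2 * k + 2))) :
    0 ≤ a ∧ 8 ∣ a := by
  have hA := trib_nonneg (2 * k + 2)
  have hB := trib_nonneg (2 * k + 3)
  have hC := trib_nonneg (2 * k + 4)
  have hZ := trib_nonneg (2 * k)
  have e1 := trib_add_three (2 * k)
  have e2 := trib_add_three (2 * k + 1)
  have e3 := trib_add_three (2 * k + 2)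
  -- The signs enter only through their pairwise products, and the third of these is the product of
  -- the other two.
  have hp : e₁ * e₂ = 1 ∨ e₁ * e₂ = -1 := by
    rcases he₁ with rfl | rfl <;> rcases he₂ with rfl | rfl <;> simp
  have hq : e₂ * e₃ = 1 ∨ e₂ * e₃ = -1 := by
    rcases he₂ with rfl | rfl <;> rcases he₃ with rfl | rfl <;> simp
  have hpq : e₃ * e₁ = e₁ * e₂ * (e₂ * e₃) := by
    rcases he₂ with rfl | rfl <;> ring
  rw [hpq] at h
  simp only [Nat.add_assoc, Nat.reduceAdd] at e1 e2 e3
  generalize e₁ * e₂ = p at *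
  generalize e₂ * e₃ = q at *
  rcases trib_residues k with ⟨hv, h0, h1, h2⟩ | ⟨hv, h0, h1, h2⟩ <;> rw [hv] at h <;>
    rcases h₁ with rfl | rfl <;> rcases h₂ with rfl | rfl <;> rcases h₃ with rfl | rfl <;>
    rcases hp with rfl | rfl <;> rcases hq with rfl | rfl <;> omega

/-! ### Chebyshev sequences and traces on them -/

section ChebyshevSequence

variable {D : Type*} [CommRing D]

/-- A two-sided recurrence of order two is determined by two adjacent values. Chebyshev identities
follow by taking for `φ` the difference of the two sides. -/
theorem eq_zero_of_recurrence {φ : ℤ → D} {x : D} (h : ∀ j, φ (j + 1) = x * φ j - φ (j - 1))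
    (h0 : φ 0 = 0) (h1 : φ (-1) = 0) (j : ℤ) : φ j = 0 := by
  have up : ∀ n : ℕ, φ n = 0 ∧ φ ((n : ℤ) - 1) = 0 := by
    intro n
    induction n with
    | zero => exact ⟨by simpa using h0, by simpa using h1⟩
    | succ n ih =>
      push_cast
      refine ⟨by rw [h, ih.1, ih.2]; ring, ?_⟩
      rw [add_sub_cancel_right]
      exact ih.1
  have down : ∀ n : ℕ, φ (-(n : ℤ)) = 0 ∧ φ (-(n : ℤ) - 1) = 0 := by
    intro n
    induction n with
    | zero => exact ⟨by simpa using h0, by simpa using h1⟩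
    | succ n ih =>
      have e := h (-(n : ℤ) - 1)
      rw [show -(n : ℤ) - 1 + 1 = -(n : ℤ) by ring, ih.1, ih.2] at e
      have e2 : φ (-(n : ℤ) - 1 - 1) = 0 := by linear_combination e
      push_cast
      rw [show -((n : ℤ) + 1) = -(n : ℤ) - 1 by ring]
      exact ⟨ih.2, e2⟩
  obtain ⟨n, rfl | rfl⟩ := j.eq_nat_or_neg
  · exact (up n).1
  · exact (down n).1

/-- A sequence with the recurrence and the initial values of the rescaled Chebyshev polynomials of
the second kind. -/
structure IsChebyshev (R : ℤ → D) : Prop where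
  zero : R 0 = 1
  neg_one : R (-1) = 0
  step : ∀ j, R (j + 1) = R 1 * R j - R (j - 1)

namespace IsChebyshev

variable {R : ℤ → D} (hR : IsChebyshev R)
include hR

theorem one_mul_eq (j : ℤ) : R 1 * R j = R (j + 1) + R (j - 1) := by
  rw [hR.step]
  ring

theorem neg (j : ℤ) : R (-j - 2) = -R j := by
  have := eq_zero_of_recurrence (φ := fun j => R (-j - 2) + R j) (x := R 1) (fun j => by
    have h1 := hR.one_mul_eq (-j - 2)
    have h2 := hR.one_mul_eq j
    rw [show -j - 2 + 1 = -(j - 1) - 2 by ring, show -j - 2 - 1 = -(j + 1) - 2 by ring] at h1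
    linear_combination -h1 - h2) (by
    have := hR.step (-1)
    norm_num [hR.neg_one, hR.zero] at this ⊢
    linear_combination this) (by norm_num [hR.neg_one]) j
  linear_combination this

theorem two_mul_eq (j : ℤ) : R 2 * R j = R (j + 2) + R j + R (j - 2) := by
  have h1 := hR.one_mul_eq (j + 1)
  have h2 := hR.one_mul_eq j
  have h3 := hR.one_mul_eq (j - 1)
  have h4 := hR.one_mul_eq 1
  rw [show j + 1 + 1 = j + 2 by ring, show j + 1 - 1 = j by ring] at h1
  rw [show j - 1 + 1 = j by ring, show j - 1 - 1 = j - 2 by ring] at h3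
  norm_num [hR.zero] at h4
  linear_combination -R j * h4 + R 1 * h2 + h1 + h3

/-- For `R 1 = z + z⁻¹` the difference `R a - R (a - 2)` is `z ^ a + z ^ (-a)`, twice a Chebyshev
polynomial of the first kind, so multiplication by it shifts the index by `a` in both directions. -/
theorem diff_mul (a b : ℤ) : (R a - R (a - 2)) * R b = R (b + a) + R (b - a) := by
  have := eq_zero_of_recurrence
    (φ := fun a => (R (a + 1) - R (a - 1)) * R b - R (b + a + 1) - R (b - a - 1))
    (x := R 1) (fun j => by
      have h1 := hR.one_mul_eq (j + 1)
      have h2 := hR.one_mul_eq (j - 1)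
      have h3 := hR.one_mul_eq (b + j + 1)
      have h4 := hR.one_mul_eq (b - j - 1)
      ring_nf at h1 h2 h3 h4 ⊢
      linear_combination -h1 * R b + h2 * R b + h3 + h4) (by
      have h1 := hR.one_mul_eq b
      norm_num [hR.neg_one]
      linear_combination h1) (by
      have h1 := hR.neg 0
      norm_num at h1
      norm_num [h1, hR.zero]
      ring) (a - 1)
  simp only [sub_add_cancel] at this
  rw [show a - 1 - 1 = a - 2 by ring, show b + (a - 1) + 1 = b + a by ring,
    show b - (a - 1) - 1 = b - a by ring] at this
  linear_combination this

theorem cross_mul (a b : ℤ) :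
    R (a + 2) * R b - R a * R (b + 2) = R (b - a) + R (b - a - 2) := by
  have h1 := hR.diff_mul (a + 2) b
  have h2 := hR.diff_mul (b + 2) a
  have h3 := hR.neg (a - b - 2)
  rw [show a + 2 - 2 = a by ring, show b - (a + 2) = b - a - 2 by ring] at h1
  rw [show b + 2 - 2 = b by ring, show a + (b + 2) = b + (a + 2) by ring,
    show a - (b + 2) = a - b - 2 by ring] at h2
  rw [show -(a - b - 2) - 2 = b - a by ring] at h3
  linear_combination h1 - h2 - h3

/-- The Clebsch–Gordan rule. For `a < b` negative indices occur, so it is applied with `b ≤ a`. -/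
theorem mul_eq_sum (a : ℤ) (b : ℕ) :
    R a * R b = ∑ j ∈ Finset.range (b + 1), R (a - b + 2 * j) := by
  induction b using Nat.twoStepInduction generalizing a with
  | zero => simp [hR.zero]
  | one =>
    rw [Finset.sum_range_succ, Finset.sum_range_one]
    have := hR.one_mul_eq a
    push_cast
    rw [show a - 1 + 2 = a + 1 by ring, show a - 1 + 0 = a - 1 by ring]
    linear_combination this
  -- Passing from `b` to `b + 2` adds only the first and the last summand, which are the two terms
  -- of `diff_mul`.
  | more b h _ =>
    rw [Finset.sum_range_succ, Finset.sum_range_succ']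
    have h1 := hR.diff_mul (b + 2) a
    have h2 := h a
    push_cast at h2 ⊢
    have e : ∀ j : ℕ, a - ((b : ℤ) + 2) + 2 * ((j : ℤ) + 1) = a - b + 2 * j := fun j => by ring
    simp only [e]
    rw [← h2]
    rw [show (b : ℤ) + 2 - 2 = b by ring] at h1
    rw [add_zero, show a - ((b : ℤ) + 2) + 2 * (b + 2) = a + (b + 2) by ring]
    linear_combination h1

end IsChebyshev

end ChebyshevSequence

/-! ### Traces of products of path vertices with the ends `f`, `g` of the forked graph -/

section ForkTrace

variable {D : Type*} [CommRing D] [Algebra ℝ D]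

/-- The end vertex `f`, as a combination of Chebyshev polynomials. -/
noncomputable def forkF (R : ℤ → D) (m : ℕ) : D :=
  (1 / 2 : ℝ) • (R (2 * m) + (2 : ℝ) • R (2 * m + 2) - R (2 * m + 4))

/-- The end vertex `g`, as a combination of Chebyshev polynomials. -/
noncomputable def forkG (R : ℤ → D) (m : ℕ) : D :=
  (1 / 2 : ℝ) • (R (2 * m + 4) - R (2 * m))

/-- The sum of the two end vertices beyond `g`, as a combination of Chebyshev polynomials. -/
def forkH (R : ℤ → D) (m : ℕ) : D := R (2 * m + 3) - R (2 * m + 1)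

/-- A Chebyshev sequence subject to the relation of the forked graph, with a trace for which
the even vertices of the graph are orthonormal. -/
structure IsForkTrace (R : ℤ → D) (m : ℕ) (τ : D →ₗ[ℝ] ℝ) : Prop extends IsChebyshev R where
  -- With `n = 2 * m + 1` this expresses that `f` is a leaf attached to the vertex of index `n`: `R
  -- 1 * forkF R m = R n`.
  rel : R (2 * m + 5) = R (2 * m + 3) + R (2 * m + 1) + R (2 * m - 1)
  orth : ∀ i j : ℕ, i ≤ m → j ≤ m → τ (R (2 * i) * R (2 * j)) = if i = j then 1 else 0
  orth_f : ∀ i : ℕ, i ≤ m → τ (R (2 * i) * forkF R m) = 0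
  orth_g : ∀ i : ℕ, i ≤ m → τ (R (2 * i) * forkG R m) = 0
  ff : τ (forkF R m * forkF R m) = 1
  fg : τ (forkF R m * forkG R m) = 0
  gg : τ (forkG R m * forkG R m) = 1

theorem algebraMap_half_mul_two : algebraMap ℝ D (1 / 2) * 2 = 1 := by
  rw [← map_ofNat (algebraMap ℝ D) 2, ← map_mul]
  norm_num

theorem two_mul_forkF (R : ℤ → D) (m : ℕ) :
    2 * forkF R m = R (2 * m) + 2 * R (2 * m + 2) - R (2 * m + 4) := by
  simp only [forkF, Algebra.smul_def, map_ofNat]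
  linear_combination (R (2 * m) + 2 * R (2 * m + 2) - R (2 * m + 4)) *
    algebraMap_half_mul_two (D := D)

theorem two_mul_forkG (R : ℤ → D) (m : ℕ) :
    2 * forkG R m = R (2 * m + 4) - R (2 * m) := by
  simp only [forkG, Algebra.smul_def]
  linear_combination (R (2 * m + 4) - R (2 * m)) * algebraMap_half_mul_two (D := D)

theorem eq_of_two_mul_eq {x y : D} (h : 2 * x = 2 * y) : x = y := by
  linear_combination (y - x) * algebraMap_half_mul_two (D := D) + algebraMap ℝ D (1 / 2) * h

theorem map_two_mul (τ : D →ₗ[ℝ] ℝ) (x : D) : τ (2 * x) = 2 * τ x := by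
  rw [two_mul, map_add, two_mul]

/-- Traces against `f` and `g` vanish up to index `m` by orthogonality, and obey a recurrence in `q
= j - m` beyond it. -/
theorem le_or_exists_index {m j : ℕ} (hj : j ≤ 2 * m + 1) : j ≤ m ∨
    ∃ q : ℕ, q ≤ m + 1 ∧ 1 ≤ q ∧ (2 * (j : ℤ)) = 2 * m + 2 * q := by
  rcases le_or_gt j m with h1 | h1
  · exact Or.inl h1
  · exact Or.inr ⟨j - m, by omega, by omega, by omega⟩

namespace IsForkTrace

variable {R : ℤ → D} {m : ℕ} {τ : D →ₗ[ℝ] ℝ} (h : IsForkTrace R m τ)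
include h

omit h in
theorem forkF_add_forkG : R (2 * m + 2) = forkF R m + forkG R m := by
  apply eq_of_two_mul_eq
  linear_combination -two_mul_forkF R m - two_mul_forkG R m

theorem one_mul_forkF : R 1 * forkF R m = R (2 * m + 1) := by
  apply eq_of_two_mul_eq
  have h0 := two_mul_forkF R m
  have h1 := h.one_mul_eq (2 * m)
  have h2 := h.one_mul_eq (2 * m + 2)
  have h3 := h.one_mul_eq (2 * m + 4)
  have h4 := h.rel
  rw [add_sub_assoc] at h2 h3
  norm_num [add_assoc] at h2 h3
  linear_combination R 1 * h0 + h1 + 2 * h2 - h3 - h4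

theorem one_mul_forkG : R 1 * forkG R m = R (2 * m + 3) := by
  have h1 := h.one_mul_eq (2 * m + 2)
  rw [add_sub_assoc] at h1
  norm_num [add_assoc] at h1
  linear_combination h1 - R 1 * forkF_add_forkG (R := R) (m := m) - h.one_mul_forkF

theorem forkH_eq : forkH R m = R 1 * (forkG R m - forkF R m) := by
  rw [forkH]
  linear_combination h.one_mul_forkF - h.one_mul_forkG

theorem two_eq : R 2 = R 1 * R 1 - 1 := by
  have := h.one_mul_eq 1
  norm_num [h.zero] at this
  linear_combination -this

/-- Since `R 2 = R 1 * R 1 - 1`, multiplication by `R 2` counts walks of length two in the forked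
graph, less the identity. In the same way `g`, which has three neighbours, gets the coefficient 2 in
`R 2 * forkG R m`. -/
theorem two_mul_forkF_eq : R 2 * forkF R m = R (2 * m) + forkG R m := by
  have h1 := h.one_mul_eq (2 * m + 1)
  rw [add_sub_assoc] at h1
  norm_num [add_assoc] at h1
  linear_combination h.two_eq * forkF R m + R 1 * h.one_mul_forkF + h1 +
      forkF_add_forkG (R := R) (m := m)

theorem two_mul_forkG_eq : R 2 * forkG R m = R (2 * m) + forkF R m + 2 * forkG R m := by
  have h1 := h.one_mul_eq (2 * m + 3)
  rw [add_sub_assoc] at h1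
  norm_num [add_assoc] at h1
  linear_combination h.two_eq * forkG R m + R 1 * h.one_mul_forkG + h1 +
      forkF_add_forkG (R := R) (m := m)
    - two_mul_forkG R m

theorem map_even (j : ℕ) (hj : j ≤ m) : τ (R (2 * j)) = if j = 0 then 1 else 0 := by
  have := h.orth j 0 hj (Nat.zero_le _)
  simpa [h.zero] using this

/-! The traces of the products of `R (2 * m + 2 * q)` with `f`, `g` and `R (2 * m)`. -/

theorem map_forkF_add_one (q : ℤ) : τ (R (2 * m + 2 * (q + 1)) * forkF R m) =
    τ (R (2 * m + 2 * q) * R (2 * m)) + τ (R (2 * m + 2 * q) * forkG R m)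
      - τ (R (2 * m + 2 * q) * forkF R m) - τ (R (2 * m + 2 * (q - 1)) * forkF R m) := by
  simp only [← map_add, ← map_sub]
  congr 1
  have h1 := h.two_mul_eq (2 * m + 2 * q)
  rw [show 2 * (m : ℤ) + 2 * q + 2 = 2 * m + 2 * (q + 1) by ring,
    show 2 * (m : ℤ) + 2 * q - 2 = 2 * m + 2 * (q - 1) by ring] at h1
  linear_combination -forkF R m * h1 + R (2 * m + 2 * q) * h.two_mul_forkF_eq

theorem map_forkG_add_one (q : ℤ) : τ (R (2 * m + 2 * (q + 1)) * forkG R m) =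
    τ (R (2 * m + 2 * q) * R (2 * m)) + τ (R (2 * m + 2 * q) * forkF R m)
      + τ (R (2 * m + 2 * q) * forkG R m) - τ (R (2 * m + 2 * (q - 1)) * forkG R m) := by
  simp only [← map_add, ← map_sub]
  congr 1
  have h1 := h.two_mul_eq (2 * m + 2 * q)
  rw [show 2 * (m : ℤ) + 2 * q + 2 = 2 * m + 2 * (q + 1) by ring,
    show 2 * (m : ℤ) + 2 * q - 2 = 2 * m + 2 * (q - 1) by ring] at h1
  linear_combination -forkG R m * h1 + R (2 * m + 2 * q) * h.two_mul_forkG_eq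

/-- By `cross_mul` the second factor is raised to `R (2 * m + 2)`, which is `f + g`. The cost is two
bare traces, which vanish where the recurrence is used. -/
theorem map_mul_add_one (q : ℤ) : τ (R (2 * m + 2 * (q + 1)) * R (2 * m)) =
    τ (R (2 * m + 2 * q) * forkF R m) + τ (R (2 * m + 2 * q) * forkG R m)
      - τ (R (2 * q)) - τ (R (2 * (q - 1))) := by
  simp only [← map_add, ← map_sub]
  congr 1
  have h1 := h.cross_mul (2 * m + 2 * q) (2 * m)
  have h2 := h.neg (2 * q)
  have h3 := h.neg (2 * (q - 1))
  rw [show 2 * (m : ℤ) - (2 * m + 2 * q) - 2 = -(2 * q) - 2 by ring,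
    show 2 * (m : ℤ) - (2 * m + 2 * q) = -(2 * (q - 1)) - 2 by ring,
    show 2 * (m : ℤ) + 2 * q + 2 = 2 * m + 2 * (q + 1) by ring] at h1
  linear_combination h1 + h2 + h3 + R (2 * m + 2 * q) * forkF_add_forkG (R := R) (m := m)

theorem map_forkF_one : τ (R (2 * m + 2 * 1) * forkF R m) = 1 ∧
    τ (R (2 * m + 2 * 1) * forkG R m) = 1 ∧ τ (R (2 * m + 2 * 1) * R (2 * m)) = 0 := by
  norm_num only [forkF_add_forkG (R := R) (m := m), add_mul, map_add, h.ff, h.gg, h.fg,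
      mul_comm (forkG R m)]
  rw [mul_comm, h.orth_f m le_rfl]
  simp [h.orth_g m le_rfl]

theorem map_forkF_two : τ (R (2 * m + 2 * 2) * forkF R m) = 0 ∧
    τ (R (2 * m + 2 * 2) * forkG R m) = 2 ∧ τ (R (2 * m + 2 * 2) * R (2 * m)) = 1 := by
  have e : R (2 * m + 2 * 2) = 2 * forkG R m + R (2 * m) := by
    norm_num
    linear_combination -two_mul_forkG R m
  rw [e]
  simp only [add_mul, map_add, mul_assoc, map_two_mul, h.orth_f m le_rfl, h.orth_g m le_rfl,
    mul_comm (forkG R m), h.fg, h.gg, h.orth m m le_rfl le_rfl]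
  norm_num

/-- Once the bare traces `τ (R (2 * q))` drop out, the three coupled recurrences reduce to the
Tribonacci one. The bound on `q` keeps those traces in the range of `map_even`. -/
theorem map_fork_add_three (q : ℕ) (hq : q + 3 ≤ m + 1) :
    (τ (R (2 * m + 2 * (q + 2 : ℤ)) * forkF R m) = 2 * trib (q + 2) ∧
      τ (R (2 * m + 2 * (q + 2 : ℤ)) * forkG R m) = 2 * trib (q + 3)) ∧
    τ (R (2 * m + 2 * (q + 3 : ℤ)) * forkF R m) = 2 * trib (q + 3) ∧
      τ (R (2 * m + 2 * (q + 3 : ℤ)) * forkG R m) = 2 * trib (q + 4) ∧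
      τ (R (2 * m + 2 * (q + 3 : ℤ)) * R (2 * m)) = 2 * trib (q + 2) + 2 * trib (q + 3) := by
  induction q with
  | zero =>
    obtain ⟨f1, g1, h1⟩ := h.map_forkF_one
    obtain ⟨f2, g2, h2⟩ := h.map_forkF_two
    have f3 := h.map_forkF_add_one 2
    have g3 := h.map_forkG_add_one 2
    have h3 := h.map_mul_add_one 2
    have t1 := h.map_even 1 (by omega)
    have t2 := h.map_even 2 (by omega)
    norm_num [trib_add_three, trib_zero, trib_one, trib_two] at *
    rw [f3, g3, h3, f2, g2, h2, f1, g1, t1, t2]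
    norm_num
  | succ q ih =>
    obtain ⟨⟨f2, g2⟩, f3, g3, h3⟩ := ih (by omega)
    have f4 := h.map_forkF_add_one (q + 3)
    have g4 := h.map_forkG_add_one (q + 3)
    have h4 := h.map_mul_add_one (q + 3)
    have t1 := h.map_even (q + 2) (by omega)
    have t2 := h.map_even (q + 3) (by omega)
    have e : (q : ℤ) + 3 - 1 = q + 2 := by ring
    have e' : (q : ℤ) + 3 + 1 = q + 4 := by ring
    rw [if_neg (by omega)] at t1 t2
    push_cast at *
    rw [e] at f4 g4 h4
    rw [e', f3, f2, g3, h3] at f4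
    rw [e', f3, g2, g3, h3] at g4
    rw [e', f3, g3, t1, t2] at h4
    have e4 : (trib (q + 4) : ℝ) = trib (q + 3) + trib (q + 2) + trib (q + 1) := by
      exact_mod_cast trib_add_three (q + 1)
    have e5 : (trib (q + 5) : ℝ) = trib (q + 4) + trib (q + 3) + trib (q + 2) := by
      exact_mod_cast trib_add_three (q + 2)
    rw [show (q : ℤ) + 1 + 2 = q + 3 by ring, show (q : ℤ) + 1 + 3 = q + 4 by ring]
    simp only [Nat.add_assoc, Nat.reduceAdd]
    exact ⟨⟨f3, g3⟩, by linarith, by linarith, by linarith⟩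

/-- Small `q` are exceptional: there the values come directly from orthonormality. The truncated `q
- 1` is met only for `q ≥ 3`. -/
theorem map_fork_values (q : ℕ) (hq : q ≤ m + 1) :
    (τ (R (2 * m + 2 * q) * forkF R m) =
        if q = 0 then 0 else if q = 1 then 1 else 2 * (trib q : ℝ)) ∧
      (τ (R (2 * m + 2 * q) * forkG R m) =
        if q = 0 then 0 else if q = 1 then 1 else 2 * (trib (q + 1) : ℝ)) ∧
      τ (R (2 * m + 2 * q) * R (2 * m)) =
        if q ≤ 2 then (if q = 1 then 0 else 1) else 2 * (trib (q - 1) : ℝ) + 2 * trib q := by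
  match q, hq with
  | 0, _ => simp [h.orth_f m le_rfl, h.orth_g m le_rfl, h.orth m m le_rfl le_rfl]
  | 1, _ => simpa using h.map_forkF_one
  | 2, _ => simpa [trib_two, trib_add_three, trib_one, trib_zero] using h.map_forkF_two
  | q + 3, hq =>
    have := (h.map_fork_add_three q hq).2
    simpa using this

theorem isNat_map_mul_forkF (j : ℕ) (hj : j ≤ 2 * m + 1) : IsNat (τ (R (2 * j) * forkF R m)) := by
  rcases le_or_exists_index hj with h1 | ⟨q, h1, h2, h3⟩
  · rw [h.orth_f j h1]
    exact isNat_zero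
  · rw [h3, (h.map_fork_values q h1).1, if_neg (by omega)]
    split_ifs
    · exact isNat_one
    · rw [two_mul]
      exact (isNat_trib q).add (isNat_trib q)

theorem isNat_map_mul_forkG (j : ℕ) (hj : j ≤ 2 * m + 1) : IsNat (τ (R (2 * j) * forkG R m)) := by
  rcases le_or_exists_index hj with h1 | ⟨q, h1, h2, h3⟩
  · rw [h.orth_g j h1]
    exact isNat_zero
  · rw [h3, (h.map_fork_values q h1).2.1, if_neg (by omega)]
    split_ifs
    · exact isNat_one
    · rw [two_mul]
      exact (isNat_trib _).add (isNat_trib _)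

/-- Halving is possible because both traces are even, or both equal to 1 at `j = m + 1`. For `φ =
-1` the value `trib (q + 1) - trib q` is nonnegative from `q = 2` on. -/
theorem isNat_half_map_add (j : ℕ) (hj : j ≤ 2 * m + 1) {φ : ℤ} (hφ : φ = 1 ∨ φ = -1) :
    IsNat (1 / 2 * (τ (R (2 * j) * forkG R m) + φ * τ (R (2 * j) * forkF R m))) := by
  rcases le_or_exists_index hj with h1 | ⟨q, h1, h2, h3⟩
  · rw [h.orth_g j h1, h.orth_f j h1]
    norm_num
    exact isNat_zero
  · rw [h3, (h.map_fork_values q h1).2.1, (h.map_fork_values q h1).1,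
      if_neg (show ¬ q = 0 by omega),
      if_neg (show ¬ q = 0 by omega)]
    split_ifs with hq
    · rcases hφ with rfl | rfl
      · norm_num
        exact isNat_one
      · norm_num
        exact isNat_zero
    · refine isNat_of_mul_eq 1 one_pos (a := trib (q + 1) + φ * trib q) (by push_cast; ring)
        ⟨?_, by simp⟩
      obtain ⟨q, rfl⟩ : ∃ p, q = p + 2 := ⟨q - 2, by omega⟩
      have := trib_add_three q
      have := trib_nonneg q
      have := trib_nonneg (q + 1)
      have := trib_nonneg (q + 2)
      rcases hφ with rfl | rfl
      · simp only [Nat.add_assoc, Nat.reduceAdd]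
        omega
      · simp only [Nat.add_assoc, Nat.reduceAdd]
        omega

/-- Beyond `m` the index is reflected at `m` by `diff_mul`. The product in it is evaluated by
orthonormality, and the reflected term already has that same trace. -/
theorem map_even_of_le_two_mul (j : ℕ) (hj : j ≤ 2 * m) :
    τ (R (2 * j)) = if j = 0 then 1 else 0 := by
  rcases le_or_gt j m with h1 | h1
  · exact h.map_even j h1
  · obtain ⟨i, rfl⟩ : ∃ i, j = m + (i + 1) := ⟨j - m - 1, by omega⟩
    have e := h.diff_mul (2 * (i + 1 : ℕ)) (2 * m)
    apply_fun τ at e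
    have t := h.map_even (m - (i + 1)) (by omega)
    rw [Nat.cast_sub (by omega)] at t
    rw [show (2 * ((i + 1 : ℕ) : ℤ)) - 2 = 2 * (i : ℕ) by push_cast; ring, sub_mul, map_sub,
      map_add, h.orth _ _ (by omega) le_rfl, h.orth _ _ (by omega) le_rfl, ← mul_sub, t,
      if_neg (by omega : i ≠ m), ← mul_add] at e
    push_cast at e ⊢
    split_ifs at e with h2 h3 h3
    · linarith
    · omega
    · omega
    · linarith

/-- Three path indices are at most `2 * m + 1`, so when their sum is even it is at most `2 * (3 * m
+ 1)`. Beyond `2 * m` the reflected index is negative, and for `q ≥ 3` the trace comes out as `2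
trib q + 2 trib (q - 2)`. -/
theorem isNat_map_even (j : ℕ) (hj : j ≤ 3 * m + 1) : IsNat (τ (R (2 * j))) := by
  rcases le_or_gt j (2 * m) with h1 | h1
  · rw [h.map_even_of_le_two_mul j h1]
    split_ifs
    · exact isNat_one
    · exact isNat_zero
  · obtain ⟨q, rfl⟩ : ∃ q, j = 2 * m + (q + 1) := ⟨j - 2 * m - 1, by omega⟩
    have e := h.diff_mul (2 * m + 2 * (q + 1)) (2 * m)
    have e2 := h.neg (2 * q)
    rw [show 2 * (m : ℤ) - (2 * m + 2 * (q + 1)) = -(2 * q) - 2 by ring, e2, sub_mul,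
      show 2 * (m : ℤ) + 2 * (q + 1) - 2 = 2 * m + 2 * q by ring,
      show 2 * (m : ℤ) + (2 * m + 2 * (q + 1)) = 2 * (2 * m + (q + 1)) by ring] at e
    apply_fun τ at e
    have v1 := (h.map_fork_values q (by omega)).2.2
    have v2 := (h.map_fork_values (q + 1) (by omega)).2.2
    push_cast at v2 ⊢
    rw [map_sub, map_add, map_neg, v1, v2, h.map_even q (by omega)] at e
    rw [← sub_eq_iff_eq_add, sub_neg_eq_add] at e
    rw [← e]
    match q with
    | 0 => norm_num; exact isNat_zero
    | 1 => norm_num; exact isNat_one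
    | 2 =>
      norm_num [trib_two, trib_add_three, trib_one, trib_zero]
      exact isNat_one
    | q + 3 =>
      have e1 := trib_add_three (q + 1)
      refine isNat_of_mul_eq 1 one_pos (a := 2 * trib (q + 3) + 2 * trib (q + 1)) ?_
        ⟨?_, by simp⟩
      · simp
        have : (trib (q + 4) : ℝ) = trib (q + 3) + trib (q + 2) + trib (q + 1) := by
          exact_mod_cast e1
        linear_combination 2 * this
      · have := trib_nonneg (q + 1)
        have := trib_nonneg (q + 3)
        omega

/-! Traces of products with at least two path vertices. -/

/-- Clebsch–Gordan replaces two path vertices by a sum of single ones; ordering `b ≤ a` keeps the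
indices nonnegative. -/
theorem isNat_map_mul_of_even {x : D} {N : ℕ} (hx : ∀ j : ℕ, j ≤ N → IsNat (τ (R (2 * j) * x)))
    (a b : ℕ) (hab : a + b ≤ 2 * N) (he : Even (a + b)) : IsNat (τ (R a * R b * x)) := by
  wlog hba : b ≤ a generalizing a b
  · rw [mul_comm (R a)]
    exact this b a (by omega) (by rwa [add_comm]) (by omega)
  rw [h.mul_eq_sum, Finset.sum_mul, map_sum]
  refine IsNat.sum _ fun j hj => ?_
  rw [Finset.mem_range] at hj
  obtain ⟨c, hc⟩ := he
  have := hx (c - b + j) (by omega)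
  rwa [show 2 * ((c - b + j : ℕ) : ℤ) = a - b + 2 * j by omega] at this

theorem isNat_map_mul_of_odd {x : D} {N : ℕ}
    (hx : ∀ j : ℕ, j ≤ N → IsNat (τ (R (2 * j + 1) * x)))
    (a b : ℕ) (hab : a + b ≤ 2 * N + 1) (he : Odd (a + b)) : IsNat (τ (R a * R b * x)) := by
  wlog hba : b ≤ a generalizing a b
  · rw [mul_comm (R a)]
    exact this b a (by omega) (by rwa [add_comm]) (by omega)
  rw [h.mul_eq_sum, Finset.sum_mul, map_sum]
  refine IsNat.sum _ fun j hj => ?_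
  rw [Finset.mem_range] at hj
  obtain ⟨c, hc⟩ := he
  have := hx (c - b + j) (by omega)
  rwa [show 2 * ((c - b + j : ℕ) : ℤ) + 1 = a - b + 2 * j by omega] at this

theorem isNat_map_mul_mul (a b c : ℕ) (ha : a ≤ 2 * m + 1) (hb : b ≤ 2 * m + 1)
    (hc : c ≤ 2 * m + 1) (he : Even (a + b + c)) : IsNat (τ (R a * R b * R c)) := by
  have key (j : ℕ) (hj : j ≤ 3 * m + 1) : IsNat (τ (R (2 * j) * 1)) := by
    rw [mul_one]
    exact h.isNat_map_even j hj
  rcases Nat.even_or_odd c with hc' | hc'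
  · refine h.isNat_map_mul_of_even (N := 2 * m + 1) (fun j hj => ?_) a b (by omega)
      (by simpa [Nat.even_add, hc'] using he)
    have := h.isNat_map_mul_of_even key (2 * j) c (by obtain ⟨d, hd⟩ := hc'; omega)
      (by simp [Nat.even_add, hc'])
    simpa using this
  · have hab : Odd (a + b) := by
      rw [← Nat.not_even_iff_odd] at hc' ⊢
      simpa [Nat.even_add, hc'] using he
    refine h.isNat_map_mul_of_odd (N := 2 * m) (fun j hj => ?_) a b
      (by obtain ⟨d, hd⟩ := hab; omega) hab
    have := h.isNat_map_mul_of_even key (2 * j + 1) c (by omega)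
      (by rw [← Nat.not_odd_iff_even, Nat.odd_add]; simp [hc'])
    simpa using this

theorem isNat_map_mul_mul_forkF (a b : ℕ) (ha : a ≤ 2 * m + 1) (hb : b ≤ 2 * m + 1)
    (he : Even (a + b)) : IsNat (τ (R a * R b * forkF R m)) :=
  h.isNat_map_mul_of_even h.isNat_map_mul_forkF a b (by omega) he

theorem isNat_map_mul_mul_forkG (a b : ℕ) (ha : a ≤ 2 * m + 1) (hb : b ≤ 2 * m + 1)
    (he : Even (a + b)) : IsNat (τ (R a * R b * forkG R m)) :=
  h.isNat_map_mul_of_even h.isNat_map_mul_forkG a b (by omega) he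

/-- The diagonal part of the end vertices of the legs. -/
theorem isNat_map_mul_mul_leg (a b : ℕ) (ha : a ≤ 2 * m + 1) (hb : b ≤ 2 * m + 1)
    (he : Even (a + b)) {φ : ℤ} (hφ : φ = 1 ∨ φ = -1) :
    IsNat (τ (R a * R b * ((1 / 2 : ℝ) • (forkG R m + (φ : ℝ) • forkF R m)))) := by
  refine h.isNat_map_mul_of_even (N := 2 * m + 1) (fun j hj => ?_) a b (by omega) he
  have := h.isNat_half_map_add j hj hφ
  simpa only [mul_smul_comm, mul_add, map_smul, map_add, smul_eq_mul] using this

theorem isNat_map_mul_mul_forkH (a b : ℕ) (ha : a ≤ 2 * m + 1) (hb : b ≤ 2 * m + 1)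
    (he : Odd (a + b)) : IsNat (τ (R a * R b * ((1 / 2 : ℝ) • forkH R m))) := by
  refine h.isNat_map_mul_of_odd (N := 2 * m) (fun j hj => ?_) a b
    (by obtain ⟨c, hc⟩ := he; omega) he
  -- As `forkH` is `R 1 * (g - f)`, its factor `R 1` turns the odd index `2 * j + 1` into the even
  -- indices `2 * j` and `2 * j + 2`.
  have h1 := h.isNat_half_map_add j (by omega) (Or.inr rfl)
  have h2 := h.isNat_half_map_add (j + 1) (by omega) (Or.inr rfl)
  have h3 := h.one_mul_eq (2 * j + 1)
  rw [show (2 * (j : ℤ) + 1 + 1) = 2 * ((j + 1 : ℕ) : ℤ) by push_cast; ring,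
    add_sub_cancel_right] at h3
  rw [mul_smul_comm, h.forkH_eq, ← mul_assoc, mul_comm (R (2 * j + 1)), h3, map_smul]
  simp only [add_mul, mul_sub, map_add, map_sub, smul_eq_mul]
  convert h1.add h2 using 1
  push_cast
  ring

/-! Traces of products with one path vertex. -/

/-- The reflected term of `diff_mul` is killed by `hx`, so these traces are partial sums of those of
`R (2 * m + 2 * q) * x`. -/
theorem map_mul_mul_succ {x : D} (hx : ∀ i : ℕ, i ≤ m → τ (R (2 * i) * x) = 0) (i : ℕ)
    (hi : i + 1 ≤ m) : τ (R (2 * (i + 1 : ℕ)) * R (2 * m) * x) =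
      τ (R (2 * i) * R (2 * m) * x) + τ (R (2 * m + 2 * (i + 1 : ℕ)) * x) := by
  have e := h.diff_mul (2 * (i + 1 : ℕ)) (2 * m)
  have t := hx (m - (i + 1)) (by omega)
  rw [Nat.cast_sub (by omega), mul_sub] at t
  rw [show (2 * ((i + 1 : ℕ) : ℤ)) - 2 = 2 * (i : ℕ) by push_cast; ring] at e
  rw [← map_add, ← sub_eq_zero, ← map_sub, ← t]
  congr 1
  linear_combination x * e

theorem map_mul_mul_forkF (i : ℕ) (hi : i + 1 ≤ m) :
    τ (R (2 * (i + 1 : ℕ)) * R (2 * m) * forkF R m) =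
      trib i + 2 * trib (i + 1) + trib (i + 2) := by
  induction i with
  | zero =>
    have e := h.map_mul_mul_succ h.orth_f 0 hi
    have v := (h.map_fork_values 1 (by omega)).1
    rw [v] at e
    simpa [h.zero, h.orth_f m le_rfl, trib_zero, trib_one, trib_two] using e
  | succ i ih =>
    have e := h.map_mul_mul_succ h.orth_f (i + 1) hi
    rw [e, ih (by omega), (h.map_fork_values (i + 1 + 1) (by omega)).1, if_neg (by omega),
      if_neg (by omega)]
    simp only [Nat.add_assoc, Nat.reduceAdd, trib_add_three]
    push_cast
    ring

theorem map_mul_mul_forkG (i : ℕ) (hi : i + 1 ≤ m) :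
    τ (R (2 * (i + 1 : ℕ)) * R (2 * m) * forkG R m) =
      trib (i + 1) + 2 * trib (i + 2) + trib (i + 3) := by
  induction i with
  | zero =>
    have e := h.map_mul_mul_succ h.orth_g 0 hi
    have v := (h.map_fork_values 1 (by omega)).2.1
    rw [v] at e
    simpa [h.zero, h.orth_g m le_rfl, trib_add_three, trib_zero, trib_one, trib_two] using e
  | succ i ih =>
    have e := h.map_mul_mul_succ h.orth_g (i + 1) hi
    rw [e, ih (by omega), (h.map_fork_values (i + 1 + 1) (by omega)).2.1, if_neg (by omega),
      if_neg (by omega)]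
    simp only [Nat.add_assoc, Nat.reduceAdd, trib_add_three]
    push_cast
    ring

theorem map_mul_forkF_mul (x : D) (i : ℕ) : τ (R (2 * (i + 1 : ℕ)) * forkF R m * x) =
    τ (R (2 * i) * R (2 * m) * x) + τ (R (2 * i) * forkG R m * x)
      - τ (R (2 * i) * forkF R m * x) - τ (R (2 * i - 2) * forkF R m * x) := by
  simp only [← map_add, ← map_sub]
  congr 1
  have h1 := h.two_mul_eq (2 * i)
  rw [show 2 * (i : ℤ) + 2 = 2 * (i + 1 : ℕ) by push_cast; ring] at h1
  linear_combination -forkF R m * x * h1 + R (2 * i) * x * h.two_mul_forkF_eq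

theorem map_mul_forkG_mul (x : D) (i : ℕ) : τ (R (2 * (i + 1 : ℕ)) * forkG R m * x) =
    τ (R (2 * i) * R (2 * m) * x) + τ (R (2 * i) * forkF R m * x)
      + τ (R (2 * i) * forkG R m * x) - τ (R (2 * i - 2) * forkG R m * x) := by
  simp only [← map_add, ← map_sub]
  congr 1
  have h1 := h.two_mul_eq (2 * i)
  rw [show 2 * (i : ℤ) + 2 = 2 * (i + 1 : ℕ) by push_cast; ring] at h1
  linear_combination -forkG R m * x * h1 + R (2 * i) * x * h.two_mul_forkG_eq

/-- The induction lets `R 2` act on the first end vertex; at `i = 1` the term of index `-2`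
contributes `R (-2) = -1`. -/
theorem map_mul_fork_mul_fork (i : ℕ) (hi : i ≤ m + 1) :
    τ (R (2 * i) * forkF R m * forkF R m) = trib i + trib (i + 1) ∧
    τ (R (2 * i) * forkF R m * forkG R m) = trib (i + 1) + trib (i + 2) ∧
    τ (R (2 * i) * forkG R m * forkG R m) = trib (i + 2) + trib (i + 3) := by
  have neg2 : R (-2) = -1 := by simpa [h.zero] using h.neg 0
  have comm (x : D) : x * forkG R m * forkF R m = x * forkF R m * forkG R m := by ring
  induction i using Nat.twoStepInduction with
  | zero => simp [h.zero, h.ff, h.fg, h.gg, trib_add_three, trib_zero, trib_one, trib_two]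
  | one =>
    have e1 := h.map_mul_forkF_mul (forkF R m) 0
    have e2 := h.map_mul_forkF_mul (forkG R m) 0
    have e3 := h.map_mul_forkG_mul (forkG R m) 0
    norm_num [h.zero, neg2, h.orth_f m le_rfl, h.orth_g m le_rfl, h.ff, h.fg, h.gg, trib_add_three,
      trib_zero, trib_one, trib_two, mul_comm (forkG R m) (forkF R m)] at e1 e2 e3 ⊢
    exact ⟨e1, e2, e3⟩
  | more i ih1 ih2 =>
    have ih1 := ih1 (by omega)
    have ih2 := ih2 (by omega)
    have e1 := h.map_mul_forkF_mul (forkF R m) (i + 1)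
    have e2 := h.map_mul_forkF_mul (forkG R m) (i + 1)
    have e3 := h.map_mul_forkG_mul (forkG R m) (i + 1)
    rw [show 2 * ((i + 1 : ℕ) : ℤ) - 2 = 2 * (i : ℕ) by push_cast; ring, ih1.1, ih2.1,
      h.map_mul_mul_forkF i (by omega), comm, ih2.2.1] at e1
    rw [show 2 * ((i + 1 : ℕ) : ℤ) - 2 = 2 * (i : ℕ) by push_cast; ring, ih1.2.1, ih2.2.1,
      h.map_mul_mul_forkG i (by omega), ih2.2.2] at e2
    rw [show 2 * ((i + 1 : ℕ) : ℤ) - 2 = 2 * (i : ℕ) by push_cast; ring, ih1.2.2, ih2.2.1,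
      h.map_mul_mul_forkG i (by omega), ih2.2.2] at e3
    rw [e1, e2, e3]
    simp only [Nat.add_assoc, Nat.reduceAdd, trib_add_three]
    push_cast
    refine ⟨?_, ?_, ?_⟩ <;> ring

/-- The structure constants among the end vertices. -/
theorem map_fork_cube :
    τ (forkF R m * forkF R m * forkF R m) = trib (m + 1) ∧
    τ (forkF R m * forkF R m * forkG R m) = trib (m + 2) ∧
    τ (forkF R m * forkG R m * forkG R m) = trib (m + 3) ∧
    τ (forkG R m * forkG R m * forkG R m) = trib (m + 4) := by
  obtain ⟨e1, e2, e3⟩ := h.map_mul_fork_mul_fork (m + 1) le_rfl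
  obtain ⟨d1, d2, d3⟩ := h.map_mul_fork_mul_fork m (by omega)
  rw [show 2 * ((m + 1 : ℕ) : ℤ) = 2 * m + 2 by push_cast; ring,
      forkF_add_forkG (R := R) (m := m)] at e1 e2 e3
  -- Splitting `R (2 * m + 2) = f + g` gives three equations for four cubic traces. The fourth comes
  -- from letting `R 2` act on either factor of `f * g` in `R 2 * f * f * g`.
  have c1 : τ (R (2 * m) * forkF R m * forkG R m) + τ (forkF R m * forkG R m * forkG R m) =
      τ (R (2 * m) * forkF R m * forkF R m) + τ (forkF R m * forkF R m * forkF R m)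
        + 2 * τ (forkF R m * forkF R m * forkG R m) := by
    rw [← map_two_mul]
    simp only [← map_add]
    congr 1
    linear_combination forkF R m * forkF R m * h.two_mul_forkG_eq
      - forkF R m * forkG R m * h.two_mul_forkF_eq
  have a1 : τ (forkG R m * forkF R m * forkF R m) = τ (forkF R m * forkF R m * forkG R m) := by
    congr 1; ring
  have a2 : τ (forkG R m * forkF R m * forkG R m) = τ (forkF R m * forkG R m * forkG R m) := by
    congr 1; ring
  simp only [add_mul, map_add, a1, a2] at e1 e2 e3
  have t1 : (trib (m + 3) : ℝ) = trib (m + 2) + trib (m + 1) + trib m := by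
    exact_mod_cast trib_add_three m
  simp only [Nat.add_assoc, Nat.reduceAdd] at e1 e2 e3
  refine ⟨?_, ?_, ?_, ?_⟩ <;> linarith

end IsForkTrace

end ForkTrace

/-! ### Diagonal parts of the leg vertices of `Γ_k` and their triple traces -/

section Legs

variable {D : Type*} [CommRing D] [Algebra ℝ D]

/-- The diagonal parts of the end vertices of the legs, for `φ = 1` next to the branching vertex
and for `φ = -1` at distance three from it. -/
noncomputable def legEven (R : ℤ → D) (m : ℕ) (φ : ℤ) : D :=
  (1 / 2 : ℝ) • (forkG R m + (φ : ℝ) • forkF R m)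

/-- The diagonal parts of the middle vertices of the legs. -/
noncomputable def legOdd (R : ℤ → D) (m : ℕ) : D := (1 / 2 : ℝ) • forkH R m

namespace IsForkTrace

variable {R : ℤ → D} {m : ℕ} {τ : D →ₗ[ℝ] ℝ} (h : IsForkTrace R m τ)
include h

theorem map_even_legEven_legEven (i : ℕ) (hi : i ≤ m + 1) (φ φ' : ℤ) :
    4 * τ (R (2 * i) * legEven R m φ * legEven R m φ') =
      trib (i + 2) + trib (i + 3) + (φ + φ') * (trib (i + 1) + trib (i + 2))
        + φ * φ' * (trib i + trib (i + 1)) := by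
  obtain ⟨e1, e2, e3⟩ := h.map_mul_fork_mul_fork i hi
  have e : R (2 * i) * legEven R m φ * legEven R m φ' = (1 / 2 * (1 / 2) : ℝ) •
      (R (2 * i) * forkG R m * forkG R m
        + (φ + φ' : ℝ) • (R (2 * i) * forkF R m * forkG R m)
        + (φ * φ' : ℝ) • (R (2 * i) * forkF R m * forkF R m)) := by
    simp only [legEven, Algebra.smul_def, map_mul, map_add]
    ring
  rw [e]
  simp only [map_smul, map_add, e1, e2, e3, smul_eq_mul]
  ring

theorem map_even_diff_sq (i : ℕ) (hi : i ≤ m + 1) :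
    τ (R (2 * i) * (forkG R m - forkF R m) * (forkG R m - forkF R m)) = 2 * trib i := by
  obtain ⟨e1, e2, e3⟩ := h.map_mul_fork_mul_fork i hi
  have t1 : (trib (i + 3) : ℝ) = trib (i + 2) + trib (i + 1) + trib i := by
    exact_mod_cast trib_add_three i
  have e : R (2 * i) * (forkG R m - forkF R m) * (forkG R m - forkF R m) =
      R (2 * i) * forkG R m * forkG R m - R (2 * i) * forkF R m * forkG R m
        - R (2 * i) * forkF R m * forkG R m + R (2 * i) * forkF R m * forkF R m := by ring
  rw [e]
  simp only [map_add, map_sub, e1, e2, e3]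
  linarith

/-- The middle vertices are `R 1 * (g - f) / 2`, and `R 1 * R 1 = R 2 + 1` acts on `R j` by the walk
of length two. -/
theorem even_mul_legOdd_mul_legOdd (j : ℤ) : R j * legOdd R m * legOdd R m =
    (1 / 2 * (1 / 2) : ℝ) • (R (j + 2) * (forkG R m - forkF R m) * (forkG R m - forkF R m)
      + (2 : ℝ) • (R j * (forkG R m - forkF R m) * (forkG R m - forkF R m))
      + R (j - 2) * (forkG R m - forkF R m) * (forkG R m - forkF R m)) := by
  have h1 := h.two_mul_eq j
  have h2 := h.two_eq
  simp only [legOdd, h.forkH_eq, Algebra.smul_def, map_mul, map_ofNat]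
  linear_combination (algebraMap ℝ D (1 / 2)) ^ 2 * (forkG R m - forkF R m) ^ 2 *
    (h1 - R j * h2)

theorem map_legOdd_legOdd : 2 * τ (legOdd R m * legOdd R m) = 1 := by
  have e := h.even_mul_legOdd_mul_legOdd 0
  have neg2 : R (0 - 2) = -1 := by simpa [h.zero] using h.neg 0
  have e0 := h.map_even_diff_sq 0 (by omega)
  have e1 := h.map_even_diff_sq 1 (by omega)
  rw [h.zero, neg2, one_mul] at e
  simp only [Nat.cast_zero, mul_zero, h.zero] at e0
  rw [e]
  simp only [map_smul, map_add, neg_mul, map_neg, e0]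
  norm_num at e1 ⊢
  rw [e1]
  norm_num [trib_zero, trib_one]

theorem map_even_legOdd_legOdd (i : ℕ) (hi : i + 1 ≤ m) :
    2 * τ (R (2 * (i + 1 : ℕ)) * legOdd R m * legOdd R m) =
      trib (i + 2) + 2 * trib (i + 1) + trib i := by
  have e := h.even_mul_legOdd_mul_legOdd (2 * (i + 1 : ℕ))
  rw [show 2 * ((i + 1 : ℕ) : ℤ) + 2 = 2 * ((i + 2 : ℕ) : ℤ) by push_cast; ring,
    show 2 * ((i + 1 : ℕ) : ℤ) - 2 = 2 * (i : ℤ) by push_cast; ring] at e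
  rw [e]
  simp only [map_smul, map_add, h.map_even_diff_sq i (by omega),
    h.map_even_diff_sq (i + 1) (by omega), h.map_even_diff_sq (i + 2) (by omega), smul_eq_mul]
  ring

theorem odd_mul_legOdd (i : ℕ) (x : D) : R (2 * i + 1) * legOdd R m * x =
    (1 / 2 : ℝ) • (R (2 * i) * (forkG R m - forkF R m) * x
      + R (2 * (i + 1 : ℕ)) * (forkG R m - forkF R m) * x) := by
  have h1 := h.one_mul_eq (2 * i + 1)
  rw [show 2 * (i : ℤ) + 1 + 1 = 2 * (i + 1 : ℕ) by push_cast; ring, add_sub_cancel_right] at h1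
  simp only [legOdd, h.forkH_eq, Algebra.smul_def]
  linear_combination (algebraMap ℝ D (1 / 2)) * (forkG R m - forkF R m) * x * h1

theorem map_odd_legOdd_forkF (i : ℕ) (hi : i ≤ m) :
    τ (R (2 * i + 1) * legOdd R m * forkF R m) = trib (i + 2) := by
  obtain ⟨e1, e2, e3⟩ := h.map_mul_fork_mul_fork i (by omega)
  obtain ⟨d1, d2, d3⟩ := h.map_mul_fork_mul_fork (i + 1) (by omega)
  rw [h.odd_mul_legOdd]
  have comm (x : D) : x * (forkG R m - forkF R m) * forkF R m =
    x * forkF R m * forkG R m - x * forkF R m * forkF R m := by ring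
  have t1 : (trib (i + 3) : ℝ) = trib (i + 2) + trib (i + 1) + trib i := by
    exact_mod_cast trib_add_three i
  simp only [comm, map_smul, map_add, map_sub, e1, e2, d1, d2, smul_eq_mul, Nat.add_assoc,
    Nat.reduceAdd]
  linarith

theorem map_odd_legOdd_forkG (i : ℕ) (hi : i ≤ m) :
    τ (R (2 * i + 1) * legOdd R m * forkG R m) = trib (i + 3) := by
  obtain ⟨e1, e2, e3⟩ := h.map_mul_fork_mul_fork i (by omega)
  obtain ⟨d1, d2, d3⟩ := h.map_mul_fork_mul_fork (i + 1) (by omega)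
  rw [h.odd_mul_legOdd]
  have comm (x : D) : x * (forkG R m - forkF R m) * forkG R m =
    x * forkG R m * forkG R m - x * forkF R m * forkG R m := by ring
  have t1 : (trib (i + 3) : ℝ) = trib (i + 2) + trib (i + 1) + trib i := by
    exact_mod_cast trib_add_three i
  have t2 : (trib (i + 4) : ℝ) = trib (i + 3) + trib (i + 2) + trib (i + 1) := by
    exact_mod_cast trib_add_three (i + 1)
  simp only [comm, map_smul, map_add, map_sub, e3, e2, d3, d2, smul_eq_mul, Nat.add_assoc,
    Nat.reduceAdd]
  linarith

omit h in
theorem map_mul_legEven (x : D) (φ : ℤ) :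
    τ (x * legEven R m φ) = 1 / 2 * (τ (x * forkG R m) + φ * τ (x * forkF R m)) := by
  simp only [legEven, mul_smul_comm, mul_add, map_smul, map_add, smul_eq_mul]

theorem map_odd_legOdd_legEven (i : ℕ) (hi : i ≤ m) (φ : ℤ) :
    4 * τ (R (2 * i + 1) * legOdd R m * legEven R m φ) =
      trib (i + 2) + trib (i + 3) + trib i + trib (i + 1)
        + φ * (trib (i + 2) + trib (i + 3) - trib i - trib (i + 1)) := by
  have t1 : (trib (i + 3) : ℝ) = trib (i + 2) + trib (i + 1) + trib i := by
    exact_mod_cast trib_add_three i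
  rw [map_mul_legEven, h.map_odd_legOdd_forkF i hi, h.map_odd_legOdd_forkG i hi]
  linear_combination (1 - φ) * t1

/-- With `d = g - f`, the square of `legOdd` is `(R 2 + 1) * d * d / 4`; letting `R 2` act on the
remaining end vertex leaves only cubes of `f`, `g` and traces with `R (2 * m)`. -/
theorem map_legOdd_legOdd_fork :
    2 * τ (legOdd R m * legOdd R m * forkF R m) = trib m + trib (m + 1) ∧
    2 * τ (legOdd R m * legOdd R m * forkG R m) = trib (m + 1) + trib (m + 2) := by
  have e := h.even_mul_legOdd_mul_legOdd 0
  have neg2 : R (0 - 2) = -1 := by simpa [h.zero] using h.neg 0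
  rw [h.zero, neg2, one_mul, zero_add] at e
  set d := forkG R m - forkF R m with hd
  have a1 : legOdd R m * legOdd R m * forkF R m = (1 / 2 * (1 / 2) : ℝ) •
      (R (2 * m) * d * d + forkG R m * d * d + forkF R m * d * d) := by
    rw [e]
    simp only [Algebra.smul_def, map_mul, map_ofNat]
    linear_combination algebraMap ℝ D (1 / 2) ^ 2 * d ^ 2 * h.two_mul_forkF_eq
  have a2 : legOdd R m * legOdd R m * forkG R m = (1 / 2 * (1 / 2) : ℝ) •
      (R (2 * m) * d * d + forkF R m * d * d + (3 : ℝ) • (forkG R m * d * d)) := by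
    rw [e]
    simp only [Algebra.smul_def, map_mul, map_ofNat]
    linear_combination algebraMap ℝ D (1 / 2) ^ 2 * d ^ 2 * h.two_mul_forkG_eq
  have e0 := h.map_even_diff_sq m (by omega)
  obtain ⟨c1, c2, c3, c4⟩ := h.map_fork_cube
  have b1 : forkF R m * d * d = forkF R m * forkG R m * forkG R m
      - forkF R m * forkF R m * forkG R m - forkF R m * forkF R m * forkG R m
      + forkF R m * forkF R m * forkF R m := by rw [hd]; ring
  have b2 : forkG R m * d * d = forkG R m * forkG R m * forkG R m
      - forkF R m * forkG R m * forkG R m - forkF R m * forkG R m * forkG R m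
      + forkF R m * forkF R m * forkG R m := by rw [hd]; ring
  have t1 : (trib (m + 3) : ℝ) = trib (m + 2) + trib (m + 1) + trib m := by
    exact_mod_cast trib_add_three m
  have t2 : (trib (m + 4) : ℝ) = trib (m + 3) + trib (m + 2) + trib (m + 1) := by
    exact_mod_cast trib_add_three (m + 1)
  rw [a1, a2]
  simp only [map_smul, map_add, smul_eq_mul, b1, b2, map_sub, c1, c2, c3, c4]
  constructor <;> linarith

theorem map_legOdd_legOdd_legEven (φ : ℤ) :
    4 * τ (legOdd R m * legOdd R m * legEven R m φ) =
      trib (m + 1) + trib (m + 2) + φ * (trib m + trib (m + 1)) := by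
  obtain ⟨e1, e2⟩ := h.map_legOdd_legOdd_fork
  rw [map_mul_legEven]
  linear_combination e2 + φ * e1

theorem map_legEven_cube (φ₁ φ₂ φ₃ : ℤ) :
    8 * τ (legEven R m φ₁ * legEven R m φ₂ * legEven R m φ₃) =
      trib (m + 4) + (φ₁ + φ₂ + φ₃) * trib (m + 3)
        + (φ₁ * φ₂ + φ₂ * φ₃ + φ₃ * φ₁) * trib (m + 2) + φ₁ * φ₂ * φ₃ * trib (m + 1) := by
  obtain ⟨c1, c2, c3, c4⟩ := h.map_fork_cube
  have e : legEven R m φ₁ * legEven R m φ₂ * legEven R m φ₃ = (1 / 2 * (1 / 2 * (1 / 2)) : ℝ) •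
      (forkG R m * forkG R m * forkG R m
        + (φ₁ + φ₂ + φ₃ : ℝ) • (forkF R m * forkG R m * forkG R m)
        + (φ₁ * φ₂ + φ₂ * φ₃ + φ₃ * φ₁ : ℝ) • (forkF R m * forkF R m * forkG R m)
        + (φ₁ * φ₂ * φ₃ : ℝ) • (forkF R m * forkF R m * forkF R m)) := by
    simp only [legEven, Algebra.smul_def, map_mul, map_add]
    ring
  rw [e]
  simp only [map_smul, map_add, c1, c2, c3, c4, smul_eq_mul]
  ring

end IsForkTrace

end Legs

/-! ### The polynomials `q_k` in terms of Chebyshev polynomials in `x²` -/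

section Polynomials

open Polynomial

/-- `S_{2j+1}(x) = x W_j(x²)`. -/
noncomputable def oddPoly (j : ℤ) : ℝ[X] := (Chebyshev.S ℝ j).comp (X - 2)

/-- `S_{2j}(x) = T_j(x²)`. -/
noncomputable def evenPoly (j : ℤ) : ℝ[X] := oddPoly j + oddPoly (j - 1)

theorem oddPoly_add_one (j : ℤ) : oddPoly (j + 1) = (X - 2) * oddPoly j - oddPoly (j - 1) := by
  simp [oddPoly, Chebyshev.S_add_one]

theorem oddPoly_zero : oddPoly 0 = 1 := by simp [oddPoly]

theorem oddPoly_neg_one : oddPoly (-1) = 0 := by simp [oddPoly]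

theorem oddPoly_one : oddPoly 1 = X - 2 := by simp [oddPoly]

theorem evenPoly_add_one (j : ℤ) : evenPoly (j + 1) = (X - 2) * evenPoly j - evenPoly (j - 1) := by
  have h1 := oddPoly_add_one j
  have h2 := oddPoly_add_one (j - 1)
  rw [sub_add_cancel] at h2
  rw [evenPoly, evenPoly, evenPoly, add_sub_cancel_right]
  linear_combination h1 + h2

theorem evenPoly_zero : evenPoly 0 = 1 := by simp [evenPoly, oddPoly_zero, oddPoly_neg_one]

theorem evenPoly_one : evenPoly 1 = X - 1 := by
  simp [evenPoly, oddPoly_zero, oddPoly_one]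
  ring

theorem X_mul_oddPoly (j : ℤ) : X * oddPoly j = evenPoly (j + 1) + evenPoly j := by
  rw [evenPoly, evenPoly, oddPoly_add_one, add_sub_cancel_right]
  ring

theorem eval_S_two_mul (j : ℤ) (x : ℝ) :
    (Chebyshev.S ℝ (2 * j)).eval x = (evenPoly j).eval (x ^ 2) ∧
      (Chebyshev.S ℝ (2 * j + 1)).eval x = x * (oddPoly j).eval (x ^ 2) := by
  have step (j : ℤ) : (Chebyshev.S ℝ (j + 1)).eval x =
      x * (Chebyshev.S ℝ j).eval x - (Chebyshev.S ℝ (j - 1)).eval x := by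
    simp [Chebyshev.S_add_one]
  have odd (j : ℤ) : (Chebyshev.S ℝ (2 * j + 1)).eval x = x * (oddPoly j).eval (x ^ 2) := by
    refine sub_eq_zero.1 (eq_zero_of_recurrence
      (φ := fun j => (Chebyshev.S ℝ (2 * j + 1)).eval x - x * (oddPoly j).eval (x ^ 2))
      (x := x ^ 2 - 2) (fun j => ?_) ?_ ?_ j)
    · have h1 := step (2 * j + 2)
      have h2 := step (2 * j + 1)
      have h3 := step (2 * j)
      have h4 : (oddPoly (j + 1)).eval (x ^ 2) =
          (x ^ 2 - 2) * (oddPoly j).eval (x ^ 2) - (oddPoly (j - 1)).eval (x ^ 2) := by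
        simp [oddPoly_add_one]
      rw [show 2 * j + 2 - 1 = 2 * j + 1 by ring] at h1
      rw [show 2 * j + 1 + 1 = 2 * j + 2 by ring, add_sub_cancel_right] at h2
      simp only [show 2 * (j + 1) + 1 = 2 * j + 2 + 1 by ring,
        show 2 * (j - 1) + 1 = 2 * j - 1 by ring]
      linear_combination h1 + x * h2 + h3 - x * h4
    · simp [oddPoly_zero]
    · simp [oddPoly_neg_one]
  refine ⟨?_, odd j⟩
  have key (j : ℤ) : x * (Chebyshev.S ℝ (2 * j)).eval x = x * (evenPoly j).eval (x ^ 2) := by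
    have h1 := step (2 * j)
    have h2 := odd j
    have h3 := odd (j - 1)
    rw [show 2 * (j - 1) + 1 = 2 * j - 1 by ring] at h3
    rw [evenPoly, eval_add]
    linear_combination h2 + h3 - h1
  refine sub_eq_zero.1 (eq_zero_of_recurrence
    (φ := fun j => (Chebyshev.S ℝ (2 * j)).eval x - (evenPoly j).eval (x ^ 2))
    (x := x ^ 2 - 2) (fun j => ?_) ?_ ?_ j)
  · have h1 := step (2 * j + 1)
    have h2 := step (2 * j)
    have h3 := step (2 * j - 1)
    have h4 : (evenPoly (j + 1)).eval (x ^ 2) =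
        (x ^ 2 - 2) * (evenPoly j).eval (x ^ 2) - (evenPoly (j - 1)).eval (x ^ 2) := by
      simp [evenPoly_add_one]
    rw [add_sub_cancel_right] at h1
    rw [sub_add_cancel, show 2 * j - 1 - 1 = 2 * (j - 1) by ring] at h3
    simp only [show 2 * (j + 1) = 2 * j + 1 + 1 by ring]
    linear_combination h1 + x * h2 + h3 - h4
  · simp [evenPoly_zero]
  · have : (Chebyshev.S ℝ (2 * (-1))).eval x = -1 := by
      norm_num [Chebyshev.S_neg_two]
    rw [this]
    norm_num [evenPoly, oddPoly_neg_one]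
    simp [oddPoly, Chebyshev.S_neg_two]

/-- The right side is the relation `IsForkTrace.rel` for `m = 2 * k + 1`, divided by `x` and written
in `x²`. -/
theorem X_sub_two_mul_q (k : ℕ) : (X - 2) * q k =
    oddPoly (2 * k + 3) - oddPoly (2 * k + 2) - oddPoly (2 * k + 1) - oddPoly (2 * k) := by
  have h2 := oddPoly_add_one 1
  have h3 := oddPoly_add_one 2
  have h4 := oddPoly_add_one 3
  have h5 := oddPoly_add_one 4
  norm_num [oddPoly_zero, oddPoly_one] at h2 h3 h4 h5
  induction k using Nat.twoStepInduction with
  | zero =>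
    norm_num [q, oddPoly_zero, oddPoly_one]
    rw [h3, h2]
    ring
  | one =>
    norm_num [q, oddPoly_zero, oddPoly_one]
    rw [h5, h4, h3, h2]
    ring
  | more k ih1 ih2 =>
    have step (j : ℤ) : oddPoly (j + 4) = (X ^ 2 - 4 * X + 2) * oddPoly (j + 2) - oddPoly j := by
      have e1 := oddPoly_add_one (j + 3)
      have e2 := oddPoly_add_one (j + 2)
      have e3 := oddPoly_add_one (j + 1)
      rw [add_assoc, add_sub_assoc] at e1 e2 e3
      norm_num at e1 e2 e3
      linear_combination e1 + (X - 2) * e2 + e3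
    have s0 := step (2 * k)
    have s1 := step (2 * k + 1)
    have s2 := step (2 * k + 2)
    have s3 := step (2 * k + 3)
    rw [q]
    push_cast at ih2 ⊢
    ring_nf at ih1 ih2 s0 s1 s2 s3 ⊢
    linear_combination -ih1 + (X ^ 2 - 4 * X + 2) * ih2 + s0 + s1 + s2 - s3

/-- In this form the polynomial is the relation closing the sequence `T_j(𝔻) a₀`; its leading term
also gives the degree of `q k`. -/
theorem X_mul_X_sub_two_mul_q (k : ℕ) : X * (X - 2) * q k =
    evenPoly (2 * k + 4) - 2 * evenPoly (2 * k + 2) - 2 * evenPoly (2 * k + 1)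
      - evenPoly (2 * k) := by
  have h0 := X_mul_oddPoly (2 * k)
  have h1 := X_mul_oddPoly (2 * k + 1)
  have h2 := X_mul_oddPoly (2 * k + 2)
  have h3 := X_mul_oddPoly (2 * k + 3)
  have h := X_sub_two_mul_q k
  rw [add_assoc] at h1 h2 h3
  norm_num at h1 h2 h3
  linear_combination X * h + h3 - h2 - h1 - h0

theorem evenPoly_monic (j : ℕ) : (evenPoly j).Monic ∧ (evenPoly j).natDegree = j := by
  suffices h : ∀ j : ℕ, ((evenPoly j).Monic ∧ (evenPoly j).natDegree = j) ∧
      (evenPoly (j + 1 : ℕ)).Monic ∧ (evenPoly (j + 1 : ℕ)).natDegree = j + 1 from (h j).1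
  intro j
  have hX : (X - 2 : ℝ[X]).Monic := monic_X_sub_C 2
  have hd : (X - 2 : ℝ[X]).natDegree = 1 := natDegree_X_sub_C 2
  induction j with
  | zero =>
    norm_num [evenPoly_zero, evenPoly_one]
    exact ⟨by simpa using monic_X_sub_C (1 : ℝ), by simpa using natDegree_X_sub_C (1 : ℝ)⟩
  | succ j ih =>
    refine ⟨ih.2, ?_⟩
    have e := evenPoly_add_one (j + 1)
    rw [add_sub_cancel_right] at e
    push_cast at ih ⊢
    rw [e]
    have hm : ((X - 2) * evenPoly (j + 1)).Monic := hX.mul ih.2.1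
    have hn : ((X - 2) * evenPoly (j + 1)).natDegree = j + 2 := by
      rw [hX.natDegree_mul ih.2.1, hd, ih.2.2]
      ring
    have hlt : (evenPoly j).degree < ((X - 2) * evenPoly (j + 1)).degree := by
      rw [degree_eq_natDegree ih.1.1.ne_zero, degree_eq_natDegree hm.ne_zero, hn, ih.1.2]
      exact_mod_cast (by omega : j < j + 2)
    refine ⟨hm.sub_of_left hlt, ?_⟩
    rw [natDegree_sub_eq_left_of_natDegree_lt, hn]
    rw [hn, ih.1.2]
    omega

theorem q_monic (k : ℕ) : (q k).Monic ∧ (q k).natDegree = 2 * k + 2 := by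
  have h := X_mul_X_sub_two_mul_q k
  have hX : (X * (X - 2) : ℝ[X]).Monic := monic_X.mul (monic_X_sub_C 2)
  have hd : (X * (X - 2) : ℝ[X]).natDegree = 2 := by
    have h1 : (X - 2 : ℝ[X]).Monic := monic_X_sub_C 2
    have h2 : (X - 2 : ℝ[X]).natDegree = 1 := natDegree_X_sub_C 2
    rw [monic_X.natDegree_mul h1, natDegree_X, h2]
  have h4 := evenPoly_monic (2 * k + 4)
  have h2 := evenPoly_monic (2 * k + 2)
  have h1 := evenPoly_monic (2 * k + 1)
  have h0 := evenPoly_monic (2 * k)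
  push_cast at h4 h2 h1 h0
  have hlow : (2 * evenPoly (2 * k + 2) + 2 * evenPoly (2 * k + 1) + evenPoly (2 * k)).natDegree ≤
      2 * k + 2 := by
    have c2 : (2 : ℝ[X]) = C 2 := rfl
    refine (natDegree_add_le _ _).trans (max_le ((natDegree_add_le _ _).trans (max_le ?_ ?_)) ?_)
    · rw [c2]; exact (natDegree_C_mul_le _ _).trans h2.2.le
    · rw [c2]; exact (natDegree_C_mul_le _ _).trans (by omega)
    · omega
  have h' : X * (X - 2) * q k = evenPoly (2 * k + 4) -
      (2 * evenPoly (2 * k + 2) + 2 * evenPoly (2 * k + 1) + evenPoly (2 * k)) := by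
    rw [h]; ring
  have hm : (X * (X - 2) * q k).Monic := by
    rw [h']
    refine h4.1.sub_of_left (degree_lt_degree ?_)
    omega
  have hn : (X * (X - 2) * q k).natDegree = 2 * k + 4 := by
    rw [h', natDegree_sub_eq_left_of_natDegree_lt (by omega), h4.2]
  have hq := hX.of_mul_monic_left hm
  refine ⟨hq, ?_⟩
  rw [hX.natDegree_mul hq, hd] at hn
  omega

theorem q_eval_zero (k : ℕ) : (q k).eval 0 = 2 * k + 3 := by
  induction k using Nat.twoStepInduction with
  | zero => simp [q]
  | one => norm_num [q]
  | more k ih1 ih2 =>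
    rw [q]
    simp [ih1, ih2]
    ring

theorem q_eval_two (k : ℕ) : (q k).eval 2 = (-1) ^ (k + 1) * (2 * k + 3) := by
  induction k using Nat.twoStepInduction with
  | zero => norm_num [q]
  | one => norm_num [q]
  | more k ih1 ih2 =>
    rw [q]
    simp [ih1, ih2]
    ring

end Polynomials

/-! ### Spectral measure of a vector under a symmetric operator -/

section Spectral

open Polynomial Module.End

variable {E : Type*} [NormedAddCommGroup E] [InnerProductSpace ℝ E] [FiniteDimensional ℝ E]
  {T : Module.End ℝ E}

/-- Lagrange interpolation at `s` splits `v` into eigenvectors. Eigenspaces of a symmetric operator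
are orthogonal, so the pieces are the projections of `v`. -/
theorem sum_starProjection_eigenspace (hT : T.IsSymmetric) {v : E} {s : Finset ℝ}
    (hv : aeval T (∏ a ∈ s, (X - C a)) v = 0) :
    ∃ w : ℝ → E, (∀ a ∈ s, w a ∈ T.eigenspace a) ∧ v = ∑ a ∈ s, w a ∧
      (∀ a ∈ s, w a = (T.eigenspace a).starProjection v) ∧
      ∀ a ∈ s, w a = aeval T (Lagrange.basis s id a) v := by
  classical
  refine ⟨fun a => aeval T (Lagrange.basis s id a) v, ?_⟩
  have mem : ∀ a ∈ s, aeval T (Lagrange.basis s id a) v ∈ T.eigenspace a := by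
    intro a ha
    have hX : (X - C a : ℝ[X]) * Lagrange.basis s id a =
        C (Lagrange.nodalWeight s id a) * ∏ a ∈ s, (X - C a) := by
      rw [Lagrange.basis_eq_prod_sub_inv_mul_nodal_div ha,
        ← Lagrange.nodal_erase_eq_nodal_div ha]
      have e1 := Lagrange.nodal_eq_mul_nodal_erase (v := (id : ℝ → ℝ)) ha
      have e2 := Lagrange.nodal_eq s (id : ℝ → ℝ)
      simp only [id] at e1 e2
      rw [← e2, e1]
      ring
    have : aeval T ((X - C a : ℝ[X]) * Lagrange.basis s id a) v = 0 := by
      rw [hX, map_mul, Module.End.mul_apply, hv, map_zero]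
    rw [map_mul, Module.End.mul_apply] at this
    simp only [map_sub, aeval_X, aeval_C, LinearMap.sub_apply, Module.algebraMap_end_apply] at this
    rw [mem_eigenspace_iff]
    exact sub_eq_zero.1 this
  have sum : v = ∑ a ∈ s, aeval T (Lagrange.basis s id a) v := by
    rcases s.eq_empty_or_nonempty with rfl | hs
    · simpa using hv
    · rw [← LinearMap.sum_apply, ← map_sum, Lagrange.sum_basis Function.injective_id.injOn hs]
      simp
  refine ⟨mem, sum, fun a ha => ?_, fun a ha => rfl⟩
  conv_rhs => rw [sum, map_sum]
  rw [Finset.sum_eq_single a]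
  · exact (Submodule.starProjection_eq_self_iff.2 (mem a ha)).symm
  · intro b hb hba
    rw [Submodule.starProjection_apply_eq_zero_iff]
    rw [Submodule.mem_orthogonal]
    intro u hu
    have := hT.orthogonalFamily_eigenspaces hba.symm ⟨u, hu⟩ ⟨_, mem b hb⟩
    simpa using this
  · exact fun h => absurd ha h

omit [FiniteDimensional ℝ E] in
theorem aeval_apply_of_mem_eigenspace (p : ℝ[X]) {a : ℝ} {w : E} (hw : w ∈ T.eigenspace a) :
    aeval T p w = p.eval a • w := by
  rw [mem_eigenspace_iff] at hw
  induction p using Polynomial.induction_on' with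
  | add p q hp hq => simp [hp, hq, add_smul]
  | monomial n c =>
    have : (T ^ n) w = a ^ n • w := by
      induction n with
      | zero => simp
      | succ n ih => rw [pow_succ, Module.End.mul_apply, hw, map_smul, ih, smul_smul]; ring_nf
    simp [aeval_monomial, this, smul_smul, mul_comm]

/-- The spectral measure of a vector killed by a polynomial with simple real roots. -/
theorem inner_aeval_eq_sum (hT : T.IsSymmetric) {v : E} {s : Finset ℝ}
    (hv : aeval T (∏ a ∈ s, (X - C a)) v = 0) (p : ℝ[X]) :
    inner ℝ (aeval T p v) v =
      ∑ a ∈ s, inner ℝ ((T.eigenspace a).starProjection v) v * p.eval a := by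
  obtain ⟨w, hw, hsum, hproj, -⟩ := sum_starProjection_eigenspace hT hv
  conv_lhs => enter [2]; rw [hsum]
  rw [map_sum, sum_inner]
  refine Finset.sum_congr rfl fun a ha => ?_
  rw [aeval_apply_of_mem_eigenspace p (hw a ha), inner_smul_left, ← hproj a ha]
  simp [mul_comm]

/-- If the component at `a` were zero, the Lagrange basis polynomial at `a`, of degree `s.card - 1`,
would annihilate `v`. -/
theorem inner_starProjection_pos (hT : T.IsSymmetric) {v : E} {s : Finset ℝ}
    (hv : aeval T (∏ a ∈ s, (X - C a)) v = 0)
    (hmin : ∀ p : ℝ[X], p.degree < s.card → aeval T p v = 0 → p = 0) {a : ℝ} (ha : a ∈ s) :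
    0 < inner ℝ ((T.eigenspace a).starProjection v) v ∧ HasEigenvalue T a := by
  obtain ⟨w, hw, hsum, hproj, hbasis⟩ := sum_starProjection_eigenspace hT hv
  have hne : w a ≠ 0 := by
    intro h0
    rw [hbasis a ha] at h0
    have := hmin _ (by
      rw [Lagrange.degree_basis Function.injective_id.injOn ha]
      exact_mod_cast Nat.sub_lt (Finset.card_pos.2 ⟨a, ha⟩) one_pos) h0
    have h1 := Lagrange.eval_basis_self (v := (id : ℝ → ℝ)) Function.injective_id.injOn ha
    rw [this] at h1
    simp at h1
  refine ⟨?_, hasEigenvalue_of_hasEigenvector ⟨hw a ha, hne⟩⟩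
  rw [← Submodule.starProjection_eq_self_iff.2 (hw a ha), hproj a ha] at hne
  have h2 : inner ℝ ((T.eigenspace a).starProjection v) v =
      inner ℝ ((T.eigenspace a).starProjection v) ((T.eigenspace a).starProjection v) := by
    conv_rhs => rw [Submodule.inner_starProjection_left_eq_right]
    rw [Submodule.starProjection_eq_self_iff.2 (Submodule.starProjection_apply_mem _ _),
      Submodule.inner_starProjection_left_eq_right]
  rw [h2, real_inner_self_eq_norm_sq]
  have h3 : (T.eigenspace a).starProjection v ≠ 0 := fun h => hne (by rw [h, map_zero])
  positivity

/-- The annihilating polynomial of a vector under a symmetric operator has simple real roots. -/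
theorem splits_of_minimal (hT : T.IsSymmetric) {v : E} {P : ℝ[X]} (hP : P.Monic)
    (hv : aeval T P v = 0) (hmin : ∀ p : ℝ[X], p.degree < P.degree → aeval T p v = 0 → p = 0) :
    P.Splits ∧ P.roots.Nodup := by
  classical
  have hfin : {a : ℝ | HasEigenvalue T a}.Finite := finite_hasEigenvalue T
  set s := hfin.toFinset
  set Q : ℝ[X] := ∏ a ∈ s, (X - C a) with hQ
  -- Eigenspaces span, so the product over all eigenvalues annihilates every vector; by minimality
  -- `P` divides this product of distinct linear factors.
  have hQv : aeval T Q v = 0 := by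
    have htop : (⨆ a, T.eigenspace a) = ⊤ := by
      rw [← Submodule.orthogonal_eq_bot_iff]
      exact hT.orthogonalComplement_iSup_eigenspaces_eq_bot
    have hv' : v ∈ ⨆ a, T.eigenspace a := by rw [htop]; trivial
    clear hmin hv
    induction hv' using Submodule.iSup_induction' with
    | mem a x hx =>
      rcases eq_or_ne x 0 with rfl | hx0
      · simp
      · have ha : a ∈ s := by
          rw [Set.Finite.mem_toFinset]
          exact hasEigenvalue_of_hasEigenvector ⟨hx, hx0⟩
        rw [aeval_apply_of_mem_eigenspace Q hx, hQ, eval_prod, Finset.prod_eq_zero ha (by simp),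
          zero_smul]
    | zero => simp
    | add x y _ _ hx hy => rw [map_add, hx, hy, add_zero]
  have hdvd : P ∣ Q := by
    rw [← modByMonic_eq_zero_iff_dvd hP]
    apply hmin _ (degree_modByMonic_lt Q hP)
    have e := modByMonic_add_div Q P
    rw [← e, mul_comm P, map_add, map_mul, LinearMap.add_apply, Module.End.mul_apply, hv, map_zero,
      add_zero] at hQv
    exact hQv
  have hQ0 : Q ≠ 0 := (monic_prod_of_monic _ _ fun a _ => monic_X_sub_C a).ne_zero
  refine ⟨Splits.of_dvd (Splits.prod fun a _ => Splits.X_sub_C a) hQ0 hdvd, ?_⟩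
  refine Multiset.nodup_of_le (roots.le_of_dvd hQ0 hdvd) ?_
  rw [hQ, roots_prod_X_sub_C]
  exact s.nodup

end Spectral

/-! ### The operator `𝔻` on explicit vectors and the orbit of `a₀` -/

section Vectors

variable {k : ℕ}

/-- A function on the vertices of `Γ_k`, by its values on the even vertices. -/
def evenFun (k : ℕ) (α : ℕ → ℝ) (b₁ b₃ c₁ c₃ : ℝ) : GammaVertex k → ℝ
  | .a j => α (j / 2)
  | .b1 => b₁
  | .b2 => 0
  | .b3 => b₃
  | .c1 => c₁
  | .c2 => 0
  | .c3 => c₃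

/-- The values of `Gᵗ` on `evenFun`. -/
def oddFun (k : ℕ) (α : ℕ → ℝ) (b₁ b₃ c₁ c₃ : ℝ) : GammaVertex k → ℝ
  | .a j => if j.val = 4 * k + 3 then α (2 * k + 1) + (b₁ + c₁) else α (j / 2) + α (j / 2 + 1)
  | .b2 => b₁ + b₃
  | .c2 => c₁ + c₃
  | _ => 0

/-- The vector on the even vertices of `Γ_k` with the given values. -/
noncomputable def evenVec (k : ℕ) (α : ℕ → ℝ) (b₁ b₃ c₁ c₃ : ℝ) :
    EuclideanSpace ℝ {v : GammaVertex k // ¬ v.IsOdd} :=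
  WithLp.toLp 2 fun v => evenFun k α b₁ b₃ c₁ c₃ v.1

/-- Turns a row of `G` or its transpose into a sum over an explicit list of neighbours. -/
theorem sum_subtype_ite_mul_eq {ι : Type*} {p : ι → Prop} [Fintype {x // p x}] (P : ι → Prop)
    [DecidablePred P] (w : ι → ℝ) (s : Finset ι) (hs : ∀ x, P x ↔ x ∈ s) (hp : ∀ x ∈ s, p x) :
    ∑ x : {x // p x}, (if P x.1 then 1 else 0) * w x.1 = ∑ x ∈ s, w x := by
  classical
  simp only [ite_mul, one_mul, zero_mul, ← Finset.sum_filter]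
  refine Finset.sum_bij (fun x _ => x.1) (fun x hx => ?_) (fun x _ y _ h => Subtype.ext h)
    (fun x hx => ⟨⟨x, hp x hx⟩, ?_, rfl⟩) fun x _ => rfl
  · simpa [hs] using hx
  · simpa [hs] using hx

theorem transpose_mulVec_evenVec (α : ℕ → ℝ) (b₁ b₃ c₁ c₃ : ℝ) :
    (G k).transpose.mulVec (evenVec k α b₁ b₃ c₁ c₃).ofLp =
      fun v => oddFun k α b₁ b₃ c₁ c₃ v.1 := by
  classical
  ext ⟨v, hv⟩
  simp only [Matrix.mulVec, dotProduct, Matrix.transpose_apply, G, evenVec]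
  cases v with
  | a j =>
    have hj : Odd j.val := hv
    obtain ⟨i, hi⟩ := hj
    have hlt := j.2
    by_cases h : j.val = 4 * k + 3
    · rw [sum_subtype_ite_mul_eq (fun x => (Gamma k).Adj x (.a j)) (evenFun k α b₁ b₃ c₁ c₃)
        {.a ⟨4 * k + 2, by omega⟩, .b1, .c1}]
      · simp [evenFun, oddFun, h]
        congr 1
        omega
      · intro x
        cases x <;> simp [Gamma, GammaEdge, h, Fin.ext_iff]
        omega
      · simp [GammaVertex.IsOdd, parity_simps]
    · rw [sum_subtype_ite_mul_eq (fun x => (Gamma k).Adj x (.a j)) (evenFun k α b₁ b₃ c₁ c₃)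
        {.a ⟨j.val - 1, by omega⟩, .a ⟨j.val + 1, by omega⟩}]
      · rw [Finset.sum_pair (by simp)]
        simp only [evenFun, oddFun, h, if_false]
        congr 2 <;> omega
      · intro x
        cases x <;> simp [Gamma, GammaEdge, h, Fin.ext_iff]
        omega
      · simp [GammaVertex.IsOdd, hi, parity_simps]
  | b1 => exact hv.elim
  | b2 =>
    rw [sum_subtype_ite_mul_eq (fun x => (Gamma k).Adj x .b2) (evenFun k α b₁ b₃ c₁ c₃)
        {.b1, .b3}]
    · simp [evenFun, oddFun]
    · intro x
      cases x <;> simp [Gamma, GammaEdge]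
    · simp [GammaVertex.IsOdd]
  | b3 => exact hv.elim
  | c1 => exact hv.elim
  | c2 =>
    rw [sum_subtype_ite_mul_eq (fun x => (Gamma k).Adj x .c2) (evenFun k α b₁ b₃ c₁ c₃)
        {.c1, .c3}]
    · simp [evenFun, oddFun]
    · intro x
      cases x <;> simp [Gamma, GammaEdge]
    · simp [GammaVertex.IsOdd]
  | c3 => exact hv.elim

/-- The action of `𝔻` on explicit vectors. -/
theorem DD_evenVec (α : ℕ → ℝ) (b₁ b₃ c₁ c₃ : ℝ) :
    DD k (evenVec k α b₁ b₃ c₁ c₃) = evenVec k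
      (fun i => (if i = 0 then 0 else α (i - 1) + α i) +
        if i = 2 * k + 1 then α (2 * k + 1) + (b₁ + c₁) else α i + α (i + 1))
      (α (2 * k + 1) + (b₁ + c₁) + (b₁ + b₃)) (b₁ + b₃)
      (α (2 * k + 1) + (b₁ + c₁) + (c₁ + c₃)) (c₁ + c₃) := by
  rw [DD, Matrix.toLpLin_apply, ← Matrix.mulVec_mulVec, transpose_mulVec_evenVec, evenVec]
  congr 1
  classical
  ext ⟨v, hv⟩
  simp only [Matrix.mulVec, dotProduct, G]
  cases v with
  | a j =>
    have hj : ¬ Odd j.val := hv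
    rw [Nat.not_odd_iff_even] at hj
    obtain ⟨i, hi⟩ := hj
    have hlt := j.2
    by_cases h : j.val = 0
    · obtain ⟨j, hlt⟩ := j
      obtain rfl : j = 0 := h
      rw [sum_subtype_ite_mul_eq (fun x => (Gamma k).Adj (.a ⟨0, hlt⟩) x) (oddFun k α b₁ b₃ c₁ c₃)
        {.a ⟨1, by omega⟩}]
      · simp [evenFun, oddFun]
      · intro x
        cases x with
        | a i =>
          simp only [Gamma, SimpleGraph.fromRel_adj, GammaEdge, ne_eq, GammaVertex.a.injEq,
            Fin.ext_iff, Finset.mem_singleton]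
          omega
        | _ => simp [Gamma, GammaEdge]
      · simp [GammaVertex.IsOdd]
    · rw [sum_subtype_ite_mul_eq (fun x => (Gamma k).Adj (.a j) x) (oddFun k α b₁ b₃ c₁ c₃)
        {.a ⟨j.val - 1, by omega⟩, .a ⟨j.val + 1, by omega⟩}]
      · rw [Finset.sum_pair (by simp)]
        have e1 : (j.val - 1) / 2 = j.val / 2 - 1 := by omega
        have e2 : j.val / 2 - 1 + 1 = j.val / 2 := by omega
        have e3 : (j.val + 1) / 2 = j.val / 2 := by omega
        simp only [evenFun, oddFun, e1, e2, e3]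
        rw [if_neg (show ¬ j.val - 1 = 4 * k + 3 by omega), if_neg (show ¬ j.val / 2 = 0 by omega)]
        congr 1
        by_cases h' : j.val / 2 = 2 * k + 1
        · rw [if_pos (by omega), if_pos h']
        · rw [if_neg (by omega), if_neg h']
      · intro x
        cases x <;> simp [Gamma, GammaEdge, Fin.ext_iff] <;> omega
      · simp only [Finset.mem_insert, Finset.mem_singleton, forall_eq_or_imp, forall_eq,
          GammaVertex.IsOdd]
        exact ⟨⟨i - 1, by omega⟩, ⟨i, by omega⟩⟩
  | b1 =>
    rw [sum_subtype_ite_mul_eq (fun x => (Gamma k).Adj .b1 x) (oddFun k α b₁ b₃ c₁ c₃)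
        {.a ⟨4 * k + 3, by omega⟩, .b2}]
    · simp [evenFun, oddFun]
    · intro x
      cases x <;> simp [Gamma, GammaEdge, Fin.ext_iff]
    · simp [GammaVertex.IsOdd, parity_simps]
  | b2 => exact (hv trivial).elim
  | b3 =>
    rw [sum_subtype_ite_mul_eq (fun x => (Gamma k).Adj .b3 x) (oddFun k α b₁ b₃ c₁ c₃)
        {.b2}]
    · simp [evenFun, oddFun]
    · intro x
      cases x <;> simp [Gamma, GammaEdge]
    · simp [GammaVertex.IsOdd]
  | c1 =>
    rw [sum_subtype_ite_mul_eq (fun x => (Gamma k).Adj .c1 x) (oddFun k α b₁ b₃ c₁ c₃)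
        {.a ⟨4 * k + 3, by omega⟩, .c2}]
    · simp [evenFun, oddFun]
    · intro x
      cases x <;> simp [Gamma, GammaEdge, Fin.ext_iff]
    · simp [GammaVertex.IsOdd, parity_simps]
  | c2 => exact (hv trivial).elim
  | c3 =>
    rw [sum_subtype_ite_mul_eq (fun x => (Gamma k).Adj .c3 x) (oddFun k α b₁ b₃ c₁ c₃)
        {.c2}]
    · simp [evenFun, oddFun]
    · intro x
      cases x <;> simp [Gamma, GammaEdge]
    · simp [GammaVertex.IsOdd]

theorem evenVec_congr {α α' : ℕ → ℝ} {b₁ b₃ c₁ c₃ b₁' b₃' c₁' c₃' : ℝ}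
    (h : ∀ i ≤ 2 * k + 1, α i = α' i) (h1 : b₁ = b₁') (h2 : b₃ = b₃') (h3 : c₁ = c₁')
    (h4 : c₃ = c₃') : evenVec k α b₁ b₃ c₁ c₃ = evenVec k α' b₁' b₃' c₁' c₃' := by
  subst h1 h2 h3 h4
  ext ⟨v, hv⟩
  cases v with
  | a j => exact h _ (by have := j.2; omega)
  | _ => rfl

theorem evenVec_add (α α' : ℕ → ℝ) (b₁ b₃ c₁ c₃ b₁' b₃' c₁' c₃' : ℝ) :
    evenVec k α b₁ b₃ c₁ c₃ + evenVec k α' b₁' b₃' c₁' c₃' =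
      evenVec k (fun i => α i + α' i) (b₁ + b₁') (b₃ + b₃') (c₁ + c₁') (c₃ + c₃') := by
  ext ⟨v, hv⟩
  cases v <;> simp [evenVec, evenFun]

theorem smul_evenVec (r : ℝ) (α : ℕ → ℝ) (b₁ b₃ c₁ c₃ : ℝ) :
    r • evenVec k α b₁ b₃ c₁ c₃ =
      evenVec k (fun i => r * α i) (r * b₁) (r * b₃) (r * c₁) (r * c₃) := by
  ext ⟨v, hv⟩
  cases v <;> simp [evenVec, evenFun]

theorem inner_evenVec (α α' : ℕ → ℝ) (b₁ b₃ c₁ c₃ b₁' b₃' c₁' c₃' : ℝ) (i : ℕ)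
    (hi : i ≤ 2 * k + 1) (hα : ∀ j ≠ i, α j = 0) :
    inner ℝ (evenVec k α b₁ b₃ c₁ c₃) (evenVec k α' b₁' b₃' c₁' c₃') =
      α i * α' i + (b₁ * b₁' + (b₃ * b₃' + (c₁ * c₁' + c₃ * c₃'))) := by
  classical
  simp only [PiLp.inner_apply, RCLike.inner_apply, conj_trivial, evenVec]
  have : ∑ x : {v : GammaVertex k // ¬ v.IsOdd},
      evenFun k α' b₁' b₃' c₁' c₃' x.1 * evenFun k α b₁ b₃ c₁ c₃ x.1 =
      ∑ x ∈ {.a ⟨2 * i, by omega⟩, .b1, .b3, .c1, .c3},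
        evenFun k α' b₁' b₃' c₁' c₃' x * evenFun k α b₁ b₃ c₁ c₃ x := by
    rw [← sum_subtype_ite_mul_eq
      (fun x => x ∈ ({.a ⟨2 * i, by omega⟩, .b1, .b3, .c1, .c3} : Finset (GammaVertex k)))
      (fun x => evenFun k α' b₁' b₃' c₁' c₃' x * evenFun k α b₁ b₃ c₁ c₃ x) _
      (p := fun v => ¬ v.IsOdd) (fun x => Iff.rfl) (by simp [GammaVertex.IsOdd])]
    refine Finset.sum_congr rfl fun x _ => ?_
    obtain ⟨x, hx⟩ := x
    cases x with
    | a j =>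
      by_cases hj : j.val = 2 * i
      · simp [Fin.ext_iff, hj]
      · have : ¬ Odd j.val := hx
        rw [Nat.not_odd_iff_even] at this
        obtain ⟨r, hr⟩ := this
        simp [Fin.ext_iff, hj]
        right
        exact hα _ (by omega)
    | _ => simp [evenFun]
  rw [this]
  simp [evenFun]
  ring

/-- The vector `T_j(𝔻) a₀`. -/
noncomputable def pathVec (k j : ℕ) : EuclideanSpace ℝ {v : GammaVertex k // ¬ v.IsOdd} :=
  if j ≤ 2 * k + 1 then evenVec k (fun i => if i = j then 1 else 0) 0 0 0 0
  -- From here on the two legs are entered symmetrically, so `a₀` generates a space of dimension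
  -- only `2 * k + 4` among `2 * k + 6` even vertices.
  else if j = 2 * k + 2 then evenVec k (fun _ => 0) 1 0 1 0
  else evenVec k (fun i => if i = 2 * k + 1 then 1 else 0) 1 1 1 1

theorem pathVec_of_le {j : ℕ} (hj : j ≤ 2 * k + 1) :
    pathVec k j = evenVec k (fun i => if i = j then 1 else 0) 0 0 0 0 := by
  rw [pathVec, if_pos hj]

theorem pathVec_add_two : pathVec k (2 * k + 2) = evenVec k (fun _ => 0) 1 0 1 0 := by
  rw [pathVec, if_neg (by omega), if_pos rfl]

theorem pathVec_add_three : pathVec k (2 * k + 3) =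
    evenVec k (fun i => if i = 2 * k + 1 then 1 else 0) 1 1 1 1 := by
  rw [pathVec, if_neg (by omega), if_neg (by omega)]

theorem a0_eq (k : ℕ) : a0 k = pathVec k 0 := by
  rw [pathVec_of_le (by omega)]
  ext ⟨v, hv⟩
  cases v with
  | a j =>
    have : ¬ Odd j.val := hv
    rw [Nat.not_odd_iff_even] at this
    obtain ⟨r, hr⟩ := this
    have e : (j = 0) ↔ j.val / 2 = 0 := by
      rw [Fin.ext_iff, Fin.val_zero]
      omega
    simp [a0, evenVec, evenFun, e]
  | _ => simp [a0, evenVec, evenFun]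

theorem DD_pathVec_zero (k : ℕ) : DD k (pathVec k 0) = pathVec k 1 + pathVec k 0 := by
  rw [pathVec_of_le (by omega), pathVec_of_le (by omega), DD_evenVec, evenVec_add]
  apply evenVec_congr
  · intro i hi
    rcases i with _ | _ | i
    · simp
    · simp
    · simp
  all_goals simp

theorem DD_pathVec (k j : ℕ) (hj : j + 2 ≤ 2 * k + 3) : DD k (pathVec k (j + 1)) =
    pathVec k (j + 2) + ((2 : ℝ) • pathVec k (j + 1) + pathVec k j) := by
  obtain h | rfl | rfl : j + 2 ≤ 2 * k + 1 ∨ j = 2 * k ∨ j = 2 * k + 1 := by omega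
  · rw [pathVec_of_le (j := j + 1) (by omega), pathVec_of_le (j := j + 2) (by omega),
      pathVec_of_le (j := j) (by omega), DD_evenVec, smul_evenVec, evenVec_add, evenVec_add]
    have hne : 2 * k + 1 ≠ j + 1 := by omega
    have hk : 2 * k ≠ j := by omega
    have hk' : j ≠ 2 * k := by omega
    apply evenVec_congr
    · intro i hi
      obtain rfl | rfl | rfl | ⟨h1, h2, h3⟩ :
          i = j ∨ i = j + 1 ∨ i = j + 2 ∨ (i ≠ j ∧ i ≠ j + 1 ∧ i ≠ j + 2) := by omega
      · have : i - 1 ≠ i + 1 := by omega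
        have : i ≠ 2 * k + 1 := by omega
        simp [*]
      · simp [hk']
        norm_num
      · simp [hk]
      · have : i - 1 = j + 1 ↔ i = j + 2 := by omega
        simp [*]
    all_goals simp [hk]
  · rw [pathVec_add_two, pathVec_of_le (j := 2 * k + 1) le_rfl,
      pathVec_of_le (j := 2 * k) (by omega), DD_evenVec, smul_evenVec, evenVec_add, evenVec_add]
    apply evenVec_congr
    · intro i hi
      obtain rfl | rfl | ⟨h1, h2⟩ :
          i = 2 * k ∨ i = 2 * k + 1 ∨ (i ≠ 2 * k ∧ i ≠ 2 * k + 1) := by omega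
      · have : 2 * k - 1 ≠ 2 * k + 1 := by omega
        simp [*]
      · simp
        norm_num
      · have : i - 1 ≠ 2 * k + 1 := by omega
        simp [*]
    all_goals simp
  · have e : 2 * k + 1 + 1 = 2 * k + 2 := rfl
    have e' : 2 * k + 1 + 2 = 2 * k + 3 := rfl
    rw [e, e', pathVec_add_two, pathVec_add_three, pathVec_of_le (j := 2 * k + 1) le_rfl,
      DD_evenVec, smul_evenVec, evenVec_add, evenVec_add]
    apply evenVec_congr
    · intro i hi
      by_cases h : i = 2 * k + 1 <;> simp [h]
    all_goals norm_num

/-- The next vector of the three-term recurrence is already a combination of earlier ones, which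
yields the annihilating polynomial of `a₀`. -/
theorem DD_pathVec_last (k : ℕ) : DD k (pathVec k (2 * k + 3)) =
    (pathVec k (2 * k) + ((2 : ℝ) • pathVec k (2 * k + 1) + (2 : ℝ) • pathVec k (2 * k + 2))) +
      ((2 : ℝ) • pathVec k (2 * k + 3) + pathVec k (2 * k + 2)) := by
  rw [pathVec_add_two, pathVec_add_three, pathVec_of_le (j := 2 * k + 1) le_rfl,
    pathVec_of_le (j := 2 * k) (by omega)]
  simp only [DD_evenVec, evenVec_add, smul_evenVec]
  apply evenVec_congr
  · intro i hi
    obtain rfl | rfl | ⟨h1, h2⟩ :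
        i = 2 * k ∨ i = 2 * k + 1 ∨ (i ≠ 2 * k ∧ i ≠ 2 * k + 1) := by omega
    · have : 2 * k - 1 ≠ 2 * k + 1 := by omega
      simp [*]
    · simp
      norm_num
    · have : i - 1 ≠ 2 * k + 1 := by omega
      simp [*]
  all_goals norm_num

end Vectors

/-! ### The minimal polynomial of `a₀` and the roots of `q_k` -/

open Polynomial

theorem aeval_evenPoly_a0 (k : ℕ) (j : ℕ) (hj : j ≤ 2 * k + 3) :
    aeval (DD k) (evenPoly j) (a0 k) = pathVec k j := by
  have key : ∀ j : ℕ, j + 1 ≤ 2 * k + 3 → aeval (DD k) (evenPoly j) (a0 k) = pathVec k j ∧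
      aeval (DD k) (evenPoly (j + 1 : ℕ)) (a0 k) = pathVec k (j + 1) := by
    intro j
    induction j with
    | zero =>
      intro _
      norm_num [evenPoly_zero, evenPoly_one, a0_eq, DD_pathVec_zero]
    | succ j ih =>
      intro hj
      obtain ⟨h1, h2⟩ := ih (by omega)
      refine ⟨h2, ?_⟩
      have e := evenPoly_add_one (j + 1 : ℕ)
      push_cast at e h2 ⊢
      rw [add_sub_cancel_right] at e
      rw [e, map_sub, map_mul, LinearMap.sub_apply, Module.End.mul_apply, h1, h2, map_sub, aeval_X,
        map_ofNat, LinearMap.sub_apply, DD_pathVec k j (by omega), Module.End.ofNat_apply,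
        ← Nat.cast_smul_eq_nsmul ℝ]
      push_cast
      abel
  rcases Nat.eq_zero_or_pos j with rfl | hj0
  · exact (key 0 (by omega)).1
  · obtain ⟨i, rfl⟩ : ∃ i, j = i + 1 := ⟨j - 1, by omega⟩
    exact (key i hj).2

theorem aeval_charpoly_a0 (k : ℕ) : aeval (DD k) (X * (X - 2) * q k) (a0 k) = 0 := by
  have e := evenPoly_add_one (2 * k + 3)
  have h3 := aeval_evenPoly_a0 k (2 * k + 3) le_rfl
  have h2 := aeval_evenPoly_a0 k (2 * k + 2) (by omega)
  have h1 := aeval_evenPoly_a0 k (2 * k + 1) (by omega)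
  have h0 := aeval_evenPoly_a0 k (2 * k) (by omega)
  rw [add_assoc, add_sub_assoc] at e
  norm_num at e
  push_cast at h0 h1 h2 h3
  have ofNat (v) : (2 : Module.End ℝ (EuclideanSpace ℝ {v : GammaVertex k // ¬ v.IsOdd})) v =
      (2 : ℝ) • v := by
    rw [Module.End.ofNat_apply, ← Nat.cast_smul_eq_nsmul ℝ]
    rfl
  rw [X_mul_X_sub_two_mul_q, e]
  simp only [map_sub, map_mul, aeval_X, map_ofNat, LinearMap.sub_apply, Module.End.mul_apply, h0,
      h1,
    h2, h3, ofNat, DD_pathVec_last]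
  abel

/-- The even vertices at the ends of the vectors `pathVec`. -/
def tipVertex (k j : ℕ) : {v : GammaVertex k // ¬ v.IsOdd} :=
  if h : j ≤ 2 * k + 1 then ⟨.a ⟨2 * j, by omega⟩, by simp [GammaVertex.IsOdd]⟩
  else if j = 2 * k + 2 then ⟨.b1, by simp [GammaVertex.IsOdd]⟩
  else ⟨.b3, by simp [GammaVertex.IsOdd]⟩

/-- Evaluated at the tip vertices the vectors `pathVec k j` form a unitriangular matrix, so they are
linearly independent. -/
theorem pathVec_tipVertex_self (k j : ℕ) (hj : j ≤ 2 * k + 3) :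
    pathVec k j (tipVertex k j) = 1 := by
  obtain h | rfl | rfl : j ≤ 2 * k + 1 ∨ j = 2 * k + 2 ∨ j = 2 * k + 3 := by omega
  · simp [pathVec, tipVertex, h, evenVec, evenFun]
  · simp [pathVec, tipVertex, evenVec, evenFun]
  · simp [pathVec, tipVertex, evenVec, evenFun]

theorem pathVec_tipVertex_of_lt (k : ℕ) {i j : ℕ} (hj : j ≤ 2 * k + 3) (hi : i < j) :
    pathVec k i (tipVertex k j) = 0 := by
  obtain h | rfl | rfl : j ≤ 2 * k + 1 ∨ j = 2 * k + 2 ∨ j = 2 * k + 3 := by omega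
  · have : i ≤ 2 * k + 1 := by omega
    simp [pathVec, tipVertex, h, this, evenVec, evenFun]
    omega
  · have : i ≤ 2 * k + 1 := by omega
    simp [pathVec, tipVertex, this, evenVec, evenFun]
  · obtain h | rfl : i ≤ 2 * k + 1 ∨ i = 2 * k + 2 := by omega
    · simp [pathVec, tipVertex, h, evenVec, evenFun]
    · simp [pathVec, tipVertex, evenVec, evenFun]

theorem eq_zero_of_aeval_a0_eq_zero (k : ℕ) (p : ℝ[X]) (hp : p.degree < (2 * k + 4 : ℕ))
    (h0 : aeval (DD k) p (a0 k) = 0) : p = 0 := by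
  -- The vanishing at later tips is carried along so that the value at tip `d` isolates the
  -- coefficient of degree `d`.
  have key : ∀ d ≤ 2 * k + 4, ∀ p : ℝ[X], p.degree < d → (aeval (DD k) p (a0 k) = 0 → p = 0) ∧
      ∀ j, d ≤ j → j ≤ 2 * k + 3 → (aeval (DD k) p (a0 k)) (tipVertex k j) = 0 := by
    intro d
    induction d with
    | zero =>
      intro _ p hp
      have : p = 0 := by
        rw [← degree_eq_bot]
        by_contra h
        have := zero_le_degree_iff.2 (degree_eq_bot.not.1 h)
        exact absurd hp (not_lt.2 (by exact_mod_cast this))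
      simp [this]
    | succ d ih =>
      intro hd p hp
      have ih := ih (by omega)
      obtain ⟨hm, hn⟩ := evenPoly_monic d
      have hlt : (p - C (p.coeff d) * evenPoly d).degree < d := by
        rw [degree_lt_iff_coeff_zero]
        intro i hi
        rw [coeff_sub, coeff_C_mul]
        rcases hi.eq_or_lt with rfl | hi
        · have : (evenPoly d).coeff d = 1 := by
            have := hm.coeff_natDegree
            rwa [hn] at this
          rw [this]
          ring
        · rw [coeff_eq_zero_of_degree_lt (hp.trans_le (by exact_mod_cast hi)),
            coeff_eq_zero_of_natDegree_lt (p := evenPoly d) (by omega)]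
          ring
      obtain ⟨hz, ht⟩ := ih _ hlt
      have e : aeval (DD k) p (a0 k) =
          aeval (DD k) (p - C (p.coeff d) * evenPoly d) (a0 k) + p.coeff d • pathVec k d := by
        rw [map_sub, LinearMap.sub_apply, map_mul, Module.End.mul_apply,
          aeval_evenPoly_a0 k d (by omega), aeval_C, Module.algebraMap_end_apply, sub_add_cancel]
      refine ⟨fun h => ?_, fun j hj hj' => ?_⟩
      · have hc : p.coeff d = 0 := by
          have := congrArg (fun v => v (tipVertex k d)) e
          rw [h, PiLp.add_apply, PiLp.smul_apply, ht d le_rfl (by omega),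
            pathVec_tipVertex_self k d (by omega)] at this
          simpa using this.symm
        rw [hc] at e hz
        simp only [map_zero, zero_mul, sub_zero] at hz
        exact hz h
      · rw [e, PiLp.add_apply, PiLp.smul_apply, ht j (by omega) hj',
          pathVec_tipVertex_of_lt k hj' (by omega)]
        simp
  exact (key _ le_rfl p hp).1 h0

theorem DD_isSymmetric (k : ℕ) : (DD k).IsSymmetric := by
  rw [DD, Matrix.isSymmetric_toEuclideanLin_iff]
  exact Matrix.isHermitian_mul_conjTranspose_self (G k)

theorem nonneg_of_hasEigenvalue_DD {k : ℕ} {a : ℝ} (ha : Module.End.HasEigenvalue (DD k) a) :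
    0 ≤ a := by
  have hpos : (DD k).IsPositive := by
    rw [DD]
    exact (Matrix.isPositive_toEuclideanLin_iff).2 (Matrix.posSemidef_self_mul_conjTranspose (G k))
  obtain ⟨v, hv, hv0⟩ := ha.exists_hasEigenvector
  rw [Module.End.mem_eigenspace_iff] at hv
  have h := hpos.re_inner_nonneg_left v
  rw [hv, inner_smul_left, real_inner_self_eq_norm_sq] at h
  simp only [conj_trivial, RCLike.re_to_real] at h
  exact nonneg_of_mul_nonneg_left h (by positivity)

/-! The roots of `q k`, and the spectral measure of `a0`. -/

theorem charpoly_monic (k : ℕ) : (X * (X - 2) * q k).Monic ∧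
    (X * (X - 2) * q k).degree = ((2 * k + 4 : ℕ) : WithBot ℕ) := by
  have h2 : (X - 2 : ℝ[X]).Monic := monic_X_sub_C 2
  have hd : (X - 2 : ℝ[X]).natDegree = 1 := natDegree_X_sub_C 2
  have hm := (monic_X.mul h2).mul (q_monic k).1
  refine ⟨hm, ?_⟩
  rw [degree_eq_natDegree hm.ne_zero, (monic_X.mul h2).natDegree_mul (q_monic k).1,
    monic_X.natDegree_mul h2, hd, natDegree_X, (q_monic k).2]
  congr 1
  omega

/-- `X * (X - 2) * q k` is the minimal polynomial of `a₀` under a symmetric operator, hence it and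
its factor `q k` split with simple real roots. -/
theorem exists_isRootList (k : ℕ) : ∃ t : Fin (2 * k + 2) → ℝ, IsRootList k t := by
  obtain ⟨hm, hd⟩ := charpoly_monic k
  obtain ⟨hs, hr⟩ := splits_of_minimal (DD_isSymmetric k) hm (aeval_charpoly_a0 k)
    (by rw [hd]; exact eq_zero_of_aeval_a0_eq_zero k)
  have hdvd : q k ∣ X * (X - 2) * q k := Dvd.intro_left _ rfl
  have hsq := Splits.of_dvd hs hm.ne_zero hdvd
  have hnd := Multiset.nodup_of_le (roots.le_of_dvd hm.ne_zero hdvd) hr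
  have hcard : (q k).roots.toFinset.card = 2 * k + 2 := by
    rw [Multiset.toFinset_card_of_nodup hnd, ← (q_monic k).2]
    exact (splits_iff_card_roots.1 hsq)
  refine ⟨fun j => (Finset.equivFinOfCardEq hcard).symm j, fun i j hij => ?_, fun j => ?_⟩
  · simpa [Subtype.ext_iff] using hij
  · have := ((Finset.equivFinOfCardEq hcard).symm j).2
    rw [Multiset.mem_toFinset] at this
    exact isRoot_of_mem_roots this

section Roots

variable {k : ℕ} {t : Fin (2 * k + 2) → ℝ} (ht : IsRootList k t)
include ht

theorem IsRootList.ne_zero (j) : t j ≠ 0 := by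
  intro h
  have := ht.2 j
  rw [h, q_eval_zero] at this
  norm_cast at this

theorem IsRootList.ne_two (j) : t j ≠ 2 := by
  intro h
  have := ht.2 j
  rw [h, q_eval_two] at this
  have h3 : (2 * k + 3 : ℝ) ≠ 0 := by positivity
  simp [h3] at this

theorem IsRootList.q_eq : q k = ∏ j, (X - C (t j)) := by
  have hmon : (∏ j, (X - C (t j))).Monic := monic_prod_of_monic _ _ fun j _ => monic_X_sub_C _
  have hdvd : ∏ j, (X - C (t j)) ∣ q k :=
    Finset.prod_dvd_of_coprime (fun i _ j _ hij => pairwise_coprime_X_sub_C ht.1 hij)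
      fun j _ => dvd_iff_isRoot.2 (ht.2 j)
  refine eq_of_monic_of_dvd_of_natDegree_le hmon (q_monic k).1 hdvd ?_
  rw [(q_monic k).2, natDegree_prod_of_monic _ _ fun j _ => monic_X_sub_C _]
  simp

/-- The points of the spectral measure. -/
noncomputable def spectrumSet {k : ℕ} (t : Fin (2 * k + 2) → ℝ) : Finset ℝ :=
  insert 0 (insert 2 (Finset.univ.image t))

theorem IsRootList.sum_spectrumSet {M : Type*} [AddCommMonoid M] (F : ℝ → M) :
    ∑ a ∈ spectrumSet t, F a = F 0 + (F 2 + ∑ j, F (t j)) := by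
  rw [spectrumSet, Finset.sum_insert, Finset.sum_insert, Finset.sum_image]
  · exact fun i _ j _ h => ht.1 h
  · simpa using ht.ne_two
  · simpa using ht.ne_zero

theorem IsRootList.prod_spectrumSet :
    ∏ a ∈ spectrumSet t, (X - C a) = X * (X - 2) * q k := by
  rw [spectrumSet, Finset.prod_insert, Finset.prod_insert, Finset.prod_image, ht.q_eq]
  · simp only [C_0, sub_zero, mul_assoc]
    rfl
  · exact fun i _ j _ h => ht.1 h
  · simpa using ht.ne_two
  · simpa using ht.ne_zero

theorem IsRootList.card_spectrumSet : (spectrumSet t).card = 2 * k + 4 := by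
  rw [Finset.card_eq_sum_ones, ht.sum_spectrumSet]
  simp
  omega

theorem IsRootList.weight_pos {a : ℝ} (ha : a ∈ spectrumSet t) : 0 < weight k a ∧ 0 ≤ a := by
  have h := inner_starProjection_pos (DD_isSymmetric k) (v := a0 k) (s := spectrumSet t)
    (by rw [ht.prod_spectrumSet, aeval_charpoly_a0])
    (by rw [ht.card_spectrumSet]; exact eq_zero_of_aeval_a0_eq_zero k) ha
  exact ⟨h.1, nonneg_of_hasEigenvalue_DD h.2⟩

theorem IsRootList.pos (j) : 0 < t j :=
  lt_of_le_of_ne (ht.weight_pos (by simp [spectrumSet])).2 (ht.ne_zero j).symm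

theorem IsRootList.inner_aeval (p : ℝ[X]) : inner ℝ (aeval (DD k) p (a0 k)) (a0 k) =
    weight k 0 * p.eval 0 + (weight k 2 * p.eval 2 + ∑ j, weight k (t j) * p.eval (t j)) := by
  rw [inner_aeval_eq_sum (DD_isSymmetric k) (s := spectrumSet t)
    (by rw [ht.prod_spectrumSet, aeval_charpoly_a0]), ht.sum_spectrumSet]
  rfl

/-- The isometry from functions on the spectrum to the cyclic space of `a₀`: orthogonality for `μ`
can be checked on explicit vectors. -/
theorem IsRootList.inner_aeval_mul (p r : ℝ[X]) :
    inner ℝ (aeval (DD k) p (a0 k)) (aeval (DD k) r (a0 k)) =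
    weight k 0 * (p * r).eval 0 +
      (weight k 2 * (p * r).eval 2 + ∑ j, weight k (t j) * (p * r).eval (t j)) := by
  rw [← ht.inner_aeval, mul_comm p, map_mul, Module.End.mul_apply]
  have : ∀ v w, inner ℝ (aeval (DD k) r v) w = inner ℝ v (aeval (DD k) r w) := by
    intro v w
    induction r using Polynomial.induction_on' generalizing v w with
    | add p q hp hq => simp [hp, hq, inner_add_left, inner_add_right]
    | monomial n c =>
      have := (DD_isSymmetric k).pow n v w
      simp [aeval_monomial, inner_smul_left, inner_smul_right, this]
  rw [this]

end Roots

/-! ### The diagonal subalgebra of `𝓑` as a forked graph with trace -/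

open Polynomial

/-- The diagonal part of `B k`: functions on the spectrum of `A`. -/
abbrev D (k : ℕ) : Type := (Fin 2 → ℝ) × (Fin (2 * k + 2) → ℝ)

/-- The diagonal embedding. -/
def diagHom (k : ℕ) : D k →ₐ[ℝ] B k :=
  AlgHom.prodMap (Matrix.diagonalAlgHom ℝ) (AlgHom.id ℝ _)

section Spectrum

variable {k : ℕ} (t : Fin (2 * k + 2) → ℝ)

/-- The trace on the diagonal part. -/
noncomputable def trD : D k →ₗ[ℝ] ℝ :=
  IsLinearMap.mk' (fun d => weight k 0 * d.1 0 + weight k 2 * d.1 1 + ∑ j, weight k (t j) * d.2 j)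
    ⟨fun x y => by
      simp only [Prod.fst_add, Prod.snd_add, Pi.add_apply, mul_add, Finset.sum_add_distrib]
      ring, fun c x => by
      simp only [Prod.smul_fst, Prod.smul_snd, Pi.smul_apply, smul_eq_mul, mul_add,
        Finset.mul_sum]
      congr 1
      · ring
      · exact Finset.sum_congr rfl fun j _ => by ring⟩

theorem trD_apply (d : D k) : trD t d =
    weight k 0 * d.1 0 + weight k 2 * d.1 1 + ∑ j, weight k (t j) * d.2 j := rfl

/-- The rescaled Chebyshev polynomials at the matrix `A`. -/
noncomputable def chebD (j : ℤ) : D k :=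
  (![(Chebyshev.S ℝ j).eval 0, (Chebyshev.S ℝ j).eval √2],
    fun i => (Chebyshev.S ℝ j).eval √(t i))

theorem diagHom_chebD (j : ℕ) : diagHom k (chebD t j) = RA k t j := by
  have e : A k t = diagHom k ((![0, √2], fun i => √(t i)) : D k) := rfl
  rw [RA, e, aeval_algHom_apply]
  congr 1
  have h1 : ∀ (p : ℝ[X]) (d : D k), aeval d p = (fun i => p.eval (d.1 i),
      fun i => p.eval (d.2 i)) := by
    intro p d
    have hpi {ι : Type} (v : ι → ℝ) : aeval v p = fun i => p.eval (v i) := by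
      ext i
      have := (aeval_algHom_apply (Pi.evalAlgHom ℝ (fun _ : ι => ℝ) i) v p).symm
      rwa [Pi.evalAlgHom_apply, Pi.evalAlgHom_apply, coe_aeval_eq_eval] at this
    rw [aeval_prod_apply, hpi, hpi]
  rw [h1, chebD]
  refine Prod.ext ?_ rfl
  ext i
  fin_cases i <;> rfl

theorem isChebyshev_chebD : IsChebyshev (chebD t) where
  zero := by
    refine Prod.ext ?_ ?_
    · ext i
      fin_cases i <;> simp [chebD]
    · ext i
      simp [chebD]
  neg_one := by
    refine Prod.ext ?_ ?_
    · ext i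
      fin_cases i <;> simp [chebD]
    · ext i
      simp [chebD]
  step j := by
    have e : Chebyshev.S ℝ (j + 1) = X * Chebyshev.S ℝ j - Chebyshev.S ℝ (j - 1) := by
      have := Chebyshev.S_add_two ℝ (j - 1)
      rwa [show j - 1 + 2 = j + 1 by ring, sub_add_cancel] at this
    refine Prod.ext ?_ ?_
    · ext i
      fin_cases i
      · change eval 0 (Chebyshev.S ℝ (j + 1)) = eval 0 (Chebyshev.S ℝ 1) * _ - eval 0 _
        simp [e]
      · change eval √2 (Chebyshev.S ℝ (j + 1)) = eval √2 (Chebyshev.S ℝ 1) * eval √2 _ - eval √2 _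
        simp [e]
    · ext i
      simp [chebD, e]

/-- Evaluation of a polynomial at the spectrum of `A ^ 2`. -/
noncomputable def evD (p : ℝ[X]) : D k := (![p.eval 0, p.eval 2], fun i => p.eval (t i))

variable {t} (ht : IsRootList k t)
include ht

theorem IsRootList.chebD_even (j : ℤ) : chebD t (2 * j) = evD t (evenPoly j) := by
  refine Prod.ext ?_ ?_
  · ext i
    fin_cases i
    · simp [chebD, evD, (eval_S_two_mul j _).1]
    · simp [chebD, evD, (eval_S_two_mul j _).1]
  · ext i
    simp [chebD, evD, (eval_S_two_mul j _).1, (ht.pos i).le]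

theorem IsRootList.trD_evD_mul (p r : ℝ[X]) : trD t (evD t p * evD t r) =
    inner ℝ (aeval (DD k) p (a0 k)) (aeval (DD k) r (a0 k)) := by
  rw [ht.inner_aeval_mul, trD_apply]
  simp [evD, add_assoc]

/-- The relation is `x` times the value of `(X - 2) * q k` at `x²`, which vanishes at `0`, `√2` and
the square roots of the roots of `q k`. -/
theorem IsRootList.chebD_rel : chebD t (2 * (2 * k + 1 : ℕ) + 5) =
    chebD t (2 * (2 * k + 1 : ℕ) + 3) + chebD t (2 * (2 * k + 1 : ℕ) + 1) +
      chebD t (2 * (2 * k + 1 : ℕ) - 1) := by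
  have key (x : ℝ) (hx : x = 0 ∨ ((X - 2) * q k).eval (x ^ 2) = 0) :
      (Chebyshev.S ℝ (2 * (2 * k + 1 : ℕ) + 5)).eval x =
        (Chebyshev.S ℝ (2 * (2 * k + 1 : ℕ) + 3)).eval x +
        (Chebyshev.S ℝ (2 * (2 * k + 1 : ℕ) + 1)).eval x +
        (Chebyshev.S ℝ (2 * (2 * k + 1 : ℕ) - 1)).eval x := by
    have e3 := (eval_S_two_mul (2 * k + 3) x).2
    have e2 := (eval_S_two_mul (2 * k + 2) x).2
    have e1 := (eval_S_two_mul (2 * k + 1) x).2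
    have e0 := (eval_S_two_mul (2 * k) x).2
    push_cast
    ring_nf at e0 e1 e2 e3 ⊢
    rw [e0, e1, e2, e3]
    rcases hx with rfl | hx
    · simp
    · rw [X_sub_two_mul_q] at hx
      simp only [eval_sub] at hx
      ring_nf at hx
      linear_combination x * hx
  have k0 := key 0 (Or.inl rfl)
  have k2 := key √2 (Or.inr (by simp))
  have kt (i) := key √(t i) (Or.inr (by simp [(ht.pos i).le, ht.2]))
  refine Prod.ext ?_ ?_
  · ext i
    fin_cases i
    · exact k0
    · exact k2
  · ext i
    exact kt i

omit ht in
theorem evD_add (p r : ℝ[X]) : evD t (p + r) = evD t p + evD t r := by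
  refine Prod.ext ?_ ?_
  · ext i
    fin_cases i <;> simp [evD]
  · ext i
    simp [evD]

omit ht in
theorem evD_sub (p r : ℝ[X]) : evD t (p - r) = evD t p - evD t r := by
  refine Prod.ext ?_ ?_
  · ext i
    fin_cases i <;> simp [evD]
  · ext i
    simp [evD]

omit ht in
theorem evD_smul (c : ℝ) (p : ℝ[X]) : evD t (c • p) = c • evD t p := by
  refine Prod.ext ?_ ?_
  · ext i
    fin_cases i <;> simp [evD]
  · ext i
    simp [evD]

theorem IsRootList.forkF_eq : forkF (chebD t) (2 * k + 1) =
    evD t ((1 / 2 : ℝ) • (evenPoly (2 * k + 1 : ℕ) + (2 : ℝ) • evenPoly (2 * k + 2 : ℕ)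
      - evenPoly (2 * k + 3 : ℕ))) := by
  simp only [forkF, evD_add, evD_sub, evD_smul, ← ht.chebD_even]
  push_cast
  ring_nf

theorem IsRootList.forkG_eq : forkG (chebD t) (2 * k + 1) =
    evD t ((1 / 2 : ℝ) • (evenPoly (2 * k + 3 : ℕ) - evenPoly (2 * k + 1 : ℕ))) := by
  simp only [forkG, evD_sub, evD_smul, ← ht.chebD_even]
  push_cast
  ring_nf

omit ht in
theorem aeval_forkF_a0 (k : ℕ) : aeval (DD k) ((1 / 2 : ℝ) • (evenPoly (2 * k + 1 : ℕ) +
    (2 : ℝ) • evenPoly (2 * k + 2 : ℕ) - evenPoly (2 * k + 3 : ℕ))) (a0 k) =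
    evenVec k (fun _ => 0) (1 / 2) (-1 / 2) (1 / 2) (-1 / 2) := by
  simp only [map_smul, map_sub, map_add, LinearMap.smul_apply, LinearMap.sub_apply,
    LinearMap.add_apply]
  rw [aeval_evenPoly_a0 _ _ le_rfl, aeval_evenPoly_a0 _ _ (by omega),
    aeval_evenPoly_a0 _ _ (by omega), pathVec_add_two, pathVec_add_three, pathVec_of_le le_rfl,
    sub_eq_add_neg, ← neg_one_smul ℝ]
  simp only [smul_evenVec, evenVec_add]
  apply evenVec_congr
  · intro i _
    ring
  all_goals norm_num

omit ht in
theorem aeval_forkG_a0 (k : ℕ) : aeval (DD k) ((1 / 2 : ℝ) • (evenPoly (2 * k + 3 : ℕ) -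
    evenPoly (2 * k + 1 : ℕ))) (a0 k) = evenVec k (fun _ => 0) (1 / 2) (1 / 2) (1 / 2) (1 / 2) := by
  simp only [map_smul, map_sub, LinearMap.smul_apply, LinearMap.sub_apply]
  rw [aeval_evenPoly_a0 _ _ le_rfl, aeval_evenPoly_a0 _ _ (by omega), pathVec_add_three,
    pathVec_of_le le_rfl, sub_eq_add_neg, ← neg_one_smul ℝ]
  simp only [smul_evenVec, evenVec_add]
  apply evenVec_congr
  · intro i _
    ring
  all_goals norm_num

/-- Applied to `a₀`, even path vertices become unit vectors, while `f` and `g` become `(b₁ + c₁ - b₃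
- c₃) / 2` and `(b₁ + c₁ + b₃ + c₃) / 2`. -/
theorem IsRootList.isForkTrace : IsForkTrace (chebD t) (2 * k + 1) (trD t) where
  toIsChebyshev := isChebyshev_chebD t
  rel := ht.chebD_rel
  orth i j hi hj := by
    rw [ht.chebD_even, ht.chebD_even, ht.trD_evD_mul, aeval_evenPoly_a0 _ _ (by omega),
      aeval_evenPoly_a0 _ _ (by omega), pathVec_of_le hi, pathVec_of_le hj,
      inner_evenVec _ _ _ _ _ _ _ _ _ _ i hi (by simp +contextual)]
    simp
  orth_f i hi := by
    rw [ht.chebD_even, ht.forkF_eq, ht.trD_evD_mul, aeval_evenPoly_a0 _ _ (by omega),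
      aeval_forkF_a0, pathVec_of_le hi,
      inner_evenVec _ _ _ _ _ _ _ _ _ _ i hi (by simp +contextual)]
    simp
  orth_g i hi := by
    rw [ht.chebD_even, ht.forkG_eq, ht.trD_evD_mul, aeval_evenPoly_a0 _ _ (by omega),
      aeval_forkG_a0, pathVec_of_le hi,
      inner_evenVec _ _ _ _ _ _ _ _ _ _ i hi (by simp +contextual)]
    simp
  ff := by
    rw [ht.forkF_eq, ht.trD_evD_mul, aeval_forkF_a0,
      inner_evenVec _ _ _ _ _ _ _ _ _ _ 0 (by omega) (by simp)]
    norm_num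
  fg := by
    rw [ht.forkF_eq, ht.forkG_eq, ht.trD_evD_mul, aeval_forkF_a0, aeval_forkG_a0,
      inner_evenVec _ _ _ _ _ _ _ _ _ _ 0 (by omega) (by simp)]
    norm_num
  gg := by
    rw [ht.forkG_eq, ht.trD_evD_mul, aeval_forkG_a0,
      inner_evenVec _ _ _ _ _ _ _ _ _ _ 0 (by omega) (by simp)]
    norm_num

end Spectrum

/-! ### Values at the points `0` and `√2`, and the weights of the two points of the block `M₂` -/

open Polynomial

theorem evenPoly_eval_zero (i : ℕ) : (evenPoly i).eval 0 = valZero i := by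
  induction i using Nat.twoStepInduction with
  | zero => simp [evenPoly_zero, valZero]
  | one => simp [evenPoly_one, valZero]
  | more i h1 h2 =>
    have e := evenPoly_add_one (i + 1 : ℕ)
    push_cast at e h2 ⊢
    rw [add_sub_cancel_right, add_assoc] at e
    norm_num at e
    rw [e, eval_sub, eval_mul, h1, h2]
    have : ((valZero (i + 2) : ℤ) : ℝ) = ((-2 * valZero (i + 1) - valZero i : ℤ) : ℝ) := by
      congr 1
      unfold valZero
      split_ifs <;> omega
    rw [this]
    push_cast
    simp

theorem evenPoly_eval_two (i : ℕ) : (evenPoly i).eval 2 = valTwo i := by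
  induction i using Nat.twoStepInduction with
  | zero => simp [evenPoly_zero, valTwo]
  | one => norm_num [evenPoly_one, valTwo]
  | more i h1 h2 =>
    have e := evenPoly_add_one (i + 1 : ℕ)
    push_cast at e h2 ⊢
    rw [add_sub_cancel_right, add_assoc] at e
    norm_num at e
    rw [e, eval_sub, eval_mul, h1, h2]
    have : ((valTwo (i + 2) : ℤ) : ℝ) = ((- valTwo i : ℤ) : ℝ) := by
      congr 1
      unfold valTwo
      split_ifs <;> omega
    rw [this]
    push_cast
    simp

theorem valZero_mul_self (i : ℕ) : (valZero i : ℝ) * valZero i = 1 := by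
  unfold valZero
  split_ifs <;> simp

theorem valTwo_mul_self (i : ℕ) : (valTwo i : ℝ) * valTwo i = 1 := by
  unfold valTwo
  split_ifs <;> simp

section Spectrum

variable {k : ℕ} (t : Fin (2 * k + 2) → ℝ)

theorem chebD_even_zero (i : ℕ) : (chebD t (2 * i)).1 0 = valZero i := by
  simp [chebD, (eval_S_two_mul i _).1, evenPoly_eval_zero]

theorem chebD_even_two (i : ℕ) : (chebD t (2 * i)).1 1 = valTwo i := by
  simp [chebD, (eval_S_two_mul i _).1, evenPoly_eval_two]

theorem chebD_odd_zero (i : ℕ) : (chebD t (2 * i + 1)).1 0 = 0 := by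
  simp [chebD, (eval_S_two_mul i _).2]

theorem chebD_odd_two (i : ℕ) : √2 * (chebD t (2 * i + 1)).1 1 = valTwo i + valTwo (i + 1) := by
  have h := X_mul_oddPoly i
  apply_fun eval 2 at h
  have h' := evenPoly_eval_two (i + 1)
  push_cast at h'
  rw [eval_mul, eval_X, eval_add, evenPoly_eval_two, h'] at h
  simp only [chebD, Matrix.cons_val_one, Matrix.cons_val_fin_one, (eval_S_two_mul i _).2]
  rw [← mul_assoc, Real.mul_self_sqrt (by norm_num), Real.sq_sqrt (by norm_num), h, add_comm]

theorem chebD_one_zero : (chebD t 1).1 0 = 0 := by simp [chebD]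

theorem chebD_one_two : (chebD t 1).1 1 = √2 := by simp [chebD]

theorem forkF_zero : (forkF (chebD t) (2 * k + 1)).1 0 = 1 := by
  have e1 := chebD_even_zero t (2 * k + 1)
  have e2 := chebD_even_zero t (2 * k + 2)
  have e3 := chebD_even_zero t (2 * k + 3)
  simp only [forkF, Prod.smul_fst, Prod.fst_add, Prod.fst_sub, Pi.smul_apply, Pi.add_apply,
    Pi.sub_apply, smul_eq_mul]
  push_cast at e1 e2 e3 ⊢
  ring_nf at e1 e2 e3 ⊢
  rw [e1, e2, e3]
  have h1 : (1 + k * 2) % 2 = 1 := by omega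
  have h2 : (2 + k * 2) % 2 = 0 := by omega
  have h3 : (3 + k * 2) % 2 = 1 := by omega
  norm_num [valZero, h1, h2, h3]

theorem forkG_zero : (forkG (chebD t) (2 * k + 1)).1 0 = 0 := by
  have e1 := chebD_even_zero t (2 * k + 1)
  have e3 := chebD_even_zero t (2 * k + 3)
  simp only [forkG, Prod.smul_fst, Prod.fst_sub, Pi.smul_apply, Pi.sub_apply, smul_eq_mul]
  push_cast at e1 e3 ⊢
  ring_nf at e1 e3 ⊢
  rw [e1, e3]
  have h1 : (1 + k * 2) % 2 = 1 := by omega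
  have h3 : (3 + k * 2) % 2 = 1 := by omega
  norm_num [valZero, h1, h3]

theorem forkF_two : (forkF (chebD t) (2 * k + 1)).1 1 = 0 := by
  have e1 := chebD_even_two t (2 * k + 1)
  have e2 := chebD_even_two t (2 * k + 2)
  have e3 := chebD_even_two t (2 * k + 3)
  simp only [forkF, Prod.smul_fst, Prod.fst_add, Prod.fst_sub, Pi.smul_apply, Pi.add_apply,
    Pi.sub_apply, smul_eq_mul]
  push_cast at e1 e2 e3 ⊢
  ring_nf at e1 e2 e3 ⊢
  rw [e1, e2, e3]
  rcases Nat.even_or_odd' k with ⟨r, rfl | rfl⟩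
  · have h1 : (1 + 2 * r * 2) % 4 = 1 := by omega
    have h2 : (2 + 2 * r * 2) % 4 = 2 := by omega
    have h3 : (3 + 2 * r * 2) % 4 = 3 := by omega
    norm_num [valTwo, h1, h2, h3]
  · have h1 : (1 + (2 * r + 1) * 2) % 4 = 3 := by omega
    have h2 : (2 + (2 * r + 1) * 2) % 4 = 0 := by omega
    have h3 : (3 + (2 * r + 1) * 2) % 4 = 1 := by omega
    norm_num [valTwo, h1, h2, h3]

theorem forkG_two : (forkG (chebD t) (2 * k + 1)).1 1 = valTwo (2 * k + 2) := by
  have e1 := chebD_even_two t (2 * k + 1)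
  have e3 := chebD_even_two t (2 * k + 3)
  simp only [forkG, Prod.smul_fst, Prod.fst_sub, Pi.smul_apply, Pi.sub_apply, smul_eq_mul]
  push_cast at e1 e3 ⊢
  ring_nf at e1 e3 ⊢
  rw [e1, e3]
  rcases Nat.even_or_odd' k with ⟨r, rfl | rfl⟩
  · have h1 : (1 + 2 * r * 2) % 4 = 1 := by omega
    have h2 : (2 + 2 * r * 2) % 4 = 2 := by omega
    have h3 : (3 + 2 * r * 2) % 4 = 3 := by omega
    norm_num [valTwo, h1, h2, h3]
  · have h1 : (1 + (2 * r + 1) * 2) % 4 = 3 := by omega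
    have h2 : (2 + (2 * r + 1) * 2) % 4 = 0 := by omega
    have h3 : (3 + (2 * r + 1) * 2) % 4 = 1 := by omega
    norm_num [valTwo, h1, h2, h3]

theorem legEven_zero (φ : ℤ) : (legEven (chebD t) (2 * k + 1) φ).1 0 = φ / 2 := by
  simp only [legEven, Prod.smul_fst, Prod.fst_add, Pi.smul_apply, Pi.add_apply, smul_eq_mul,
    forkF_zero, forkG_zero]
  ring

theorem legEven_two (φ : ℤ) :
    (legEven (chebD t) (2 * k + 1) φ).1 1 = valTwo (2 * k + 2) / 2 := by
  simp only [legEven, Prod.smul_fst, Prod.fst_add, Pi.smul_apply, Pi.add_apply, smul_eq_mul,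
    forkF_two, forkG_two]
  ring

variable {t} (ht : IsRootList k t)
include ht

theorem IsRootList.legOdd_zero : (legOdd (chebD t) (2 * k + 1)).1 0 = 0 := by
  rw [legOdd, ht.isForkTrace.forkH_eq]
  simp [chebD_one_zero]

theorem IsRootList.legOdd_two :
    √2 * (legOdd (chebD t) (2 * k + 1)).1 1 = valTwo (2 * k + 2) := by
  rw [legOdd, ht.isForkTrace.forkH_eq]
  have h2 : √2 * √2 = 2 := Real.mul_self_sqrt (by norm_num)
  simp only [Prod.smul_fst, Prod.fst_mul, Prod.fst_sub, Pi.smul_apply, Pi.mul_apply, Pi.sub_apply,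
    smul_eq_mul, chebD_one_two, forkF_two, forkG_two]
  linear_combination (1 / 2 : ℝ) * valTwo (2 * k + 2) * h2

omit ht in
theorem chebD_one_mul_sum (n : ℕ) :
    chebD t 1 * ∑ i ∈ Finset.range (n + 1), (valZero i : ℝ) • chebD t (2 * i) =
      (valZero n : ℝ) • chebD t (2 * n + 1) := by
  have hC := isChebyshev_chebD t
  induction n with
  | zero => simp [hC.zero]
  | succ n ih =>
    rw [Finset.sum_range_succ, mul_add, ih, mul_smul_comm, hC.one_mul_eq]
    have : valZero (n + 1) = -valZero n := by
      unfold valZero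
      split_ifs <;> omega
    rw [this, show 2 * ((n + 1 : ℕ) : ℤ) - 1 = 2 * n + 1 by push_cast; ring, smul_add]
    push_cast
    rw [neg_smul, neg_smul]
    abel

omit ht in
theorem chebD_two_mul_sum (n : ℕ) :
    (chebD t 2 - 1) * ∑ i ∈ Finset.range (n + 2), (valTwo i : ℝ) • chebD t (2 * i) =
      (valTwo (n + 1) : ℝ) • chebD t (2 * (n + 2 : ℕ)) + (valTwo n : ℝ) • chebD t (2 * (n +
          1 : ℕ)) := by
  have hC := isChebyshev_chebD t
  have h2 (j : ℤ) : (chebD t 2 - 1) * chebD t j = chebD t (j + 2) + chebD t (j - 2) := by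
    linear_combination hC.two_mul_eq j
  induction n with
  | zero =>
    rw [Finset.sum_range_succ, Finset.sum_range_one, mul_add, mul_smul_comm, mul_smul_comm, h2, h2]
    have := hC.neg 0
    norm_num [valTwo, hC.zero] at this ⊢
    rw [this]
    abel
  | succ n ih =>
    rw [Finset.sum_range_succ, mul_add, ih, mul_smul_comm, h2]
    have : valTwo (n + 2) = -valTwo n := by
      unfold valTwo
      split_ifs <;> omega
    rw [this, show 2 * ((n + 2 : ℕ) : ℤ) - 2 = 2 * (n + 1 : ℕ) by push_cast; ring,
      show 2 * ((n + 2 : ℕ) : ℤ) + 2 = 2 * (n + 1 + 2 : ℕ) by push_cast; ring, smul_add]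
    simp only [Int.cast_neg, neg_smul]
    rw [show n + 1 + 1 = n + 2 from rfl]
    abel

omit ht in
theorem trD_of_support_zero {d : D k} (h1 : d.1 1 = 0) (h2 : d.2 = 0) :
    trD t d = weight k 0 * d.1 0 := by
  simp [trD_apply, h1, h2]

omit ht in
theorem trD_of_support_two {d : D k} (h1 : d.1 0 = 0) (h2 : d.2 = 0) :
    trD t d = weight k 2 * d.1 1 := by
  simp [trD_apply, h1, h2]

theorem IsRootList.trD_sum (c : ℕ → ℝ) (n : ℕ) (hn : n ≤ 2 * k + 1) :
    trD t (∑ i ∈ Finset.range (n + 1), c i • chebD t (2 * i)) = c 0 := by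
  rw [map_sum, Finset.sum_eq_single_of_mem 0 (by simp)]
  · rw [map_smul, ht.isForkTrace.map_even 0 (by omega)]
    simp
  · intro i hi hi0
    rw [Finset.mem_range] at hi
    rw [map_smul, ht.isForkTrace.map_even i (by omega), if_neg hi0, smul_zero]

theorem IsRootList.trD_fork : trD t (forkF (chebD t) (2 * k + 1)) = 0 ∧
    trD t (forkG (chebD t) (2 * k + 1)) = 0 := by
  have h1 := ht.isForkTrace.orth_f 0 (by omega)
  have h2 := ht.isForkTrace.orth_g 0 (by omega)
  rw [Nat.cast_zero, mul_zero, (isChebyshev_chebD t).zero, one_mul] at h1 h2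
  exact ⟨h1, h2⟩

/-- The element `d` is annihilated by `A` because the alternating sum telescopes, so it lives at the
point `0`. Its value there is `2k + 2` squares of signs plus `f = 1`; its trace is 1, from the term
`i = 0`. -/
theorem IsRootList.weight_zero : (2 * k + 3) * weight k 0 = 1 := by
  set d : D k := ∑ i ∈ Finset.range (2 * k + 1 + 1), (valZero i : ℝ) • chebD t (2 * i) +
    forkF (chebD t) (2 * k + 1) with hd
  have hA : chebD t 1 * d = 0 := by
    rw [hd, mul_add, chebD_one_mul_sum, ht.isForkTrace.one_mul_forkF]
    have : valZero (2 * k + 1) = -1 := by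
      unfold valZero
      rw [if_neg (by omega)]
    rw [this]
    simp
  have h1 : d.1 1 = 0 := by
    have := congrArg (fun d => d.1 1) hA
    simpa [chebD_one_two] using this
  have h2 : d.2 = 0 := by
    ext j
    have := congrArg (fun d => d.2 j) hA
    simpa [chebD, (Real.sqrt_pos.2 (ht.pos j)).ne'] using this
  have h0 : d.1 0 = 2 * k + 3 := by
    rw [hd, Prod.fst_add, Pi.add_apply, forkF_zero, Prod.fst_sum, Finset.sum_apply]
    simp only [Prod.smul_fst, Pi.smul_apply, chebD_even_zero, smul_eq_mul, valZero_mul_self]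
    simp
    ring
  have e := trD_of_support_zero (t := t) h1 h2
  rw [h0, hd, map_add, ht.trD_sum (fun i => valZero i) _ le_rfl, ht.trD_fork.1] at e
  rw [mul_comm, ← e]
  simp [valZero]

/-- The same argument at `√2`, with `A² - 2` as annihilator and `g`, which is a sign there, in the
role of `f`. -/
theorem IsRootList.weight_two : (2 * k + 3) * weight k 2 = 1 := by
  set d : D k := ∑ i ∈ Finset.range (2 * k + 2), (valTwo i : ℝ) • chebD t (2 * i) +
    (valTwo (2 * k + 2) : ℝ) • forkG (chebD t) (2 * k + 1) with hd
  have hA : (chebD t 2 - 1) * d = 0 := by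
    have hg : (chebD t 2 - 1) * forkG (chebD t) (2 * k + 1) =
        chebD t (2 * (2 * k + 1 : ℕ)) + chebD t (2 * (2 * k + 2 : ℕ)) := by
      have e := IsForkTrace.forkF_add_forkG (R := chebD t) (m := 2 * k + 1)
      rw [show 2 * ((2 * k + 2 : ℕ) : ℤ) = 2 * (2 * k + 1 : ℕ) + 2 by push_cast; ring, e]
      linear_combination ht.isForkTrace.two_mul_forkG_eq
    rw [hd, mul_add, chebD_two_mul_sum, mul_smul_comm, hg]
    have e1 : valTwo (2 * k + 2) = -valTwo (2 * k) := by
      unfold valTwo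
      split_ifs <;> omega
    have e2 : valTwo (2 * k + 1) = valTwo (2 * k) := by
      unfold valTwo
      split_ifs <;> omega
    rw [e1, e2, smul_add]
    push_cast
    rw [neg_smul, neg_smul]
    abel
  have h02 : (chebD t 2 - 1) = chebD t 1 * chebD t 1 - 2 := by
    rw [ht.isForkTrace.two_eq]
    ring
  rw [h02] at hA
  have h1 : d.1 0 = 0 := by
    have := congrArg (fun d => d.1 0) hA
    simpa [chebD_one_zero] using this
  have h2 : d.2 = 0 := by
    ext j
    have := congrArg (fun d => d.2 j) hA
    have hs := Real.mul_self_sqrt (ht.pos j).le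
    simpa [chebD, hs, sub_eq_zero, ht.ne_two j] using this
  have h0 : d.1 1 = 2 * k + 3 := by
    rw [hd, Prod.fst_add, Pi.add_apply, Prod.fst_sum, Finset.sum_apply]
    simp only [Prod.smul_fst, Pi.smul_apply, chebD_even_two, smul_eq_mul, valTwo_mul_self,
      forkG_two]
    simp
    ring
  have e := trD_of_support_two (t := t) h1 h2
  rw [h0, hd, map_add, ht.trD_sum (fun i => valTwo i) _ le_rfl, map_smul, ht.trD_fork.2] at e
  rw [mul_comm, ← e]
  simp [valTwo]

end Spectrum

/-! ### Integrality and nonnegativity of the structure constants -/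

section Elements

variable {k : ℕ}

/-- The element of `B k` with given diagonal and rescaled off-diagonal entries. -/
noncomputable def bElem (p : D k) (c d : ℝ) : B k :=
  (!![p.1 0, c * √(2 * k + 3); d * √(2 * k + 3), p.1 1], p.2)

variable {t : Fin (2 * k + 2) → ℝ} (ht : IsRootList k t)
include ht

/-- Off-diagonal entries enter in pairs, whose factor `2k + 3` cancels the common weight `1 / (2k +
3)`. -/
theorem IsRootList.mu_bElem_mul_mul (p₁ p₂ p₃ : D k) (c₁ d₁ c₂ d₂ c₃ d₃ : ℝ) :
    mu k t (bElem p₁ c₁ d₁ * bElem p₂ c₂ d₂ * bElem p₃ c₃ d₃) = trD t (p₁ * p₂ * p₃) +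
      (p₁.1 0 * (c₂ * d₃) + c₁ * d₃ * p₂.1 1 + c₁ * d₂ * p₃.1 0 +
        d₁ * c₃ * p₂.1 0 + d₁ * c₂ * p₃.1 1 + p₁.1 1 * (d₂ * c₃)) := by
  have hs : √(2 * k + 3) * √(2 * k + 3) = 2 * k + 3 := Real.mul_self_sqrt (by positivity)
  have w0 := ht.weight_zero
  have w2 := ht.weight_two
  rw [← hs] at w0 w2
  rw [trD_apply]
  simp only [mu, bElem, Prod.fst_mul, Prod.snd_mul, Matrix.mul_apply, Fin.sum_univ_two,
    Matrix.of_apply, Matrix.cons_val', Matrix.cons_val_zero, Matrix.cons_val_one,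
    Matrix.cons_val_fin_one, Pi.mul_apply]
  linear_combination (p₁.1 0 * (c₂ * d₃) + c₁ * d₃ * p₂.1 1 + c₁ * d₂ * p₃.1 0) * w0 +
    (d₁ * c₃ * p₂.1 0 + d₁ * c₂ * p₃.1 1 + p₁.1 1 * (d₂ * c₃)) * w2

/-- Both diagonal entries of the block `M₂` have the same weight, so `μ` restricts there to a
multiple of the matrix trace. -/
theorem IsRootList.mu_mul_comm (b c : B k) : mu k t (b * c) = mu k t (c * b) := by
  have w0 := ht.weight_zero
  have w2 := ht.weight_two
  have hk : (2 * k + 3 : ℝ) ≠ 0 := by positivity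
  have w : weight k 0 = weight k 2 := mul_left_cancel₀ hk (w0.trans w2.symm)
  simp only [mu, Prod.fst_mul, Prod.snd_mul, Matrix.mul_apply, Fin.sum_univ_two, Pi.mul_apply, w]
  simp only [mul_comm (c.2 _)]
  ring

/-- The components in `B k` of the elements of `V`, by their labels. -/
inductive IsElem (t : Fin (2 * k + 2) → ℝ) : Fin 2 → Fin 2 → B k → Prop
  | evenPath (i : ℕ) (hi : i ≤ 2 * k + 1) : IsElem t 0 0 (bElem (chebD t (2 * i)) 0 0)
  | leg (φ ε : ℤ) (hφ : φ = 1 ∨ φ = -1) (hε : ε = 1 ∨ ε = -1) :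
      IsElem t 0 0 (bElem (legEven (chebD t) (2 * k + 1) φ) (ε / 2) (ε * φ / 2))
  | oddPath (i : ℕ) (hi : i ≤ 2 * k + 1) : IsElem t 0 1 (bElem (chebD t (2 * i + 1)) 0 0)
  | mid (ε : ℤ) (hε : ε = 1 ∨ ε = -1) :
      IsElem t 0 1 (bElem (legOdd (chebD t) (2 * k + 1)) (ε * √2 / 2) 0)
  | oddPath' (i : ℕ) (hi : i ≤ 2 * k + 1) : IsElem t 1 0 (bElem (chebD t (2 * i + 1)) 0 0)
  | mid' (ε : ℤ) (hε : ε = 1 ∨ ε = -1) :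
      IsElem t 1 0 (bElem (legOdd (chebD t) (2 * k + 1)) 0 (ε * √2 / 2))
  | evenPath' (i : ℕ) (hi : i ≤ 2 * k + 1) : IsElem t 1 1 (bElem (chebD t (2 * i)) 0 0)
  | f : IsElem t 1 1 (bElem (forkF (chebD t) (2 * k + 1)) 0 0)
  | g : IsElem t 1 1 (bElem (forkG (chebD t) (2 * k + 1)) 0 0)

omit ht in
theorem sign_mul {a b : ℤ} (ha : a = 1 ∨ a = -1) (hb : b = 1 ∨ b = -1) :
    a * b = 1 ∨ a * b = -1 := by
  rcases ha with rfl | rfl <;> rcases hb with rfl | rfl <;> simp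

omit ht in
theorem mul_rotate_left {M : Type*} [CommMonoid M] (x y z : M) : x * y * z = y * z * x := by
  rw [mul_comm, mul_comm y, mul_assoc, mul_comm y, mul_comm x, ← mul_assoc, mul_comm z]

omit ht in
theorem mul_reverse {M : Type*} [CommMonoid M] (x y z : M) : x * y * z = z * y * x := by
  rw [mul_comm, mul_comm x, mul_assoc]

/-- Three elements of `V₁₁`. -/
theorem IsRootList.isNat_mu_zero {x y z : B k} (hx : IsElem t 0 0 x) (hy : IsElem t 0 0 y)
    (hz : IsElem t 0 0 z) : IsNat (mu k t (x * y * z)) := by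
  have h := ht.isForkTrace
  have cyc (x y z : B k) : mu k t (x * y * z) = mu k t (y * z * x) := by
    rw [mul_assoc, ht.mu_mul_comm]
  -- `R` stands for a path vertex and `L` for a leg end; the other cyclic orders follow from `cyc`.
  have RRR (a b c : ℕ) (ha : a ≤ 2 * k + 1) (hb : b ≤ 2 * k + 1) (hc : c ≤ 2 * k + 1) :
      IsNat (trD t (chebD t (2 * a) * chebD t (2 * b) * chebD t (2 * c))) := by
    have := h.isNat_map_mul_mul (2 * a) (2 * b) (2 * c) (by omega) (by omega) (by omega)
      (by simp [parity_simps])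
    exact_mod_cast this
  have RRL (a b : ℕ) (φ ε : ℤ) (ha : a ≤ 2 * k + 1) (hb : b ≤ 2 * k + 1) (hφ : φ = 1 ∨ φ = -1) :
      IsNat (mu k t (bElem (chebD t (2 * a)) 0 0 * bElem (chebD t (2 * b)) 0 0 *
        bElem (legEven (chebD t) (2 * k + 1) φ) (ε / 2) (ε * φ / 2))) := by
    rw [ht.mu_bElem_mul_mul]
    have : IsNat (trD t (chebD t (2 * a : ℕ) * chebD t (2 * b : ℕ) *
          legEven (chebD t) (2 * k + 1) φ)) :=
          h.isNat_map_mul_mul_leg (2 * a) (2 * b) (by omega) (by omega)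
      (by simp [parity_simps]) hφ
    simp only [zero_mul, mul_zero, add_zero]
    exact_mod_cast this
  have RLL (a : ℕ) (φ ε φ' ε' : ℤ) (ha : a ≤ 2 * k + 1) (hφ : φ = 1 ∨ φ = -1)
      (hφ' : φ' = 1 ∨ φ' = -1) (hε : ε = 1 ∨ ε = -1) (hε' : ε' = 1 ∨ ε' = -1) :
      IsNat (mu k t (bElem (chebD t (2 * a)) 0 0 *
        bElem (legEven (chebD t) (2 * k + 1) φ) (ε / 2) (ε * φ / 2) *
        bElem (legEven (chebD t) (2 * k + 1) φ') (ε' / 2) (ε' * φ' / 2))) := by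
    rw [ht.mu_bElem_mul_mul]
    refine isNat_of_mul_eq 4 (by norm_num) ?_
      (trib_leg_leg a hφ hφ' (sign_mul hε hε') rfl)
    have e := h.map_even_legEven_legEven a (by omega) φ φ'
    rw [chebD_even_zero, chebD_even_two]
    push_cast
    linear_combination e
  have LLL (φ ε φ' ε' φ₃ ε₃ : ℤ) (hφ : φ = 1 ∨ φ = -1) (hφ' : φ' = 1 ∨ φ' = -1)
      (hφ₃ : φ₃ = 1 ∨ φ₃ = -1)
      (hε : ε = 1 ∨ ε = -1) (hε' : ε' = 1 ∨ ε' = -1) (hε₃ : ε₃ = 1 ∨ ε₃ = -1) :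
      IsNat (mu k t (bElem (legEven (chebD t) (2 * k + 1) φ) (ε / 2) (ε * φ / 2) *
        bElem (legEven (chebD t) (2 * k + 1) φ') (ε' / 2) (ε' * φ' / 2) *
        bElem (legEven (chebD t) (2 * k + 1) φ₃) (ε₃ / 2) (ε₃ * φ₃ / 2))) := by
    rw [ht.mu_bElem_mul_mul]
    refine isNat_of_mul_eq 8 (by norm_num) ?_
      (trib_three_legs k hφ hφ' hφ₃ hε hε' hε₃ rfl)
    have e := h.map_legEven_cube φ φ' φ₃
    simp only [legEven_zero, legEven_two]
    simp only [Nat.add_assoc, Nat.reduceAdd] at e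
    push_cast
    linear_combination e
  cases hx with
  | evenPath a ha =>
    cases hy with
    | evenPath b hb =>
      cases hz with
      | evenPath c hc =>
        rw [ht.mu_bElem_mul_mul]
        simpa using RRR a b c ha hb hc
      | leg φ ε hφ hε => exact RRL a b φ ε ha hb hφ
    | leg φ ε hφ hε =>
      cases hz with
      | evenPath c hc =>
        rw [← cyc]
        exact RRL c a φ ε hc ha hφ
      | leg φ' ε' hφ' hε' => exact RLL a φ ε φ' ε' ha hφ hφ' hε hε'
  | leg φ ε hφ hε =>
    cases hy with
    | evenPath b hb =>
      cases hz with
      | evenPath c hc =>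
        rw [cyc]
        exact RRL b c φ ε hb hc hφ
      | leg φ' ε' hφ' hε' =>
        rw [cyc]
        exact RLL b φ' ε' φ ε hb hφ' hφ hε' hε
    | leg φ' ε' hφ' hε' =>
      cases hz with
      | evenPath c hc =>
        rw [← cyc]
        exact RLL c φ ε φ' ε' hc hφ hφ' hε hε'
      | leg φ₃ ε₃ hφ₃ hε₃ => exact LLL φ ε φ' ε' φ₃ ε₃ hφ hφ' hφ₃ hε hε' hε₃

/-- Two times the diagonal trace is an odd integer in effect, so adding either sign makes it even;
`a = 0` is separate because the Tribonacci formula starts at index one. -/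
theorem IsRootList.trD_odd_mid_mid {a : ℕ} (ha : a ≤ 2 * k + 1) :
    ∃ z : ℤ, 2 * trD t (chebD t (2 * a) * legOdd (chebD t) (2 * k + 1) *
      legOdd (chebD t) (2 * k + 1)) = z ∧
    ∀ e : ℤ, e = 1 ∨ e = -1 → (0 ≤ z + e * valZero a ∧ (2 : ℤ) ∣ z + e * valZero a) ∧
      (0 ≤ z + e * valTwo a ∧ (2 : ℤ) ∣ z + e * valTwo a) := by
  have h := ht.isForkTrace
  rcases a with _ | a
  · refine ⟨1, ?_, fun e he => ?_⟩
    · simpa [h.zero] using h.map_legOdd_legOdd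
    · rcases he with rfl | rfl <;> simp [valZero, valTwo]
  · refine ⟨_, ?_, fun e he => ⟨trib_odd_odd_zero a he rfl, trib_odd_odd_two a he rfl⟩⟩
    rw [h.map_even_legOdd_legOdd a (by omega)]
    push_cast
    ring

/-- An element of `V₁₁`, one of `V₁₂` and one of `V₂₁`. -/
theorem IsRootList.isNat_mu_one {x y z : B k} (hx : IsElem t 0 0 x) (hy : IsElem t 0 1 y)
    (hz : IsElem t 1 0 z) : IsNat (mu k t (x * y * z)) := by
  have h := ht.isForkTrace
  have h2 : √2 * √2 = 2 := Real.mul_self_sqrt (by norm_num)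
  have mid2 := ht.legOdd_two
  cases hx with
  | evenPath a ha =>
    cases hy with
    | oddPath b hb =>
      cases hz with
      | oddPath' c hc =>
        rw [ht.mu_bElem_mul_mul]
        have := h.isNat_map_mul_mul (2 * a) (2 * b + 1) (2 * c + 1) (by omega) (by omega)
          (by omega) (by simp [parity_simps])
        simp only [zero_mul, mul_zero, add_zero]
        exact_mod_cast this
      | mid' ε hε =>
        rw [ht.mu_bElem_mul_mul]
        have : IsNat (trD t (chebD t (2 * a : ℕ) * chebD t (2 * b + 1 : ℕ) *
          legOdd (chebD t) (2 * k + 1))) :=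
          h.isNat_map_mul_mul_forkH (2 * a) (2 * b + 1) (by omega) (by omega)
          (by simp [parity_simps])
        simp only [zero_mul, mul_zero, add_zero]
        exact_mod_cast this
    | mid ε hε =>
      cases hz with
      | oddPath' c hc =>
        rw [ht.mu_bElem_mul_mul, mul_right_comm]
        have : IsNat (trD t (chebD t (2 * a : ℕ) * chebD t (2 * c + 1 : ℕ) *
          legOdd (chebD t) (2 * k + 1))) :=
          h.isNat_map_mul_mul_forkH (2 * a) (2 * c + 1) (by omega) (by omega)
          (by simp [parity_simps])
        simp only [zero_mul, mul_zero, add_zero]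
        exact_mod_cast this
      | mid' ε' hε' =>
        rw [ht.mu_bElem_mul_mul]
        obtain ⟨z, hz, hn⟩ := ht.trD_odd_mid_mid ha
        refine isNat_of_mul_eq 2 (by norm_num) ?_ (hn _ (sign_mul hε hε')).1
        rw [chebD_even_zero]
        push_cast
        linear_combination hz + 1 / 2 * valZero a * ε * ε' * h2
  | leg φ ε₀ hφ hε₀ =>
    cases hy with
    | oddPath b hb =>
      cases hz with
      | oddPath' c hc =>
        rw [ht.mu_bElem_mul_mul, mul_rotate_left]
        have : IsNat (trD t (chebD t (2 * b + 1 : ℕ) * chebD t (2 * c + 1 : ℕ) *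
          legEven (chebD t) (2 * k + 1) φ)) :=
          h.isNat_map_mul_mul_leg (2 * b + 1) (2 * c + 1) (by omega) (by omega)
          (by simp [parity_simps]) hφ
        simp only [zero_mul, mul_zero, add_zero]
        exact_mod_cast this
      | mid' ε hε =>
        rw [ht.mu_bElem_mul_mul, mul_rotate_left]
        refine isNat_of_mul_eq 4 (by norm_num) ?_
          (trib_odd_leg b hφ (sign_mul hε₀ hε) rfl)
        have e := h.map_odd_legOdd_legEven b (by omega) φ
        have e2 := chebD_odd_two t b
        push_cast
        linear_combination e + ε₀ * ε * e2
    | mid ε hε =>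
      cases hz with
      | oddPath' c hc =>
        rw [ht.mu_bElem_mul_mul, mul_reverse]
        refine isNat_of_mul_eq 4 (by norm_num) ?_
          (trib_odd_leg c hφ (sign_mul (sign_mul hε₀ hφ) hε) rfl)
        have e := h.map_odd_legOdd_legEven c (by omega) φ
        have e2 := chebD_odd_two t c
        push_cast
        linear_combination e + ε₀ * φ * ε * e2
      | mid' ε' hε' =>
        rw [ht.mu_bElem_mul_mul, mul_rotate_left]
        refine isNat_of_mul_eq 4 (by norm_num) ?_
          (trib_leg_odd_odd k hφ hε₀ hε hε' rfl)
        have e := h.map_legOdd_legOdd_legEven φ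
        simp only [Nat.add_assoc, Nat.reduceAdd] at e
        rw [legEven_zero]
        push_cast
        linear_combination e + (ε₀ * ε' + ε₀ * φ * ε) * mid2 + 1 / 2 * φ * ε * ε' * h2

/-- An element of `V₂₂`, one of `V₂₁` and one of `V₁₂`. -/
theorem IsRootList.isNat_mu_two {x y z : B k} (hx : IsElem t 1 1 x) (hy : IsElem t 1 0 y)
    (hz : IsElem t 0 1 z) : IsNat (mu k t (x * y * z)) := by
  have h := ht.isForkTrace
  have h2 : √2 * √2 = 2 := Real.mul_self_sqrt (by norm_num)
  cases hx with
  | evenPath' a ha =>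
    cases hy with
    | oddPath' b hb =>
      cases hz with
      | oddPath c hc =>
        rw [ht.mu_bElem_mul_mul]
        have := h.isNat_map_mul_mul (2 * a) (2 * b + 1) (2 * c + 1) (by omega) (by omega)
          (by omega) (by simp [parity_simps])
        simp only [zero_mul, mul_zero, add_zero]
        exact_mod_cast this
      | mid ε hε =>
        rw [ht.mu_bElem_mul_mul]
        have : IsNat (trD t (chebD t (2 * a : ℕ) * chebD t (2 * b + 1 : ℕ) *
          legOdd (chebD t) (2 * k + 1))) :=
          h.isNat_map_mul_mul_forkH (2 * a) (2 * b + 1) (by omega) (by omega)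
          (by simp [parity_simps])
        simp only [zero_mul, mul_zero, add_zero]
        exact_mod_cast this
    | mid' ε hε =>
      cases hz with
      | oddPath c hc =>
        rw [ht.mu_bElem_mul_mul, mul_right_comm]
        have : IsNat (trD t (chebD t (2 * a : ℕ) * chebD t (2 * c + 1 : ℕ) *
          legOdd (chebD t) (2 * k + 1))) :=
          h.isNat_map_mul_mul_forkH (2 * a) (2 * c + 1) (by omega) (by omega)
          (by simp [parity_simps])
        simp only [zero_mul, mul_zero, add_zero]
        exact_mod_cast this
      | mid ε' hε' =>
        rw [ht.mu_bElem_mul_mul]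
        obtain ⟨z, hz, hn⟩ := ht.trD_odd_mid_mid ha
        refine isNat_of_mul_eq 2 (by norm_num) ?_ (hn _ (sign_mul hε hε')).2
        rw [chebD_even_two]
        push_cast
        linear_combination hz + 1 / 2 * valTwo a * ε * ε' * h2
  | f =>
    cases hy with
    | oddPath' b hb =>
      cases hz with
      | oddPath c hc =>
        rw [ht.mu_bElem_mul_mul, mul_rotate_left]
        have := h.isNat_map_mul_mul_forkF (2 * b + 1) (2 * c + 1) (by omega) (by omega)
          (by simp [parity_simps])
        simp only [zero_mul, mul_zero, add_zero]
        exact_mod_cast this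
      | mid ε hε =>
        rw [ht.mu_bElem_mul_mul, mul_rotate_left, h.map_odd_legOdd_forkF b (by omega)]
        simpa using isNat_trib (b + 2)
    | mid' ε hε =>
      cases hz with
      | oddPath c hc =>
        rw [ht.mu_bElem_mul_mul, mul_rotate_left, mul_comm (legOdd _ _),
          h.map_odd_legOdd_forkF c (by omega)]
        simpa using isNat_trib (c + 2)
      | mid ε' hε' =>
        rw [ht.mu_bElem_mul_mul, mul_rotate_left]
        refine isNat_of_mul_eq 2 (by norm_num) ?_ (trib_even_f k rfl)
        have e := h.map_legOdd_legOdd_fork.1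
        simp only [Nat.add_assoc, Nat.reduceAdd] at e
        rw [forkF_two]
        push_cast
        linear_combination e
  | g =>
    cases hy with
    | oddPath' b hb =>
      cases hz with
      | oddPath c hc =>
        rw [ht.mu_bElem_mul_mul, mul_rotate_left]
        have := h.isNat_map_mul_mul_forkG (2 * b + 1) (2 * c + 1) (by omega) (by omega)
          (by simp [parity_simps])
        simp only [zero_mul, mul_zero, add_zero]
        exact_mod_cast this
      | mid ε hε =>
        rw [ht.mu_bElem_mul_mul, mul_rotate_left, h.map_odd_legOdd_forkG b (by omega)]
        simpa using isNat_trib (b + 3)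
    | mid' ε hε =>
      cases hz with
      | oddPath c hc =>
        rw [ht.mu_bElem_mul_mul, mul_rotate_left, mul_comm (legOdd _ _),
          h.map_odd_legOdd_forkG c (by omega)]
        simpa using isNat_trib (c + 3)
      | mid ε' hε' =>
        rw [ht.mu_bElem_mul_mul, mul_rotate_left]
        refine isNat_of_mul_eq 2 (by norm_num) ?_ (trib_even_g k (sign_mul hε hε') rfl)
        have e := h.map_legOdd_legOdd_fork.2
        simp only [Nat.add_assoc, Nat.reduceAdd] at e
        rw [forkG_two]
        push_cast
        linear_combination e + 1 / 2 * valTwo (2 * k + 2) * ε * ε' * h2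

/-- Three elements of `V₂₂`. -/
theorem IsRootList.isNat_mu_three {x y z : B k} (hx : IsElem t 1 1 x) (hy : IsElem t 1 1 y)
    (hz : IsElem t 1 1 z) : IsNat (mu k t (x * y * z)) := by
  have h := ht.isForkTrace
  have RRR (a b c : ℕ) (ha : a ≤ 2 * k + 1) (hb : b ≤ 2 * k + 1) (hc : c ≤ 2 * k + 1) :
      IsNat (trD t (chebD t (2 * a) * chebD t (2 * b) * chebD t (2 * c))) := by
    have := h.isNat_map_mul_mul (2 * a) (2 * b) (2 * c) (by omega) (by omega) (by omega)
      (by simp [parity_simps])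
    exact_mod_cast this
  have RRF (a b : ℕ) (ha : a ≤ 2 * k + 1) (hb : b ≤ 2 * k + 1) :
      IsNat (trD t (chebD t (2 * a) * chebD t (2 * b) * forkF (chebD t) (2 * k + 1))) := by
    have := h.isNat_map_mul_mul_forkF (2 * a) (2 * b) (by omega) (by omega)
      (by simp [parity_simps])
    exact_mod_cast this
  have RRG (a b : ℕ) (ha : a ≤ 2 * k + 1) (hb : b ≤ 2 * k + 1) :
      IsNat (trD t (chebD t (2 * a) * chebD t (2 * b) * forkG (chebD t) (2 * k + 1))) := by
    have := h.isNat_map_mul_mul_forkG (2 * a) (2 * b) (by omega) (by omega)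
      (by simp [parity_simps])
    exact_mod_cast this
  have Rff (a : ℕ) (ha : a ≤ 2 * k + 1) : IsNat (trD t (chebD t (2 * a) * forkF (chebD t) (2 * k +
      1) * forkF (chebD t) (2 * k + 1))) ∧
      IsNat (trD t (chebD t (2 * a) * forkF (chebD t) (2 * k + 1) * forkG (chebD t) (2 * k + 1))) ∧
          IsNat (trD t (chebD t (2 * a) * forkG (chebD t) (2 * k + 1) * forkG (chebD t) (2 * k +
          1))) := by
    obtain ⟨e1, e2, e3⟩ := h.map_mul_fork_mul_fork a (by omega)
    rw [e1, e2, e3]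
    exact ⟨(isNat_trib _).add (isNat_trib _), (isNat_trib _).add (isNat_trib _),
      (isNat_trib _).add (isNat_trib _)⟩
  have fff : IsNat (trD t (forkF (chebD t) (2 * k + 1) * forkF (chebD t) (2 * k +
      1) * forkF (chebD t) (2 * k + 1))) ∧ IsNat (trD t (forkF (chebD t) (2 * k +
      1) * forkF (chebD t) (2 * k + 1) * forkG (chebD t) (2 * k + 1))) ∧
      IsNat (trD t (forkF (chebD t) (2 * k + 1) * forkG (chebD t) (2 * k +
          1) * forkG (chebD t) (2 * k + 1))) ∧ IsNat (trD t (forkG (chebD t) (2 * k +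
          1) * forkG (chebD t) (2 * k + 1) * forkG (chebD t) (2 * k + 1))) := by
    obtain ⟨e1, e2, e3, e4⟩ := h.map_fork_cube
    rw [e1, e2, e3, e4]
    exact ⟨isNat_trib _, isNat_trib _, isNat_trib _, isNat_trib _⟩
  cases hx <;> cases hy <;> cases hz <;> rw [ht.mu_bElem_mul_mul] <;>
    simp only [zero_mul, mul_zero, add_zero]
  case evenPath'.evenPath'.evenPath' a ha b hb c hc => exact RRR a b c ha hb hc
  case evenPath'.evenPath'.f a ha b hb => exact RRF a b ha hb
  case evenPath'.evenPath'.g a ha b hb => exact RRG a b ha hb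
  case evenPath'.f.evenPath' a ha c hc =>
    rw [mul_right_comm]
    exact RRF a c ha hc
  case evenPath'.g.evenPath' a ha c hc =>
    rw [mul_right_comm]
    exact RRG a c ha hc
  case f.evenPath'.evenPath' b hb c hc =>
    rw [mul_rotate_left]
    exact RRF b c hb hc
  case g.evenPath'.evenPath' b hb c hc =>
    rw [mul_rotate_left]
    exact RRG b c hb hc
  case evenPath'.f.f a ha => exact (Rff a ha).1
  case evenPath'.f.g a ha => exact (Rff a ha).2.1
  case evenPath'.g.f a ha =>
    rw [mul_right_comm]
    exact (Rff a ha).2.1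
  case evenPath'.g.g a ha => exact (Rff a ha).2.2
  case f.evenPath'.f a ha =>
    rw [mul_comm (forkF _ _)]
    exact (Rff a ha).1
  case f.evenPath'.g a ha =>
    rw [mul_comm (forkF _ _)]
    exact (Rff a ha).2.1
  case g.evenPath'.f a ha =>
    rw [mul_rotate_left]
    exact (Rff a ha).2.1
  case g.evenPath'.g a ha =>
    rw [mul_comm (forkG _ _)]
    exact (Rff a ha).2.2
  case f.f.evenPath' a ha =>
    rw [mul_reverse]
    exact (Rff a ha).1
  case f.g.evenPath' a ha =>
    rw [mul_rotate_left, mul_rotate_left]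
    exact (Rff a ha).2.1
  case g.f.evenPath' a ha =>
    rw [mul_reverse]
    exact (Rff a ha).2.1
  case g.g.evenPath' a ha =>
    rw [mul_reverse]
    exact (Rff a ha).2.2
  case f.f.f => exact fff.1
  case f.f.g => exact fff.2.1
  case f.g.f =>
    rw [mul_right_comm]
    exact fff.2.1
  case g.f.f =>
    rw [mul_rotate_left]
    exact fff.2.1
  case f.g.g => exact fff.2.2.1
  case g.f.g =>
    rw [mul_comm (forkG _ _)]
    exact fff.2.2.1
  case g.g.f =>
    rw [mul_reverse]
    exact fff.2.2.1
  case g.g.g => exact fff.2.2.2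

/-- The trace of a product of three cyclically composable elements is a natural number. -/
theorem IsRootList.isNat_mu {i j l : Fin 2} {x y z : B k} (hx : IsElem t i j x)
    (hy : IsElem t j l y) (hz : IsElem t l i z) : IsNat (mu k t (x * y * z)) := by
  have cyc (x y z : B k) : mu k t (x * y * z) = mu k t (y * z * x) := by
    rw [mul_assoc, ht.mu_mul_comm]
  -- Cyclic rotation reduces the eight label patterns to four.
  fin_cases i <;> fin_cases j <;> fin_cases l
  · exact ht.isNat_mu_zero hx hy hz
  · exact ht.isNat_mu_one hx hy hz
  · rw [← cyc z x y]
    exact ht.isNat_mu_one hz hx hy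
  · rw [cyc x y z]
    exact ht.isNat_mu_two hy hz hx
  · rw [cyc x y z]
    exact ht.isNat_mu_one hy hz hx
  · rw [← cyc z x y]
    exact ht.isNat_mu_two hz hx hy
  · exact ht.isNat_mu_two hx hy hz
  · exact ht.isNat_mu_three hx hy hz

end Elements

/-! ### The elements of `V` in diagonal and off-diagonal coordinates; conjugation -/

section Entries

variable {k : ℕ} (t : Fin (2 * k + 2) → ℝ)

theorem diagHom_apply (p : D k) : diagHom k p = (Matrix.diagonal p.1, p.2) := rfl

theorem bElem_eq (p : D k) (c d : ℝ) : bElem p c d =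
    diagHom k p + ((c * √(2 * k + 3)) • e12 k + (d * √(2 * k + 3)) • e21 k) := by
  refine Prod.ext ?_ ?_
  · ext i j
    fin_cases i <;> fin_cases j <;> simp [bElem, diagHom_apply, e12, e21]
  · ext i
    simp [bElem, diagHom_apply, e12, e21]

theorem star_bElem (p : D k) (c d : ℝ) : star (bElem p c d) = bElem p d c := by
  refine Prod.ext ?_ ?_
  · ext i j
    fin_cases i <;> fin_cases j <;> simp [bElem, Matrix.star_apply]
  · ext i
    simp [bElem]

theorem RA_eq (j : ℕ) : RA k t j = bElem (chebD t j) 0 0 := by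
  simp [bElem_eq, diagHom_chebD]

theorem legEven_one : legEven (chebD t) (2 * k + 1) 1 = (1 / 2 : ℝ) • chebD t (4 * k + 4 : ℕ) := by
  have e := IsForkTrace.forkF_add_forkG (R := chebD t) (m := 2 * k + 1)
  rw [legEven, show ((4 * k + 4 : ℕ) : ℤ) = 2 * (2 * k + 1 : ℕ) + 2 by push_cast; ring, e]
  simp [add_comm]

theorem legEven_neg_one : legEven (chebD t) (2 * k + 1) (-1) = (1 / 2 : ℝ) •
    (chebD t (4 * k + 6 : ℕ) - chebD t (4 * k + 4 : ℕ) - chebD t (4 * k + 2 : ℕ)) := by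
  have e1 := two_mul_forkF (chebD t) (2 * k + 1)
  have e2 := two_mul_forkG (chebD t) (2 * k + 1)
  rw [legEven, show ((4 * k + 4 : ℕ) : ℤ) = 2 * (2 * k + 1 : ℕ) + 2 by push_cast; ring,
    show ((4 * k + 6 : ℕ) : ℤ) = 2 * (2 * k + 1 : ℕ) + 4 by push_cast; ring,
    show ((4 * k + 2 : ℕ) : ℤ) = 2 * (2 * k + 1 : ℕ) by push_cast; ring]
  congr 1
  apply eq_of_two_mul_eq
  rw [Int.cast_neg, Int.cast_one, neg_one_smul]
  linear_combination e2 - e1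

theorem legOdd_eq : legOdd (chebD t) (2 * k + 1) =
    (1 / 2 : ℝ) • (chebD t (4 * k + 5 : ℕ) - chebD t (4 * k + 3 : ℕ)) := by
  rw [legOdd, forkH, show ((4 * k + 5 : ℕ) : ℤ) = 2 * (2 * k + 1 : ℕ) + 3 by push_cast; ring,
    show ((4 * k + 3 : ℕ) : ℤ) = 2 * (2 * k + 1 : ℕ) + 1 by push_cast; ring]

theorem sqrt_two_mul_eq : √(2 * (2 * k + 3)) = √2 * √(2 * k + 3) := Real.sqrt_mul (by norm_num) _

theorem entry_a (j) : entry k t (.inl (.a j)) = bElem (chebD t j.val) 0 0 := RA_eq t j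

theorem entry_a' (j) : entry k t (.inr (.a j)) = bElem (chebD t j.val) 0 0 := RA_eq t j

theorem entry_b1 : entry k t (.inl .b1) =
    bElem (legEven (chebD t) (2 * k + 1) 1) (1 / 2) (1 / 2) := by
  rw [bElem_eq, legEven_one, map_smul, diagHom_chebD, entry]
  module

theorem entry_c1 : entry k t (.inl .c1) =
    bElem (legEven (chebD t) (2 * k + 1) 1) (-1 / 2) (-1 / 2) := by
  rw [bElem_eq, legEven_one, map_smul, diagHom_chebD, entry]
  module

theorem entry_b3 : entry k t (.inl .b3) =
    bElem (legEven (chebD t) (2 * k + 1) (-1)) (1 / 2) (-1 / 2) := by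
  rw [bElem_eq, legEven_neg_one, map_smul, map_sub, map_sub, diagHom_chebD, diagHom_chebD,
    diagHom_chebD, entry]
  module

theorem entry_c3 : entry k t (.inl .c3) =
    bElem (legEven (chebD t) (2 * k + 1) (-1)) (-1 / 2) (1 / 2) := by
  rw [bElem_eq, legEven_neg_one, map_smul, map_sub, map_sub, diagHom_chebD, diagHom_chebD,
    diagHom_chebD, entry]
  module

theorem entry_b2 : entry k t (.inl .b2) =
    bElem (legOdd (chebD t) (2 * k + 1)) (√2 / 2) 0 := by
  rw [bElem_eq, legOdd_eq, map_smul, map_sub, diagHom_chebD, diagHom_chebD, entry, sqrt_two_mul_eq]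
  module

theorem entry_c2 : entry k t (.inl .c2) =
    bElem (legOdd (chebD t) (2 * k + 1)) (-√2 / 2) 0 := by
  rw [bElem_eq, legOdd_eq, map_smul, map_sub, diagHom_chebD, diagHom_chebD, entry, sqrt_two_mul_eq]
  module

theorem entry_b2bar : entry k t (.inr .b2bar) =
    bElem (legOdd (chebD t) (2 * k + 1)) 0 (√2 / 2) := by
  rw [bElem_eq, legOdd_eq, map_smul, map_sub, diagHom_chebD, diagHom_chebD, entry, sqrt_two_mul_eq]
  module

theorem entry_c2bar : entry k t (.inr .c2bar) =
    bElem (legOdd (chebD t) (2 * k + 1)) 0 (-√2 / 2) := by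
  rw [bElem_eq, legOdd_eq, map_smul, map_sub, diagHom_chebD, diagHom_chebD, entry, sqrt_two_mul_eq]
  module

theorem entry_f : entry k t (.inr .f) = bElem (forkF (chebD t) (2 * k + 1)) 0 0 := by
  rw [bElem_eq, forkF, show (2 * (2 * k + 1 : ℕ) + 2 : ℤ) = ((4 * k +
      4 : ℕ) : ℤ) by push_cast; ring,
    show (2 * (2 * k + 1 : ℕ) + 4 : ℤ) = ((4 * k + 6 : ℕ) : ℤ) by push_cast; ring,
    show (2 * (2 * k + 1 : ℕ) : ℤ) = ((4 * k + 2 : ℕ) : ℤ) by push_cast; ring]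
  simp only [map_smul, map_sub, map_add, diagHom_chebD, entry]
  module

theorem entry_g : entry k t (.inr .g) = bElem (forkG (chebD t) (2 * k + 1)) 0 0 := by
  rw [bElem_eq, forkG,
    show (2 * (2 * k + 1 : ℕ) + 4 : ℤ) = ((4 * k + 6 : ℕ) : ℤ) by push_cast; ring,
    show (2 * (2 * k + 1 : ℕ) : ℤ) = ((4 * k + 2 : ℕ) : ℤ) by push_cast; ring]
  simp only [map_smul, map_sub, diagHom_chebD, entry]
  module

theorem isElem_entry (x : Label k) : IsElem t (left x) (right x) (entry k t x) := by
  rcases x with (j | _ | _ | _ | _ | _ | _) | (j | _ | _ | _ | _)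
  · rw [entry_a]
    have hj := j.2
    rcases Nat.even_or_odd' j.val with ⟨i, hi | hi⟩
    · have : right (k := k) (.inl (.a j)) = 0 := by simp [right, GammaVertex.IsOdd, hi]
      rw [this, hi]
      exact_mod_cast IsElem.evenPath i (by omega)
    · have : right (k := k) (.inl (.a j)) = 1 := by simp [right, GammaVertex.IsOdd, hi]
      rw [this, hi]
      exact_mod_cast IsElem.oddPath i (by omega)
  · rw [entry_b1]
    change IsElem t 0 0 _
    convert IsElem.leg (t := t) 1 1 (by simp) (by simp) using 2 <;> norm_num
  · rw [entry_b2]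
    change IsElem t 0 1 _
    convert IsElem.mid (t := t) 1 (by simp) using 2
    norm_num
  · rw [entry_b3]
    change IsElem t 0 0 _
    convert IsElem.leg (t := t) (-1) 1 (by simp) (by simp) using 2 <;> norm_num
  · rw [entry_c1]
    change IsElem t 0 0 _
    convert IsElem.leg (t := t) 1 (-1) (by simp) (by simp) using 2 <;> norm_num
  · rw [entry_c2]
    change IsElem t 0 1 _
    convert IsElem.mid (t := t) (-1) (by simp) using 2
    norm_num
  · rw [entry_c3]
    change IsElem t 0 0 _
    convert IsElem.leg (t := t) (-1) (-1) (by simp) (by simp) using 2 <;> norm_num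
  · rw [entry_a']
    have hj := j.2
    rcases Nat.even_or_odd' j.val with ⟨i, hi | hi⟩
    · have : right (k := k) (.inr (.a j)) = 1 := by simp [right, GammaVertex'.IsOdd, hi]
      rw [this, hi]
      exact_mod_cast IsElem.evenPath' i (by omega)
    · have : right (k := k) (.inr (.a j)) = 0 := by simp [right, GammaVertex'.IsOdd, hi]
      rw [this, hi]
      exact_mod_cast IsElem.oddPath' i (by omega)
  · rw [entry_f]
    exact IsElem.f
  · rw [entry_g]
    exact IsElem.g
  · rw [entry_b2bar]
    change IsElem t 1 0 _
    convert IsElem.mid' (t := t) 1 (by simp) using 2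
    norm_num
  · rw [entry_c2bar]
    change IsElem t 1 0 _
    convert IsElem.mid' (t := t) (-1) (by simp) using 2
    norm_num

theorem entry_conj (x : Label k) : entry k t (conj x) = star (entry k t x) := by
  rcases x with (j | _ | _ | _ | _ | _ | _) | (j | _ | _ | _ | _)
  · simp only [conj]
    split_ifs <;> simp only [entry_a, entry_a', star_bElem]
  all_goals try simp only [conj, entry_b1, entry_b2, entry_b3, entry_c1, entry_c2, entry_c3,
    entry_f, entry_g, entry_b2bar, entry_c2bar, star_bElem]
  · split_ifs <;> simp only [entry_a, entry_a', star_bElem]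

theorem conj_conj_eq (x : Label k) : conj (conj x) = x := by
  rcases x with (j | _ | _ | _ | _ | _ | _) | (j | _ | _ | _ | _) <;> try rfl
  · simp only [conj]
    split_ifs with h <;> simp [h]
  · simp only [conj]
    split_ifs with h <;> simp [h]

theorem left_conj_eq (x : Label k) : left (conj x) = right x := by
  rcases x with (j | _ | _ | _ | _ | _ | _) | (j | _ | _ | _ | _) <;> try rfl
  · by_cases h : Odd j.val <;> simp [conj, left, right, GammaVertex.IsOdd, h]
  · by_cases h : Odd j.val <;> simp [conj, left, right, GammaVertex'.IsOdd, h]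

theorem right_conj_eq (x : Label k) : right (conj x) = left x := by
  rw [← left_conj_eq, conj_conj_eq]

theorem V_conj (x : Label k) : V k t (conj x) = star (V k t x) := by
  rw [V, V, entry_conj, left_conj_eq, right_conj_eq]
  ext1 i j
  rw [Matrix.star_apply, Matrix.single_apply, Matrix.single_apply]
  simp only [and_comm]
  split_ifs <;> simp

end Entries

/-! ### Orthonormality of `V` -/

section Orthonormal

variable {k : ℕ} {t : Fin (2 * k + 2) → ℝ} (ht : IsRootList k t)

namespace IsForkTrace

variable {D : Type*} [CommRing D] [Algebra ℝ D] {R : ℤ → D} {m : ℕ} {τ : D →ₗ[ℝ] ℝ}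
  (h : IsForkTrace R m τ)
include h

theorem orth_odd (i j : ℕ) (hi : i ≤ m) (hj : j ≤ m) :
    τ (R (2 * i + 1) * R (2 * j + 1)) = if i = j then 1 else 0 := by
  have hone (i : ℕ) : R 1 * R (2 * i + 1) = R (2 * (i + 1 : ℕ)) + R (2 * i) := by
    rw [h.one_mul_eq]
    push_cast
    ring_nf
  have step (i j : ℕ) (hi : i + 1 ≤ m) (hj : j ≤ m) :
      τ (R (2 * i + 1) * R (2 * j + 1)) = if i = j then 1 else 0 := by
    induction j with
    | zero =>
      have e := congrArg τ (hone i)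
      rw [map_add, h.map_even _ hi, h.map_even i (by omega)] at e
      rw [mul_comm, Nat.cast_zero, mul_zero, zero_add, e]
      simp
    | succ j ih =>
      have ih := ih (by omega)
      have e : R (2 * i + 1) * R (2 * (j + 1 : ℕ) + 1) = R (2 * (i + 1 : ℕ)) * R (2 * (j + 1 : ℕ)) +
          R (2 * i) * R (2 * (j + 1 : ℕ)) - R (2 * i + 1) * R (2 * j + 1) := by
        have h1 := h.one_mul_eq (2 * (j + 1 : ℕ))
        rw [show 2 * ((j + 1 : ℕ) : ℤ) - 1 = 2 * j + 1 by push_cast; ring] at h1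
        linear_combination R (2 * (j + 1 : ℕ)) * hone i - R (2 * i + 1) * h1
      rw [e, map_sub, map_add, ih, h.orth _ _ hi hj, h.orth _ _ (by omega) hj]
      simp
  rcases hi.eq_or_lt with rfl | hi
  · rcases hj.eq_or_lt with rfl | hj
    -- At the top index the neighbour `R (2 * m + 2)` is no longer a path vertex but `f + g`, and
    -- one factor `R (2 * m + 1)` is replaced by `R 1 * f`.
    · have e : R (2 * j + 1) * R (2 * j + 1) = forkF R j * forkF R j + forkF R j * forkG R j +
          R (2 * j) * forkF R j := by
        have h1 := hone j
        have h2 := forkF_add_forkG (R := R) (m := j)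
        rw [show 2 * ((j + 1 : ℕ) : ℤ) = 2 * j + 2 by push_cast; ring, h2] at h1
        linear_combination forkF R j * h1 - R (2 * j + 1) * h.one_mul_forkF
      rw [e, map_add, map_add, h.ff, h.fg, h.orth_f j le_rfl]
      simp
    · rw [mul_comm, step j i hj le_rfl]
      simp only [eq_comm]
  · exact step i j hi hj

theorem orth_odd_legOdd (i : ℕ) (hi : i ≤ m) : τ (R (2 * i + 1) * legOdd R m) = 0 := by
  have e := h.odd_mul_legOdd i 1
  simp only [mul_one] at e
  rw [e, map_smul, map_add, mul_sub, mul_sub, map_sub, map_sub, h.orth_f i hi, h.orth_g i hi]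
  rcases hi.eq_or_lt with rfl | hi
  · rw [show 2 * ((i + 1 : ℕ) : ℤ) = 2 * i + 2 by push_cast; ring,
      forkF_add_forkG (R := R) (m := i), add_mul, add_mul, map_add, map_add, h.ff, h.fg, h.gg,
      mul_comm, h.fg]
    simp
  · rw [h.orth_f _ hi, h.orth_g _ hi]
    simp

theorem orth_even_legEven (i : ℕ) (hi : i ≤ m) (φ : ℤ) : τ (R (2 * i) * legEven R m φ) = 0 := by
  rw [map_mul_legEven, h.orth_f i hi, h.orth_g i hi]
  simp

/-- For leg ends of signs `ε`, `ε'` the off-diagonal entries add `ε ε' (1 + φ φ') / 4`, and the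
total `(1 + ε ε') (1 + φ φ') / 4` is 1 or 0. -/
theorem map_legEven_legEven (φ φ' : ℤ) :
    τ (legEven R m φ * legEven R m φ') = (1 + φ * φ') / 4 := by
  rw [map_mul_legEven, mul_comm (legEven R m φ), map_mul_legEven, mul_comm (legEven R m φ),
    map_mul_legEven, mul_comm (forkG R m) (forkF R m), h.ff, h.fg, h.gg]
  ring

end IsForkTrace

include ht

theorem IsRootList.mu_bElem_mul (p q : D k) (c d c' d' : ℝ) :
    mu k t (bElem p c d * bElem q c' d') = trD t (p * q) + (c * d' + d * c') := by
  have h1 : (1 : B k) = bElem 1 0 0 := by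
    refine Prod.ext ?_ rfl
    ext i j
    fin_cases i <;> fin_cases j <;> simp [bElem]
  rw [← mul_one (bElem q c' d'), ← mul_assoc, h1, ht.mu_bElem_mul_mul]
  simp

omit ht in
theorem right_inl_eq_one (v : GammaVertex k) : right (.inl v) = 1 ↔ v.IsOdd := by
  by_cases h : v.IsOdd <;> simp [right, h]

omit ht in
theorem right_inr_eq_one (v : GammaVertex' k) : right (.inr v) = 1 ↔ ¬ v.IsOdd := by
  by_cases h : v.IsOdd <;> simp [right, h]

/-- The elements of `V` are orthonormal. -/
theorem IsRootList.mu_entry_mul_star (x y : Label k) (hl : left x = left y)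
    (hr : right x = right y) :
    mu k t (entry k t x * star (entry k t y)) = if x = y then 1 else 0 := by
  have h := ht.isForkTrace
  have two : √2 * √2 = 2 := Real.mul_self_sqrt (by norm_num)
  -- The names pair a path vertex `a` with another one, a leg end `l`, a middle vertex `m`, or an
  -- end `f`, `g`; primes mark the reversed order.
  have aa (i j : Fin (4 * k + 4)) (hij : (Odd i.val ↔ Odd j.val)) :
      trD t (chebD t i.val * chebD t j.val) = if i = j then 1 else 0 := by
    have hi := i.2
    have hj := j.2
    simp only [Fin.ext_iff]
    rcases Nat.even_or_odd' i.val with ⟨i', hi' | hi'⟩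
    · obtain ⟨j', hj'⟩ : Even j.val := by
        rw [← Nat.not_odd_iff_even, ← hij, Nat.not_odd_iff_even, hi']
        exact even_two_mul i'
      have := h.orth i' j' (by omega) (by omega)
      rw [hi', hj', ← two_mul]
      push_cast
      rw [this]
      simp
    · obtain ⟨j', hj'⟩ : Odd j.val := by
        rw [← hij, hi']
        exact odd_two_mul_add_one i'
      have := h.orth_odd i' j' (by omega) (by omega)
      rw [hi', hj']
      push_cast
      rw [this]
      simp
  have al (i : Fin (4 * k + 4)) (hi : ¬ Odd i.val) (φ : ℤ) :
      trD t (chebD t i.val * legEven (chebD t) (2 * k + 1) φ) = 0 := by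
    have hi2 := i.2
    rw [Nat.not_odd_iff_even] at hi
    obtain ⟨i', hi'⟩ := hi
    have := h.orth_even_legEven i' (by omega) φ
    rw [hi', ← two_mul]
    exact_mod_cast this
  have am (i : Fin (4 * k + 4)) (hi : Odd i.val) :
      trD t (chebD t i.val * legOdd (chebD t) (2 * k + 1)) = 0 := by
    have hi2 := i.2
    obtain ⟨i', hi'⟩ := hi
    have := h.orth_odd_legOdd i' (by omega)
    rw [hi']
    exact_mod_cast this
  have af (i : Fin (4 * k + 4)) (hi : ¬ Odd i.val) :
      trD t (chebD t i.val * forkF (chebD t) (2 * k + 1)) = 0 ∧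
      trD t (chebD t i.val * forkG (chebD t) (2 * k + 1)) = 0 := by
    have hi2 := i.2
    rw [Nat.not_odd_iff_even] at hi
    obtain ⟨i', hi'⟩ := hi
    have h1 := h.orth_f i' (by omega)
    have h2 := h.orth_g i' (by omega)
    rw [hi', ← two_mul]
    exact ⟨by exact_mod_cast h1, by exact_mod_cast h2⟩
  have al' (i : Fin (4 * k + 4)) (hi : ¬ Odd i.val) (φ : ℤ) := al i hi φ
  simp only [mul_comm (chebD t _)] at al'
  have am' (i : Fin (4 * k + 4)) (hi : Odd i.val) := am i hi
  simp only [mul_comm (chebD t _)] at am'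
  have af' (i : Fin (4 * k + 4)) (hi : ¬ Odd i.val) := af i hi
  simp only [mul_comm (chebD t _)] at af'
  have ag (i : Fin (4 * k + 4)) (hi : ¬ Odd i.val) := (af i hi).2
  have ag' (i : Fin (4 * k + 4)) (hi : ¬ Odd i.val) := (af' i hi).2
  replace af (i : Fin (4 * k + 4)) (hi : ¬ Odd i.val) := (af i hi).1
  replace af' (i : Fin (4 * k + 4)) (hi : ¬ Odd i.val) := (af' i hi).1
  have mm : trD t (legOdd (chebD t) (2 * k + 1) * legOdd (chebD t) (2 * k + 1)) = 1 / 2 := by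
    linarith [h.map_legOdd_legOdd]
  have fg' : trD t (forkG (chebD t) (2 * k + 1) * forkF (chebD t) (2 * k + 1)) = 0 := by
    rw [mul_comm (forkG _ _), h.fg]
  have ff := h.ff
  have fg := h.fg
  have gg := h.gg
  have ll := h.map_legEven_legEven
  have hr' : right x = 1 ↔ right y = 1 := by rw [hr]
  rcases x with (i | _ | _ | _ | _ | _ | _) | (i | _ | _ | _ | _) <;>
  rcases y with (j | _ | _ | _ | _ | _ | _) | (j | _ | _ | _ | _) <;>
    first
    | (simp [left] at hl; done)
    | (simp [right, GammaVertex.IsOdd, GammaVertex'.IsOdd] at hr; done)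
    | skip
  all_goals
    simp only [entry_a, entry_a', entry_b1, entry_b2, entry_b3, entry_c1, entry_c2, entry_c3,
      entry_f, entry_g, entry_b2bar, entry_c2bar, star_bElem, ht.mu_bElem_mul]
  all_goals first
    | rw [aa _ _] <;>
      [simp; simpa [right_inl_eq_one, right_inr_eq_one, GammaVertex.IsOdd,
        GammaVertex'.IsOdd] using hr']
    | rw [al _] <;>
      [simp; simpa [right_inl_eq_one, right_inr_eq_one, GammaVertex.IsOdd,
        GammaVertex'.IsOdd] using hr']
    | rw [al' _] <;>
      [simp; simpa [right_inl_eq_one, right_inr_eq_one, GammaVertex.IsOdd,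
        GammaVertex'.IsOdd] using hr']
    | rw [am _] <;>
      [simp; simpa [right_inl_eq_one, right_inr_eq_one, GammaVertex.IsOdd,
        GammaVertex'.IsOdd] using hr']
    | rw [am' _] <;>
      [simp; simpa [right_inl_eq_one, right_inr_eq_one, GammaVertex.IsOdd,
        GammaVertex'.IsOdd] using hr']
    | rw [af _] <;>
      [simp; simpa [right_inl_eq_one, right_inr_eq_one, GammaVertex.IsOdd,
        GammaVertex'.IsOdd] using hr']
    | rw [af' _] <;>
      [simp; simpa [right_inl_eq_one, right_inr_eq_one, GammaVertex.IsOdd,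
        GammaVertex'.IsOdd] using hr']
    | rw [ag _] <;>
      [simp; simpa [right_inl_eq_one, right_inr_eq_one, GammaVertex.IsOdd,
        GammaVertex'.IsOdd] using hr']
    | rw [ag' _] <;>
      [simp; simpa [right_inl_eq_one, right_inr_eq_one, GammaVertex.IsOdd,
        GammaVertex'.IsOdd] using hr']
    | rw [ll]; simp only [Sum.inl.injEq, reduceCtorEq, if_true, if_false]; norm_num
    | rw [ff]; simp
    | rw [fg]; simp
    | rw [fg']; simp
    | rw [gg]; simp
    | rw [mm]; simp only [Sum.inl.injEq, Sum.inr.injEq, reduceCtorEq, if_true, if_false]; linarith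
    | rw [aa _] <;> [simp; (rw [← not_iff_not]; simpa [right_inl_eq_one, right_inr_eq_one,
        GammaVertex.IsOdd, GammaVertex'.IsOdd] using hr')]

end Orthonormal

/-! ### Expansion of products in the family `V` -/

/-- An orthonormal family of the right size gives the coordinates of every vector. -/
theorem eq_sum_of_orthonormal {ι κ E :
    Type*} [Fintype κ] [Fintype ι] [DecidableEq ι] [AddCommGroup E]
    [Module ℝ E] [FiniteDimensional ℝ E] (H : Submodule ℝ E) (ψ : E →ₗ[ℝ] (κ → ℝ))
    (hψ : ∀ b ∈ H, ψ b = 0 → b = 0) (e : ι → E) (he : ∀ i, e i ∈ H) (β : ι → E →ₗ[ℝ] ℝ)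
    (orth : ∀ i j, β j (e i) = if i = j then 1 else 0) (card :
        Fintype.card κ ≤ Fintype.card ι) {b : E}
    (hb : b ∈ H) : b = ∑ i, β i b • e i := by
  have hrank : Module.finrank ℝ H ≤ Fintype.card κ := by
    have := LinearMap.finrank_le_finrank_of_injective (f := ψ.comp H.subtype) (by
      rw [← LinearMap.ker_eq_bot, LinearMap.ker_eq_bot']
      intro v hv
      exact Subtype.ext (hψ v v.2 hv))
    simpa using this
  let e' : ι → H := fun i => ⟨e i, he i⟩
  have hli : LinearIndependent ℝ e' := by
    rw [Fintype.linearIndependent_iff]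
    intro g hg i
    have := congrArg (fun v : H => β i v) hg
    simpa [e', orth] using this
  have hspan := hli.span_eq_top_of_card_eq_finrank'
    (le_antisymm (hli.fintype_card_le_finrank) (hrank.trans card))
  have hmem : (⟨b, hb⟩ : H) ∈ Submodule.span ℝ (Set.range e') := by
    rw [hspan]
    trivial
  rw [Submodule.mem_span_range_iff_exists_fun] at hmem
  obtain ⟨c, hc⟩ := hmem
  have hc' : ∑ i, c i • e i = b := by
    have := congrArg Subtype.val hc
    simpa [e'] using this
  rw [← hc']
  refine Finset.sum_congr rfl fun i _ => ?_
  congr 1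
  simp [orth]

section Span

variable {k : ℕ} {t : Fin (2 * k + 2) → ℝ}

/-- The subspaces of `B k` containing the elements with given labels. -/
def blockSpace (k : ℕ) (i j : Fin 2) : Submodule ℝ (B k) where
  carrier := {b | (i = 1 → b.1 0 1 = 0) ∧ (j = 1 → b.1 1 0 = 0) ∧ (i ≠ j → b.1 0 0 = 0)}
  add_mem' := by
    rintro a b ⟨h1, h2, h3⟩ ⟨g1, g2, g3⟩
    refine ⟨fun h => ?_, fun h => ?_, fun h => ?_⟩
    · simp [h1 h, g1 h]
    · simp [h2 h, g2 h]
    · simp [h3 h, g3 h]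
  zero_mem' := by simp
  smul_mem' := by
    rintro c b ⟨h1, h2, h3⟩
    refine ⟨fun h => ?_, fun h => ?_, fun h => ?_⟩
    · simp [h1 h]
    · simp [h2 h]
    · simp [h3 h]

theorem mem_blockSpace {i j : Fin 2} {b : B k} : b ∈ blockSpace k i j ↔
    (i = 1 → b.1 0 1 = 0) ∧ (j = 1 → b.1 1 0 = 0) ∧ (i ≠ j → b.1 0 0 = 0) := Iff.rfl

/-- On the block `M₂` the four subspaces are all matrices (11), vanishing first column (12),
vanishing first row (21), and diagonal matrices (22). -/
theorem mul_mem_blockSpace {i j l : Fin 2} {a b : B k} (ha : a ∈ blockSpace k i j)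
    (hb : b ∈ blockSpace k j l) : a * b ∈ blockSpace k i l := by
  rw [mem_blockSpace] at *
  obtain ⟨h1, h2, h3⟩ := ha
  obtain ⟨g1, g2, g3⟩ := hb
  simp only [Prod.fst_mul, Matrix.mul_apply, Fin.sum_univ_two]
  fin_cases i <;> fin_cases j <;> fin_cases l <;> simp_all

theorem IsRootList.mem_blockSpace_of_isElem (ht : IsRootList k t) {i j : Fin 2} {b : B k}
    (hb : IsElem t i j b) : b ∈ blockSpace k i j := by
  rw [mem_blockSpace]
  cases hb <;> simp [bElem, chebD_odd_zero, ht.legOdd_zero]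

/-- Coordinates on `B k`, with the given entries of the first block. -/
def coordMap (k : ℕ) {n : ℕ} (F : Fin n → Fin 2 × Fin 2) :
    B k →ₗ[ℝ] (Fin n ⊕ Fin (2 * k + 2) → ℝ) where
  toFun b := Sum.elim (fun s => b.1 (F s).1 (F s).2) b.2
  map_add' a b := by
    ext s
    rcases s with s | s <;> simp
  map_smul' c b := by
    ext s
    rcases s with s | s <;> simp

/-- The labels of the elements spanning `blockSpace k i j`. -/
abbrev BlockLabel (k : ℕ) (i j : Fin 2) : Type := {x : Label k // left x = i ∧ right x = j}

theorem card_le_card_blockLabel {n : ℕ} {i j : Fin 2} (tip : Fin n → Label k)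
    (path : ℕ → Label k) (h1 : ∀ s, left (tip s) = i ∧ right (tip s) = j)
    (h2 : ∀ r < 2 * k + 2, left (path r) = i ∧ right (path r) = j) (htip : tip.Injective)
    (hpath : ∀ r < 2 * k + 2, ∀ r' < 2 * k + 2, path r = path r' → r = r')
    (hne : ∀ s, ∀ r < 2 * k + 2, tip s ≠ path r) :
    Fintype.card (Fin n ⊕ Fin (2 * k + 2)) ≤ Fintype.card (BlockLabel k i j) := by
  refine Fintype.card_le_of_injective (fun s => Sum.rec (fun s => ⟨tip s, h1 s⟩)
    (fun r => ⟨path r, h2 r r.2⟩) s : Fin n ⊕ Fin (2 * k + 2) → BlockLabel k i j) ?_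
  rintro (s | s) (r | r) h <;> rw [Subtype.ext_iff] at h
  · exact congrArg _ (htip h)
  · exact absurd h (hne s r r.2)
  · exact absurd h.symm (hne r s s.2)
  · exact congrArg _ (Fin.ext (hpath s s.2 r r.2 h))

/-- The block `M₂` leaves 4, 2, 2, 2 free entries, matched by the leg vertices or by `f`, `g`. The
other `2k + 2` coordinates are matched by the path vertices of the right parity. -/
theorem exists_coordMap (k : ℕ) (i j : Fin 2) : ∃ (n : ℕ) (F : Fin n → Fin 2 × Fin 2),
    (∀ b ∈ blockSpace k i j, coordMap k F b = 0 → b = 0) ∧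
    Fintype.card (Fin n ⊕ Fin (2 * k + 2)) ≤ Fintype.card (BlockLabel k i j) := by
  have key {n : ℕ} (F : Fin n → Fin 2 × Fin 2) {b : B k} (h : coordMap k F b = 0) :
      b.2 = 0 ∧ ∀ s, b.1 (F s).1 (F s).2 = 0 :=
    ⟨funext fun r => congrFun h (.inr r), fun s => congrFun h (.inl s)⟩
  have ext_zero {b : B k} (h : b.2 = 0) (h00 : b.1 0 0 = 0) (h01 : b.1 0 1 = 0)
      (h10 : b.1 1 0 = 0) (h11 : b.1 1 1 = 0) : b = 0 := by
    refine Prod.ext ?_ h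
    ext r s
    fin_cases r <;> fin_cases s <;> assumption
  have hright (v : GammaVertex k) : right (.inl v) = 0 ↔ ¬ v.IsOdd := by
    by_cases h : v.IsOdd <;> simp [right, h]
  have hright' (v : GammaVertex' k) : right (.inr v) = 0 ↔ v.IsOdd := by
    by_cases h : v.IsOdd <;> simp [right, h]
  -- `Fin.ofNat` reduces modulo `4 * k + 4`, which does nothing on the path indices in range.
  have mod (r : ℕ) (hr : r < 2 * k + 2) : 2 * r % (4 * k + 4) = 2 * r :=
    Nat.mod_eq_of_lt (by omega)
  have mod' (r : ℕ) (hr : r < 2 * k + 2) : (2 * r + 1) % (4 * k + 4) = 2 * r + 1 :=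
    Nat.mod_eq_of_lt (by omega)
  fin_cases i <;> fin_cases j
  · refine ⟨4, ![(0, 0), (0, 1), (1, 0), (1, 1)], fun b _ hb => ?_,
      card_le_card_blockLabel ![.inl .b1, .inl .b3, .inl .c1, .inl .c3]
        (fun r => .inl (.a (Fin.ofNat _ (2 * r)))) ?_ ?_ ?_ ?_ ?_⟩
    · obtain ⟨h, hs⟩ := key _ hb
      exact ext_zero h (hs 0) (hs 1) (hs 2) (hs 3)
    · intro s
      fin_cases s <;> exact ⟨rfl, rfl⟩
    · intro r hr
      simp [left, hright, GammaVertex.IsOdd, mod r hr]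
    · intro s s'
      fin_cases s <;> fin_cases s' <;> simp
    · intro r hr r' hr' h
      simp [Fin.ext_iff, mod r hr, mod r' hr'] at h
      exact h
    · intro s r hr
      fin_cases s <;> simp
  · refine ⟨2, ![(0, 1), (1, 1)], fun b hm hb => ?_,
      card_le_card_blockLabel ![.inl .b2, .inl .c2]
        (fun r => .inl (.a (Fin.ofNat _ (2 * r + 1)))) ?_ ?_ ?_ ?_ ?_⟩
    · obtain ⟨h, hs⟩ := key _ hb
      exact ext_zero h (hm.2.2 (by simp)) (hs 0) (hm.2.1 rfl) (hs 1)
    · intro s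
      fin_cases s <;> exact ⟨rfl, rfl⟩
    · intro r hr
      simp [left, right_inl_eq_one, GammaVertex.IsOdd, mod' r hr]
    · intro s s'
      fin_cases s <;> fin_cases s' <;> simp
    · intro r hr r' hr' h
      simp [Fin.ext_iff, mod' r hr, mod' r' hr'] at h
      exact h
    · intro s r hr
      fin_cases s <;> simp
  · refine ⟨2, ![(1, 0), (1, 1)], fun b hm hb => ?_,
      card_le_card_blockLabel ![.inr .b2bar, .inr .c2bar]
        (fun r => .inr (.a (Fin.ofNat _ (2 * r + 1)))) ?_ ?_ ?_ ?_ ?_⟩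
    · obtain ⟨h, hs⟩ := key _ hb
      exact ext_zero h (hm.2.2 (by simp)) (hm.1 rfl) (hs 0) (hs 1)
    · intro s
      fin_cases s <;> exact ⟨rfl, rfl⟩
    · intro r hr
      simp [left, hright', GammaVertex'.IsOdd, mod' r hr]
    · intro s s'
      fin_cases s <;> fin_cases s' <;> simp
    · intro r hr r' hr' h
      simp [Fin.ext_iff, mod' r hr, mod' r' hr'] at h
      exact h
    · intro s r hr
      fin_cases s <;> simp
  · refine ⟨2, ![(0, 0), (1, 1)], fun b hm hb => ?_,
      card_le_card_blockLabel ![.inr .f, .inr .g]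
        (fun r => .inr (.a (Fin.ofNat _ (2 * r)))) ?_ ?_ ?_ ?_ ?_⟩
    · obtain ⟨h, hs⟩ := key _ hb
      exact ext_zero h (hs 0) (hm.1 rfl) (hm.2.1 rfl) (hs 1)
    · intro s
      fin_cases s <;> exact ⟨rfl, rfl⟩
    · intro r hr
      simp [left, right_inr_eq_one, GammaVertex'.IsOdd, mod r hr]
    · intro s s'
      fin_cases s <;> fin_cases s' <;> simp
    · intro r hr r' hr' h
      simp [Fin.ext_iff, mod r hr, mod r' hr'] at h
      exact h
    · intro s r hr
      fin_cases s <;> simp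

theorem mu_add (a b : B k) : mu k t (a + b) = mu k t a + mu k t b := by
  simp only [mu, Prod.fst_add, Prod.snd_add, Matrix.add_apply, Pi.add_apply, mul_add,
    Finset.sum_add_distrib]
  ring

theorem mu_smul (c : ℝ) (b : B k) : mu k t (c • b) = c * mu k t b := by
  simp only [mu, Prod.smul_fst, Prod.smul_snd, Matrix.smul_apply, Pi.smul_apply, smul_eq_mul,
    mul_add, Finset.mul_sum]
  congr 1
  · ring
  · exact Finset.sum_congr rfl fun j _ => by ring

/-- The inner product with a fixed element, as a linear functional. -/
noncomputable def muMulStar (t : Fin (2 * k + 2) → ℝ) (c : B k) : B k →ₗ[ℝ] ℝ where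
  toFun b := mu k t (b * star c)
  map_add' a b := by rw [add_mul, mu_add]
  map_smul' r b := by rw [smul_mul_assoc, mu_smul, smul_eq_mul, RingHom.id_apply]

theorem muMulStar_apply (c b : B k) : muMulStar t c b = mu k t (b * star c) := rfl

theorem IsRootList.eq_sum_entry (ht : IsRootList k t) {i j : Fin 2} {b : B k}
    (hb : b ∈ blockSpace k i j) : b = ∑ z : Label k with left z = i ∧ right z = j,
      mu k t (b * star (entry k t z)) • entry k t z := by
  obtain ⟨n, F, hF, card⟩ := exists_coordMap k i j
  have h := eq_sum_of_orthonormal (ι := BlockLabel k i j) _ _ hF (fun z => entry k t z.1)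
    (fun z => by
      have := ht.mem_blockSpace_of_isElem (isElem_entry t z.1)
      rwa [z.2.1, z.2.2] at this)
    (fun z => muMulStar t (entry k t z.1))
    (fun x y => by
      rw [muMulStar_apply, ht.mu_entry_mul_star _ _ (x.2.1.trans y.2.1.symm)
        (x.2.2.trans y.2.2.symm)]
      simp only [Subtype.ext_iff]) card hb
  rw [Finset.sum_subtype (p := fun z => left z = i ∧ right z = j) _ (by simp)]
  exact h

end Span

/-! ### The fusion ring and the faithful trace state -/

section Fusion

variable {k : ℕ} {t : Fin (2 * k + 2) → ℝ}

theorem mu_star (b : B k) : mu k t (star b) = mu k t b := by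
  simp [mu, Matrix.star_apply]

/-- The structure constants. -/
noncomputable def structConst (t : Fin (2 * k + 2) → ℝ) (x y z : Label k) : ℕ :=
  -- The floor only serves to land in `ℕ`; on compatible triples its argument is a natural number.
  ⌊mu k t (entry k t x * entry k t y * star (entry k t z))⌋₊

theorem innerMu_single (i j i' j' : Fin 2) (b c : B k) :
    innerMu k t (Matrix.single i j b) (Matrix.single i' j' c) =
      if i = i' ∧ j = j' then mu k t (b * star c) else 0 := by
  have h0 : mu k t 0 = 0 := by simp [mu]
  fin_cases i <;> fin_cases j <;> fin_cases i' <;> fin_cases j' <;>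
    simp [innerMu, Matrix.single_apply, h0]

theorem innerMu_add_left (X Y Z : Matrix (Fin 2) (Fin 2) (B k)) :
    innerMu k t (X + Y) Z = innerMu k t X Z + innerMu k t Y Z := by
  simp only [innerMu, Matrix.add_apply, add_mul, mu_add, Finset.sum_add_distrib]

theorem V_mul_of_eq {x y : Label k} (h : right x = left y) :
    V k t x * V k t y = Matrix.single (left x) (right y) (entry k t x * entry k t y) := by
  rw [V, V, h, Matrix.single_mul_single_same]

theorem V_mul_of_ne {x y : Label k} (h : right x ≠ left y) : V k t x * V k t y = 0 := by
  rw [V, V, Matrix.single_mul_single_of_ne _ _ _ _ h]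

theorem innerMu_mul_of_compatible {x y z : Label k} (h : Compatible left right x y z) :
    innerMu k t (V k t x * V k t y) (V k t z) =
      mu k t (entry k t x * entry k t y * star (entry k t z)) := by
  rw [V_mul_of_eq h.1, V, innerMu_single, if_pos ⟨h.2.1.symm, h.2.2.symm⟩]

theorem entry_unit (i : Fin 2) : entry k t (unit k i) = 1 := by
  fin_cases i <;> simp [unit, entry, RA]

theorem left_unit (i : Fin 2) : left (unit k i) = i := by
  fin_cases i <;> rfl

theorem right_unit (i : Fin 2) : right (unit k i) = i := by
  fin_cases i <;> simp [unit, right, GammaVertex.IsOdd, GammaVertex'.IsOdd]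

variable (ht : IsRootList k t)
include ht

theorem IsRootList.structConst_eq {x y z : Label k} (h : Compatible left right x y z) :
    (structConst t x y z : ℝ) = mu k t (entry k t x * entry k t y * star (entry k t z)) := by
  obtain ⟨h1, h2, h3⟩ := h
  have hx := isElem_entry t x
  have hy := isElem_entry t y
  -- The adjoint of `z` is again an element of `V`, with labels exchanged, so the three factors are
  -- cyclically composable.
  have hz := isElem_entry t (conj z)
  rw [entry_conj, left_conj_eq, right_conj_eq, h2, h3] at hz
  rw [h1] at hx
  obtain ⟨n, hn⟩ := ht.isNat_mu hx hy hz
  rw [structConst, hn, Nat.floor_natCast]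

theorem IsRootList.mu_rotate (x y z : B k) : mu k t (x * y * z) = mu k t (y * z * x) := by
  rw [mul_assoc, ht.mu_mul_comm]

theorem IsRootList.innerMu_V (x y : Label k) :
    innerMu k t (V k t x) (V k t y) = if x = y then 1 else 0 := by
  rw [V, V, innerMu_single]
  by_cases h : left x = left y ∧ right x = right y
  · rw [if_pos h, ht.mu_entry_mul_star _ _ h.1 h.2]
  · rw [if_neg h, if_neg]
    rintro rfl
    exact h ⟨rfl, rfl⟩

theorem IsRootList.linearIndependent_V : LinearIndependent ℤ (V k t) := by
  rw [Fintype.linearIndependent_iff]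
  intro g hg z
  let φ : Matrix (Fin 2) (Fin 2) (B k) →+ ℝ :=
    AddMonoidHom.mk' (fun X => innerMu k t X (V k t z)) fun X Y => innerMu_add_left X Y _
  have h := congrArg φ hg
  rw [map_sum, map_zero] at h
  have hφ (x : Label k) : φ (g x • V k t x) = if x = z then (g x : ℝ) else 0 := by
    rw [map_zsmul]
    change g x • innerMu k t (V k t x) (V k t z) = _
    rw [ht.innerMu_V]
    simp
  simp only [hφ, Finset.sum_ite_eq', Finset.mem_univ, if_true] at h
  exact_mod_cast h

theorem IsRootList.isFusionRing :
    IsFusionRing (V k t) left right conj (unit k) (structConst t) where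
  linearIndependent := ht.linearIndependent_V
  conj_conj := conj_conj_eq
  left_conj := left_conj_eq
  right_conj := right_conj_eq
  mul_eq_sum x y h := by
    have hx := ht.mem_blockSpace_of_isElem (isElem_entry t x)
    rw [h] at hx
    have e := ht.eq_sum_entry
      (mul_mem_blockSpace hx (ht.mem_blockSpace_of_isElem (isElem_entry t y)))
    rw [V_mul_of_eq h, e]
    have hs := map_sum (Matrix.singleAddMonoidHom (α := B k) (left x) (right y))
      (fun z => mu k t (entry k t x * entry k t y * star (entry k t z)) • entry k t z)
      (Finset.univ.filter fun z : Label k => left z = left x ∧ right z = right y)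
    refine hs.trans (Finset.sum_congr rfl fun z hz => ?_)
    rw [Finset.mem_filter] at hz
    obtain ⟨-, h1, h2⟩ := hz
    rw [← ht.structConst_eq ⟨h, h1, h2⟩, V, h1, h2, Matrix.smul_single, Nat.cast_smul_eq_nsmul]
    rfl
  mul_eq_zero x y h := V_mul_of_ne h
  -- The real numbers under the floors agree, by rotation and by invariance of `μ` under
  -- transposition.
  frobenius x y z _ := by
    simp only [structConst, entry_conj, star_star]
    have h1 : mu k t (entry k t x * entry k t y * star (entry k t z)) =
        mu k t (entry k t z * star (entry k t y) * star (entry k t x)) := by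
      rw [← mu_star]
      simp only [star_mul, star_star, mul_assoc]
    have h2 : mu k t (star (entry k t z) * entry k t x * entry k t y) =
        mu k t (entry k t x * entry k t y * star (entry k t z)) := ht.mu_rotate _ _ _
    have h3 : mu k t (entry k t x * entry k t y * star (entry k t z)) =
        mu k t (entry k t y * star (entry k t z) * entry k t x) := ht.mu_rotate _ _ _
    refine ⟨by rw [h1], ?_, ?_, by rw [h2], by rw [h3]⟩
    · rw [h1, ht.mu_rotate, ht.mu_rotate]
    · rw [h1, ht.mu_rotate]
  left_one := left_unit
  right_one := right_unit
  one_mul x := by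
    rw [V_mul_of_eq (right_unit _), left_unit, entry_unit, one_mul, V]
  mul_one x := by
    rw [V_mul_of_eq (left_unit _).symm, right_unit, entry_unit, mul_one, V]

theorem IsRootList.mu_one : mu k t 1 = 1 := by
  have h := ht.mu_entry_mul_star (unit k 0) (unit k 0) rfl rfl
  rwa [entry_unit, star_one, mul_one, if_pos rfl] at h

theorem IsRootList.mu_star_mul_self_pos {b : B k} (hb : b ≠ 0) : 0 < mu k t (star b * b) := by
  have w0 := (ht.weight_pos (a := 0) (by simp [spectrumSet])).1
  have w2 := (ht.weight_pos (a := 2) (by simp [spectrumSet])).1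
  have w (j) := (ht.weight_pos (a := t j) (by simp [spectrumSet])).1
  have e : mu k t (star b * b) = weight k 0 * (b.1 0 0 ^ 2 + b.1 1 0 ^ 2) +
      weight k 2 * (b.1 0 1 ^ 2 + b.1 1 1 ^ 2) + ∑ j, weight k (t j) * b.2 j ^ 2 := by
    simp [mu, Matrix.mul_apply, Matrix.star_apply, sq]
  rw [e]
  have n0 : 0 ≤ weight k 0 * (b.1 0 0 ^ 2 + b.1 1 0 ^ 2) := by positivity
  have n2 : 0 ≤ weight k 2 * (b.1 0 1 ^ 2 + b.1 1 1 ^ 2) := by positivity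
  have nt (j) : 0 ≤ weight k (t j) * b.2 j ^ 2 := mul_nonneg (w j).le (sq_nonneg _)
  have ns : 0 ≤ ∑ j, weight k (t j) * b.2 j ^ 2 := Finset.sum_nonneg fun j _ => nt j
  refine lt_of_le_of_ne (add_nonneg (add_nonneg n0 n2) ns) fun h => hb ?_
  have e0 : b.1 0 0 ^ 2 + b.1 1 0 ^ 2 = 0 :=
    (mul_eq_zero.1 (by linarith : weight k 0 * (b.1 0 0 ^ 2 + b.1 1 0 ^ 2) = 0)).resolve_left w0.ne'
  have e2 : b.1 0 1 ^ 2 + b.1 1 1 ^ 2 = 0 :=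
    (mul_eq_zero.1 (by linarith : weight k 2 * (b.1 0 1 ^ 2 + b.1 1 1 ^ 2) = 0)).resolve_left w2.ne'
  have es : ∑ j, weight k (t j) * b.2 j ^ 2 = 0 := by linarith
  rw [Finset.sum_eq_zero_iff_of_nonneg fun j _ => nt j] at es
  have z {x y : ℝ} (h : x ^ 2 + y ^ 2 = 0) : x = 0 ∧ y = 0 :=
    ⟨pow_eq_zero_iff two_ne_zero |>.1 (by linarith [sq_nonneg x, sq_nonneg y]),
      pow_eq_zero_iff two_ne_zero |>.1 (by linarith [sq_nonneg x, sq_nonneg y])⟩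
  refine Prod.ext ?_ ?_
  · ext i j
    fin_cases i <;> fin_cases j
    · exact (z e0).1
    · exact (z e2).1
    · exact (z e0).2
    · exact (z e2).2
  · ext j
    have := (mul_eq_zero.1 (es j (Finset.mem_univ j))).resolve_left (w j).ne'
    exact pow_eq_zero_iff two_ne_zero |>.1 this

/-! The graphs. -/

/-- If `x α` is the sum of the neighbours of `x`, then the structure constants count edges. -/
theorem IsRootList.structConst_of_sum {ι : Type*} [DecidableEq ι] (emb : ι → Label k)
    (hemb : emb.Injective) {x g : Label k} (s : Finset ι)
    (hs : ∀ y ∈ s, left (emb y) = left x ∧ right (emb y) = right g)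
    (h : entry k t x * entry k t g = ∑ y ∈ s, entry k t (emb y)) (y : ι)
    (hc : Compatible left right x g (emb y)) :
    structConst t x g (emb y) = if y ∈ s then 1 else 0 := by
  have e := ht.structConst_eq hc
  rw [h, Finset.sum_mul] at e
  have hmap := map_sum (muMulStar t (entry k t (emb y))) (fun y => entry k t (emb y)) s
  rw [muMulStar_apply, Finset.sum_mul] at hmap
  rw [hmap, Finset.sum_congr rfl (g := fun y' => if y' = y then (1 : ℝ) else 0)] at e
  · rw [Finset.sum_ite_eq'] at e
    split_ifs at e ⊢
    · exact_mod_cast e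
    · exact_mod_cast e
  · intro y' hy'
    rw [muMulStar_apply, ht.mu_entry_mul_star _ _ ((hs y' hy').1.trans hc.2.1.symm)
      ((hs y' hy').2.trans hc.2.2.symm)]
    simp only [hemb.eq_iff]

end Fusion

section Graphs

variable {k : ℕ} {t : Fin (2 * k + 2) → ℝ}

/-- The block of `A` is `diag(0, √2)`: right multiplication erases the first column and scales the
second by `√2`. -/
theorem bElem_mul_chebD_one (p : D k) (c d : ℝ) :
    bElem p c d * bElem (chebD t 1) 0 0 = bElem (chebD t 1 * p) (c * √2) 0 := by
  refine Prod.ext ?_ ?_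
  · ext i j
    fin_cases i <;> fin_cases j <;>
      simp [bElem, chebD_one_zero, chebD_one_two] <;> ring
  · ext i
    simp [bElem, mul_comm]

theorem bElem_add (p q : D k) (c d c' d' : ℝ) :
    bElem p c d + bElem q c' d' = bElem (p + q) (c + c') (d + d') := by
  refine Prod.ext ?_ ?_
  · ext i j
    fin_cases i <;> fin_cases j <;> simp [bElem, add_mul]
  · ext i
    simp [bElem]

theorem chebD_one_mul (j : ℕ) (hj : j ≠ 0) :
    chebD t 1 * chebD t j = chebD t (j - 1 : ℕ) + chebD t (j + 1 : ℕ) := by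
  rw [(isChebyshev_chebD t).one_mul_eq, Nat.cast_sub (by omega), add_comm]
  rfl

theorem chebD_one_mul_zero : chebD t 1 * chebD t (0 : ℕ) = chebD t (1 : ℕ) := by
  have := (isChebyshev_chebD t).zero
  simp [this]

/-- The neighbours of an even vertex of `Γ_k`. -/
def evenNeighbors (k : ℕ) : GammaVertex k → Finset (GammaVertex k)
  -- The bound fails only at `a n`, an odd vertex, so the default `∅` is never met at even vertices.
  | .a j => if h : j.val + 1 < 4 * k + 4 then
      (if j.val = 0 then {.a ⟨j + 1, h⟩} else {.a ⟨j - 1, by omega⟩, .a ⟨j + 1, h⟩}) else ∅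
  | .b1 => {.a ⟨4 * k + 3, by omega⟩, .b2}
  | .b3 => {.b2}
  | .c1 => {.a ⟨4 * k + 3, by omega⟩, .c2}
  | .c3 => {.c2}
  | _ => ∅

/-- The neighbours of an even vertex of `Γ'_k`. -/
def evenNeighbors' (k : ℕ) : GammaVertex' k → Finset (GammaVertex' k)
  | .a j => if h : j.val + 1 < 4 * k + 4 then
      (if j.val = 0 then {.a ⟨j + 1, h⟩} else {.a ⟨j - 1, by omega⟩, .a ⟨j + 1, h⟩}) else ∅
  | .f => {.a ⟨4 * k + 3, by omega⟩}
  | .g => {.a ⟨4 * k + 3, by omega⟩, .b2bar, .c2bar}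
  | _ => ∅

theorem mem_evenNeighbors {x y : GammaVertex k} (hx : ¬ x.IsOdd) :
    y ∈ evenNeighbors k x ↔ (Gamma k).Adj x y := by
  cases x with
  | a j =>
    have hj : ¬ Odd j.val := hx
    rw [Nat.not_odd_iff_even] at hj
    obtain ⟨i, hi⟩ := hj
    have hlt := j.2
    rw [evenNeighbors, dif_pos (by omega)]
    split_ifs with h0
    · cases y <;> simp [Gamma, GammaEdge, Fin.ext_iff] <;> omega
    · cases y <;> simp [Gamma, GammaEdge, Fin.ext_iff] <;> omega
  | b2 => exact (hx trivial).elim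
  | c2 => exact (hx trivial).elim
  | _ => cases y <;> simp [evenNeighbors, Gamma, GammaEdge, Fin.ext_iff]

theorem mem_evenNeighbors' {x y : GammaVertex' k} (hx : ¬ x.IsOdd) :
    y ∈ evenNeighbors' k x ↔ (Gamma' k).Adj x y := by
  cases x with
  | a j =>
    have hj : ¬ Odd j.val := hx
    rw [Nat.not_odd_iff_even] at hj
    obtain ⟨i, hi⟩ := hj
    have hlt := j.2
    rw [evenNeighbors', dif_pos (by omega)]
    split_ifs with h0
    · cases y <;> simp [Gamma', GammaEdge', Fin.ext_iff] <;> omega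
    · cases y <;> simp [Gamma', GammaEdge', Fin.ext_iff] <;> omega
  | b2bar => exact (hx trivial).elim
  | c2bar => exact (hx trivial).elim
  | _ => cases y <;> simp [evenNeighbors', Gamma', GammaEdge', Fin.ext_iff]

theorem isOdd_of_mem_evenNeighbors {x y : GammaVertex k} (hx : ¬ x.IsOdd)
    (hy : y ∈ evenNeighbors k x) : y.IsOdd := by
  cases x with
  | a j =>
    have hj : ¬ Odd j.val := hx
    rw [Nat.not_odd_iff_even] at hj
    obtain ⟨i, hi⟩ := hj
    rw [evenNeighbors] at hy
    split_ifs at hy with h1 h0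
    · rw [Finset.mem_singleton] at hy
      subst hy
      exact ⟨i, by simp; omega⟩
    · rw [Finset.mem_insert, Finset.mem_singleton] at hy
      rcases hy with rfl | rfl
      · exact ⟨i - 1, by simp; omega⟩
      · exact ⟨i, by simp; omega⟩
    · simp at hy
  | b2 => exact (hx trivial).elim
  | c2 => exact (hx trivial).elim
  | _ =>
    simp [evenNeighbors] at hy
    rcases hy with rfl | rfl <;> simp [GammaVertex.IsOdd, parity_simps]

theorem isOdd_of_mem_evenNeighbors' {x y : GammaVertex' k} (hx : ¬ x.IsOdd)
    (hy : y ∈ evenNeighbors' k x) : y.IsOdd := by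
  cases x with
  | a j =>
    have hj : ¬ Odd j.val := hx
    rw [Nat.not_odd_iff_even] at hj
    obtain ⟨i, hi⟩ := hj
    rw [evenNeighbors'] at hy
    split_ifs at hy with h1 h0
    · rw [Finset.mem_singleton] at hy
      subst hy
      exact ⟨i, by simp; omega⟩
    · rw [Finset.mem_insert, Finset.mem_singleton] at hy
      rcases hy with rfl | rfl
      · exact ⟨i - 1, by simp; omega⟩
      · exact ⟨i, by simp; omega⟩
    · simp at hy
  | b2bar => exact (hx trivial).elim
  | c2bar => exact (hx trivial).elim
  | f =>
    rw [evenNeighbors', Finset.mem_singleton] at hy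
    subst hy
    simp [GammaVertex'.IsOdd, parity_simps]
  | g =>
    simp [evenNeighbors'] at hy
    rcases hy with rfl | rfl | rfl <;> simp [GammaVertex'.IsOdd, parity_simps]

theorem isOdd_of_adj_of_isOdd {x y : GammaVertex k} (h : (Gamma k).Adj x y) (hx : x.IsOdd) :
    ¬ y.IsOdd := by
  cases x <;> cases y <;>
    simp [Gamma, GammaEdge, GammaVertex.IsOdd, Fin.ext_iff] at h hx ⊢
  obtain ⟨i, hi⟩ := hx
  rw [Nat.even_iff]
  omega

theorem isOdd_of_adj_of_isOdd' {x y : GammaVertex' k} (h : (Gamma' k).Adj x y) (hx : x.IsOdd) :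
    ¬ y.IsOdd := by
  cases x <;> cases y <;>
    simp [Gamma', GammaEdge', GammaVertex'.IsOdd, Fin.ext_iff] at h hx ⊢
  obtain ⟨i, hi⟩ := hx
  rw [Nat.even_iff]
  omega

variable (ht : IsRootList k t)
include ht

/-- The diagonal half of `β₁ α = α_n + β₂` and of `γ₁ α = α_n + γ₂`; the off-diagonal half is in
`bElem_mul_chebD_one`. -/
theorem IsRootList.one_mul_legEven_one :
    chebD t 1 * legEven (chebD t) (2 * k + 1) 1 =
      chebD t (4 * k + 3 : ℕ) + legOdd (chebD t) (2 * k + 1) := by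
  have hf := ht.isForkTrace.one_mul_forkF
  have hg := ht.isForkTrace.one_mul_forkG
  rw [legEven, legOdd, forkH, mul_smul_comm, mul_add, mul_smul_comm, hf, hg,
    show ((4 * k + 3 : ℕ) : ℤ) = 2 * (2 * k + 1 : ℕ) + 1 by push_cast; ring]
  push_cast
  module

theorem IsRootList.one_mul_legEven_neg_one :
    chebD t 1 * legEven (chebD t) (2 * k + 1) (-1) = legOdd (chebD t) (2 * k + 1) := by
  have hf := ht.isForkTrace.one_mul_forkF
  have hg := ht.isForkTrace.one_mul_forkG
  rw [legEven, legOdd, forkH, mul_smul_comm, mul_add, mul_smul_comm, hf, hg]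
  push_cast
  module

theorem IsRootList.one_mul_forkF_eq : chebD t 1 * forkF (chebD t) (2 * k + 1) =
    chebD t (4 * k + 3 : ℕ) := by
  rw [ht.isForkTrace.one_mul_forkF]
  push_cast
  ring_nf

theorem IsRootList.one_mul_forkG_eq : chebD t 1 * forkG (chebD t) (2 * k + 1) =
    chebD t (4 * k + 3 : ℕ) + (legOdd (chebD t) (2 * k + 1) + legOdd (chebD t) (2 * k + 1)) := by
  rw [ht.isForkTrace.one_mul_forkG, legOdd, forkH,
    show ((4 * k + 3 : ℕ) : ℤ) = 2 * (2 * k + 1 : ℕ) + 1 by push_cast; ring]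
  push_cast
  module

theorem IsRootList.entry_mul_alpha {x : GammaVertex k} (hx : ¬ x.IsOdd) :
    entry k t (.inl x) * entry k t (alpha k) = ∑ y ∈ evenNeighbors k x, entry k t (.inl y) := by
  have e : entry k t (alpha k) = bElem (chebD t 1) 0 0 := by
    rw [alpha, entry_a]
    simp
  rw [e]
  cases x with
  | a j =>
    have hj : ¬ Odd j.val := hx
    rw [Nat.not_odd_iff_even] at hj
    obtain ⟨i, hi⟩ := hj
    have hlt := j.2
    rw [evenNeighbors, dif_pos (by omega), entry_a, bElem_mul_chebD_one]
    split_ifs with h0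
    · rw [Finset.sum_singleton, entry_a, zero_mul]
      congr 1
      simp only [h0, zero_add]
      exact chebD_one_mul_zero
    · rw [Finset.sum_pair (by simp), entry_a, entry_a, chebD_one_mul _ h0, bElem_add]
      simp
  | b1 =>
    rw [evenNeighbors, Finset.sum_pair (by simp), entry_a, entry_b1, entry_b2,
      bElem_mul_chebD_one, ht.one_mul_legEven_one, bElem_add]
    congr 1 <;> ring
  | b2 => exact (hx trivial).elim
  | b3 =>
    rw [evenNeighbors, Finset.sum_singleton, entry_b3, entry_b2,
      bElem_mul_chebD_one, ht.one_mul_legEven_neg_one]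
    congr 1
    ring
  | c1 =>
    rw [evenNeighbors, Finset.sum_pair (by simp), entry_a, entry_c1, entry_c2,
      bElem_mul_chebD_one, ht.one_mul_legEven_one, bElem_add]
    congr 1 <;> ring
  | c2 => exact (hx trivial).elim
  | c3 =>
    rw [evenNeighbors, Finset.sum_singleton, entry_c3, entry_c2,
      bElem_mul_chebD_one, ht.one_mul_legEven_neg_one]
    congr 1
    ring

theorem IsRootList.entry_mul_alphaBar {x : GammaVertex' k} (hx : ¬ x.IsOdd) :
    entry k t (.inr x) * entry k t (alphaBar k) =
      ∑ y ∈ evenNeighbors' k x, entry k t (.inr y) := by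
  have e : entry k t (alphaBar k) = bElem (chebD t 1) 0 0 := by
    rw [alphaBar, entry_a']
    simp
  rw [e]
  cases x with
  | a j =>
    have hj : ¬ Odd j.val := hx
    rw [Nat.not_odd_iff_even] at hj
    obtain ⟨i, hi⟩ := hj
    have hlt := j.2
    rw [evenNeighbors', dif_pos (by omega), entry_a', bElem_mul_chebD_one]
    split_ifs with h0
    · rw [Finset.sum_singleton, entry_a', zero_mul]
      congr 1
      simp only [h0, zero_add]
      exact chebD_one_mul_zero
    · rw [Finset.sum_pair (by simp), entry_a', entry_a', chebD_one_mul _ h0, bElem_add]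
      simp
  | f =>
    rw [evenNeighbors', Finset.sum_singleton, entry_a', entry_f, bElem_mul_chebD_one,
      ht.one_mul_forkF_eq]
    simp
  | g =>
    rw [evenNeighbors', Finset.sum_insert (by simp), Finset.sum_pair (by simp), entry_a', entry_g,
      entry_b2bar, entry_c2bar, bElem_mul_chebD_one, ht.one_mul_forkG_eq, bElem_add, bElem_add]
    congr 1 <;> ring
  | b2bar => exact (hx trivial).elim
  | c2bar => exact (hx trivial).elim

omit ht in
theorem compatible_alpha {x y : GammaVertex k} :
    Compatible left right (.inl x) (alpha k) (.inl y) ↔ ¬ x.IsOdd ∧ y.IsOdd := by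
  have h1 : right (alpha k) = 1 := by simp [alpha, right_inl_eq_one, GammaVertex.IsOdd]
  rw [Compatible, h1, right_inl_eq_one, ← right_inl_eq_one x]
  simp only [alpha, left, true_and]
  constructor <;> rintro ⟨h, h'⟩ <;> refine ⟨?_, h'⟩ <;> omega

omit ht in
theorem compatible_alphaBar {x y : GammaVertex' k} :
    Compatible left right (.inr x) (alphaBar k) (.inr y) ↔ ¬ x.IsOdd ∧ y.IsOdd := by
  have h1 : right (alphaBar k) = 0 := by simp [alphaBar, right, GammaVertex'.IsOdd]
  have hx := right_inr_eq_one x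
  have hy := right_inr_eq_one y
  rw [Compatible, h1, ← hx]
  simp only [alphaBar, left, true_and]
  have hy' : right (.inr y) = 0 ↔ y.IsOdd := by
    rw [← not_iff_not, ← hy]
    omega
  rw [hy']

theorem IsRootList.structConst_alpha {x y : GammaVertex k} (hx : ¬ x.IsOdd) (hy : y.IsOdd) :
    structConst t (.inl x) (alpha k) (.inl y) = if y ∈ evenNeighbors k x then 1 else 0 :=
  ht.structConst_of_sum Sum.inl Sum.inl_injective _
    (fun _ hy' => (compatible_alpha.2 ⟨hx, isOdd_of_mem_evenNeighbors hx hy'⟩).2)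
    (ht.entry_mul_alpha hx) y (compatible_alpha.2 ⟨hx, hy⟩)

theorem IsRootList.structConst_alphaBar {x y : GammaVertex' k} (hx : ¬ x.IsOdd) (hy : y.IsOdd) :
    structConst t (.inr x) (alphaBar k) (.inr y) = if y ∈ evenNeighbors' k x then 1 else 0 :=
  ht.structConst_of_sum Sum.inr Sum.inr_injective _
    (fun _ hy' => (compatible_alphaBar.2 ⟨hx, isOdd_of_mem_evenNeighbors' hx hy'⟩).2)
    (ht.entry_mul_alphaBar hx) y (compatible_alphaBar.2 ⟨hx, hy⟩)

open Classical in
theorem IsRootList.edgeCount_alpha (x y : GammaVertex k) :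
    edgeCount left right (structConst t) (alpha k) (.inl x) (.inl y) =
      if (Gamma k).Adj x y then 1 else 0 := by
  rw [edgeCount]
  simp only [compatible_alpha]
  by_cases hx : x.IsOdd <;> by_cases hy : y.IsOdd
  · rw [if_neg (by tauto), if_neg (by tauto), if_neg]
    exact fun h => isOdd_of_adj_of_isOdd h hx hy
  · rw [if_neg (by tauto), if_pos ⟨hy, hx⟩, ht.structConst_alpha hy hx]
    simp only [mem_evenNeighbors hy, (Gamma k).adj_comm y x]
  · rw [if_pos ⟨hx, hy⟩, ht.structConst_alpha hx hy]
    simp only [mem_evenNeighbors hx]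
  · rw [if_neg (by tauto), if_neg (by tauto), if_neg]
    exact fun h => hy (isOdd_of_mem_evenNeighbors hx ((mem_evenNeighbors hx).2 h))

open Classical in
theorem IsRootList.edgeCount_alphaBar (x y : GammaVertex' k) :
    edgeCount left right (structConst t) (alphaBar k) (.inr x) (.inr y) =
      if (Gamma' k).Adj x y then 1 else 0 := by
  rw [edgeCount]
  simp only [compatible_alphaBar]
  by_cases hx : x.IsOdd <;> by_cases hy : y.IsOdd
  · rw [if_neg (by tauto), if_neg (by tauto), if_neg]
    exact fun h => isOdd_of_adj_of_isOdd' h hx hy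
  · rw [if_neg (by tauto), if_pos ⟨hy, hx⟩, ht.structConst_alphaBar hy hx]
    simp only [mem_evenNeighbors' hy, (Gamma' k).adj_comm y x]
  · rw [if_pos ⟨hx, hy⟩, ht.structConst_alphaBar hx hy]
    simp only [mem_evenNeighbors' hx]
  · rw [if_neg (by tauto), if_neg (by tauto), if_neg]
    exact fun h => hy (isOdd_of_mem_evenNeighbors' hx ((mem_evenNeighbors' hx).2 h))

end Graphs

end GraphFusion

open Classical in
theorem theorem3p7 (k : ℕ) :
    -- `q_k` has `2k + 2` distinct real roots, so that the construction below is not vacuous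
    (∃ t : Fin (2 * k + 2) → ℝ, IsRootList k t) ∧
    ∀ t : Fin (2 * k + 2) → ℝ, IsRootList k t →
      -- the roots are positive and different from `2`
      (∀ j, 0 < t j ∧ t j ≠ 2) ∧
      -- `μ` is a faithful trace state on `𝓑`
      (mu k t 1 = 1 ∧ (∀ b c : B k, mu k t (b * c) = mu k t (c * b)) ∧
        ∀ b : B k, b ≠ 0 → 0 < mu k t (star b * b)) ∧
      -- conjugation on `V` is the adjoint (the transpose) in `M₂(𝓑)`
      (∀ x : Label k, V k t (conj x) = star (V k t x)) ∧
      ∃ N : Label k → Label k → Label k → ℕ,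
        -- `ℤV` is a fusion ring with structure constants `N` and units `α₀`, `α'₀`
        IsFusionRing (V k t) left right conj (unit k) N ∧
        (∀ x y z : Label k, Compatible left right x y z →
          (N x y z : ℝ) = innerMu k t (V k t x * V k t y) (V k t z)) ∧
        -- right multiplication by `α` gives `Γ_k`, right multiplication by `ᾱ` gives `Γ'_k`
        (∀ x y : GammaVertex k, edgeCount left right N (alpha k) (.inl x) (.inl y) =
          if (Gamma k).Adj x y then 1 else 0) ∧
        (∀ x y : GammaVertex' k, edgeCount left right N (alphaBar k) (.inr x) (.inr y) =
          if (Gamma' k).Adj x y then 1 else 0) := by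
  refine ⟨exists_isRootList k, fun t ht => ⟨fun j => ⟨ht.pos j, ht.ne_two j⟩,
    ⟨ht.mu_one, ht.mu_mul_comm, fun b hb => ht.mu_star_mul_self_pos hb⟩, V_conj t, structConst t,
    ht.isFusionRing, fun x y z h => ?_, ht.edgeCount_alpha, ht.edgeCount_alphaBar⟩⟩
  rw [ht.structConst_eq h, innerMu_mul_of_compatible h]
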